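/- Let $\mathbb{T}^2=\mathbb{R}/\mathbb{Z}\times\mathbb{R}/\mathbb{Z}$, let $\mu$ be Lebesgue measure on $\mathbb{T}^2$, let $\mathrm{Diff}^\infty(\mathbb{T}^2,\mu)$ be the group of $\mu$-preserving $C^\infty$ diffeomorphisms of $\mathbb{T}^2$ with its $C^\infty$ topology, and let $S_t(x_1,x_2)=(x_1+t,x_2)$. A diffeomorphism $T\in\mathrm{Diff}^\infty(\mathbb{T}^2,\mu)$ is said to be constructed by the approximation by conjugation (AbC, or Anosov–Katok) method if $$T=\lim_{n\to\infty}H_n\circ S_{\alpha_{n+1}}\circ H_n^{-1}\quad\text{in the } C^\infty \text{ topology},\qquad H_n=h_1\circ\cdots\circ h_n,$$ where $h_n\in\mathrm{Diff}^\infty(\mathbb{T}^2,\mu)$ satisfies $h_n\circ S_{\alpha_n}=S_{\alpha_n}\circ h_n$ and $\alpha_n=p_n/q_n$ are rational numbers with $p_{n+1}=k_nl_nq_np_n+1$ and $q_{n+1}=k_nl_nq_n^2$ for some positive integers $k_n,l_n$. A point $x\in\mathbb{T}^2$ is generic for $T$ if $\frac1N\sum_{i=0}^{N-1}\phi(T^ix)\to\int\phi\,d\mu$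 as $N\to\infty$ for every continuous $\phi:\mathbb{T}^2\to\mathbb{R}$. **Theorem D.** For every $1<\alpha<2$ there is a diffeomorphism $T\in\mathrm{Diff}^\infty(\mathbb{T}^2,\mu)$ constructed by the AbC method such that the set $B_\alpha$ of all generic points of $T$ satisfies $\mu(B_\alpha)=0$ and $$\alpha-1\le\dim_H(B_\alpha)\le\alpha .$$ -/

import Mathlib

open MeasureTheory Filter Topology
open scoped ContDiff ENNReal

/-- The two-torus `ℝ/ℤ × ℝ/ℤ`; its `volume` is normalized Lebesgue measure and its metric is a
product metric, bi-Lipschitz equivalent to the flat Euclidean one. -/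
abbrev Torus : Type := UnitAddCircle × UnitAddCircle

namespace Torus

/-- The universal covering map `ℝ² → 𝕋²`. -/
def proj (z : ℝ × ℝ) : Torus := ((z.1 : UnitAddCircle), (z.2 : UnitAddCircle))

/-- `F : ℝ² → ℝ²` is a smooth lift of the torus map `f`. -/
def IsSmoothLift (f : Torus → Torus) (F : ℝ × ℝ → ℝ × ℝ) : Prop :=
  ContDiff ℝ ∞ F ∧ ∀ z, proj (F z) = f (proj z)

/-- Smoothness of a torus self-map: since the covering map is a local diffeomorphism and the plane
is simply connected, this is the existence of a smooth lift. -/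
def IsSmooth (f : Torus → Torus) : Prop :=
  ∃ F, IsSmoothLift f F

/-- `Diff^∞(𝕋², μ)`: smooth diffeomorphisms of the torus that preserve Lebesgue measure. -/
def IsSmoothAreaPreservingDiffeo (T : Equiv.Perm Torus) : Prop :=
  IsSmooth T ∧ IsSmooth T.symm ∧ MeasurePreserving T volume volume

/-- Convergence of torus maps, uniformly with all derivatives (of suitable smooth lifts). -/
def SmoothTendsto (f : ℕ → Torus → Torus) (g : Torus → Torus) : Prop :=
  ∃ (F : ℕ → ℝ × ℝ → ℝ × ℝ) (G : ℝ × ℝ → ℝ × ℝ),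
    (∀ n, IsSmoothLift (f n) (F n)) ∧ IsSmoothLift g G ∧
    ∀ k : ℕ, ∀ ε > 0, ∀ᶠ n in atTop, ∀ z, ‖iteratedFDeriv ℝ k (F n - G) z‖ < ε

/-- Convergence in the `C^∞` topology of the group of diffeomorphisms: the maps and their
inverses converge uniformly with all derivatives. -/
def DiffeoTendsto (T' : ℕ → Equiv.Perm Torus) (T : Equiv.Perm Torus) : Prop :=
  SmoothTendsto (fun n => T' n) T ∧ SmoothTendsto (fun n => (T' n).symm) T.symm

/-- The circle action `S_t (x₁, x₂) = (x₁ + t, x₂)`. -/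
def rotation (t : ℝ) : Equiv.Perm Torus :=
  (Equiv.addRight (t : UnitAddCircle)).prodCongr (Equiv.refl UnitAddCircle)

/-- `H₀ = id`, `Hₙ₊₁ = Hₙ ∘ hₙ`, that is, `Hₙ = h₀ ∘ ⋯ ∘ hₙ₋₁`. -/
def conjugacy (h : ℕ → Equiv.Perm Torus) : ℕ → Equiv.Perm Torus
  | 0 => 1
  | n + 1 => conjugacy h n * h n

/-- `T` is obtained by the approximation-by-conjugation (Anosov–Katok) method: there are
area-preserving smooth diffeomorphisms `hₙ` commuting with `S_{αₙ}`, where `αₙ = pₙ / qₙ`,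
`pₙ₊₁ = kₙ lₙ qₙ pₙ + 1` and `qₙ₊₁ = kₙ lₙ qₙ²`, such that, with `Hₙ₊₁ = h₀ ∘ ⋯ ∘ hₙ`, the periodic
maps `Hₙ₊₁ ∘ S_{αₙ₊₁} ∘ Hₙ₊₁⁻¹` converge to `T` in the `C^∞` topology. -/
def IsAbC (T : Equiv.Perm Torus) : Prop :=
  ∃ (h : ℕ → Equiv.Perm Torus) (p : ℕ → ℤ) (q k l : ℕ → ℕ),
    (∀ n, IsSmoothAreaPreservingDiffeo (h n)) ∧
    (∀ n, 0 < q n) ∧ (∀ n, 0 < k n) ∧ (∀ n, 0 < l n) ∧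
    (∀ n, p (n + 1) = k n * l n * q n * p n + 1) ∧
    (∀ n, q (n + 1) = k n * l n * q n ^ 2) ∧
    (∀ n, rotation (p n / q n) * h n = h n * rotation (p n / q n)) ∧
    DiffeoTendsto
      (fun n => conjugacy h (n + 1) * rotation (p (n + 1) / q (n + 1)) *
        (conjugacy h (n + 1))⁻¹) T

/-- The set of points of the torus that are generic for Lebesgue measure under `T` (the torus is
compact, so all continuous functions have compact support). -/
def genericPoints (T : Torus → Torus) : Set Torus :=
  {x | ∀ φ : C(Torus, ℝ),
    Tendsto (fun N : ℕ => (1 / (N : ℝ)) * ∑ i ∈ Finset.range N, φ (T^[i] x)) atTop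
      (𝓝 (∫ y, φ y))}

end Torus

/-! The diffeomorphism is built so that a whole vertical segment consists of generic points, while
every generic point lies in infinitely many very thin neighbourhoods of curves. The segment gives
dimension at least `1`, which exceeds `α - 1`; the thin neighbourhoods give measure zero and
dimension at most `α`.

Write `Hₙ` for the conjugacy of stage `n` and `Rₙ` for the next conjugating map, so that `Hₙ₊₁ = Hₙ
Rₙ`. The map `Rₙ` is the identity off `cross qₙ (1 / Kₙ)`, a neighbourhood of the circles `x ∈ (1 /
qₙ) ℤ` and `y = 0`, and `Kₙ` is chosen after `Hₙ`. If `Hₙ⁻¹ x` eventually avoids the crosses, it is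
a constant point from some `n₀` on. Up to time `qₙ` the orbit of `x` then follows the `Hₙ`-image of
one horizontal circle, most of which is still its `Hₙ₀`-image, so `x` is not generic
(`notMem_genericPoints`). Generic points therefore lie in the limsup of the sets `Hₙ (cross qₙ (1 /
Kₙ))`. Their areas are summable, and each is covered by `(qₙ + 1) Kₙ` sets of diameter at most `2 Lₙ
/ Kₙ`, with `Lₙ` a Lipschitz constant of `Hₙ`; since `α > 1`, a large `Kₙ` makes the `α`-sums
summable, and Borel–Cantelli for Hausdorff measure concludes.

Genericity of the segment comes from `exists_winding_diffeo`. Near height `0`, a horizontal circle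
is sent to a curve that crosses the segment, rests at its height there for a short while, and then
winds quickly around the vertical direction. The orbit of a segment point under stage `n + 1` drifts
slowly along this curve, and each `qₙ` steps sample a full horizontal circle. While the curve rests,
the averages are good by the previous stage; once it winds, they are good by Fubini. The error is
thus small relative to the elapsed time at every time, not only at the end of a period, and the time
windows of consecutive stages cover all large times (`segment_mem_genericPoints`).

Convergence is the usual argument: `Rₙ` commutes with the rotation by `pₙ / qₙ`, so consecutive
approximants differ only by a rotation increment `1 / (lₙ qₙ²)`, and `lₙ` is chosen last. -/

namespace Torus

/-! ### The covering of the torus and the group of liftable area-preserving diffeomorphisms. -/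

instance : IsProbabilityMeasure (volume : Measure UnitAddCircle) :=
  ⟨UnitAddCircle.measure_univ⟩

instance : IsProbabilityMeasure (volume : Measure Torus) :=
  inferInstanceAs (IsProbabilityMeasure ((volume : Measure UnitAddCircle).prod volume))

theorem proj_add_int (z : ℝ × ℝ) (m n : ℤ) : proj (z + ((m : ℝ), (n : ℝ))) = proj z := by
  have h (k : ℤ) : ((k : ℝ) : UnitAddCircle) = 0 :=
    (AddCircle.coe_eq_zero_iff 1).2 ⟨k, by simp⟩
  simp only [proj, Prod.fst_add, Prod.snd_add, AddCircle.coe_add, h, add_zero]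

theorem proj_eq_iff {z w : ℝ × ℝ} :
    proj z = proj w ↔ ∃ m n : ℤ, w = z + ((m : ℝ), (n : ℝ)) := by
  constructor
  · intro h
    have h1 := congrArg Prod.fst h
    have h2 := congrArg Prod.snd h
    simp only [proj] at h1 h2
    rw [eq_comm, ← sub_eq_zero, ← AddCircle.coe_sub, AddCircle.coe_eq_zero_iff] at h1 h2
    obtain ⟨m, hm⟩ := h1
    obtain ⟨n, hn⟩ := h2
    refine ⟨m, n, Prod.ext ?_ ?_⟩
    · simp only [zsmul_eq_mul, mul_one] at hm
      simp [hm]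
    · simp only [zsmul_eq_mul, mul_one] at hn
      simp [hn]
  · rintro ⟨m, n, rfl⟩
    exact (proj_add_int z m n).symm

theorem proj_surjective : Function.Surjective proj := by
  rintro ⟨x, y⟩
  obtain ⟨x, rfl⟩ := QuotientAddGroup.mk_surjective x
  obtain ⟨y, rfl⟩ := QuotientAddGroup.mk_surjective y
  exact ⟨(x, y), rfl⟩

theorem continuous_proj : Continuous proj := by
  unfold proj
  exact ((AddCircle.continuous_mk' 1).comp continuous_fst).prodMk
    ((AddCircle.continuous_mk' 1).comp continuous_snd)

theorem _root_.UnitAddCircle.dist_coe_le (x y : ℝ) :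
    dist (x : UnitAddCircle) (y : UnitAddCircle) ≤ dist x y := by
  rw [dist_eq_norm, ← AddCircle.coe_sub, UnitAddCircle.norm_eq, Real.dist_eq]
  simpa using round_le (x - y) 0

theorem dist_proj_le (z w : ℝ × ℝ) : dist (proj z) (proj w) ≤ dist z w := by
  simp only [Prod.dist_eq, proj]
  exact max_le_max (UnitAddCircle.dist_coe_le _ _) (UnitAddCircle.dist_coe_le _ _)

/-- The torus distance is attained by the nearest lift, found by rounding each coordinate. This
transfers Lipschitz bounds from a lift to the torus map. -/
theorem exists_proj_eq_dist_eq (z : ℝ × ℝ) (b : Torus) :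
    ∃ w, proj w = b ∧ dist z w = dist (proj z) b := by
  obtain ⟨w, rfl⟩ := proj_surjective b
  refine ⟨w + (((round (z.1 - w.1) : ℤ) : ℝ), ((round (z.2 - w.2) : ℤ) : ℝ)),
    proj_add_int _ _ _, ?_⟩
  simp only [Prod.dist_eq, proj, Prod.fst_add, Prod.snd_add, Real.dist_eq]
  congr 1
  · rw [dist_eq_norm, ← AddCircle.coe_sub, UnitAddCircle.norm_eq, ← sub_sub]
  · rw [dist_eq_norm, ← AddCircle.coe_sub, UnitAddCircle.norm_eq, ← sub_sub]

/-- A continuous `ℤ²`-periodic function on the plane is bounded. -/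
theorem exists_norm_le_of_periodic {E : Type*} [SeminormedAddCommGroup E] {f : ℝ × ℝ → E}
    (hf : Continuous f) (hp : ∀ z (m n : ℤ), f (z + ((m : ℝ), (n : ℝ))) = f z) :
    ∃ C : ℝ, 0 ≤ C ∧ ∀ z, ‖f z‖ ≤ C := by
  have hK : IsCompact (Set.Icc (0 : ℝ) 1 ×ˢ Set.Icc (0 : ℝ) 1) := isCompact_Icc.prod isCompact_Icc
  obtain ⟨C, hC⟩ := hK.exists_bound_of_continuousOn hf.continuousOn
  refine ⟨max C 0, le_max_right _ _, fun z => ?_⟩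
  have h := hp (Int.fract z.1, Int.fract z.2) ⌊z.1⌋ ⌊z.2⌋
  have hz : ((Int.fract z.1, Int.fract z.2) : ℝ × ℝ) + ((⌊z.1⌋ : ℝ), (⌊z.2⌋ : ℝ)) = z := by
    ext <;> simp
  rw [hz] at h
  rw [h]
  refine (hC _ ⟨⟨Int.fract_nonneg _, (Int.fract_lt_one _).le⟩,
    ⟨Int.fract_nonneg _, (Int.fract_lt_one _).le⟩⟩).trans (le_max_left _ _)

/-- `F` commutes with the deck transformations of the covering `ℝ² → 𝕋²`. -/
def IsEquivariant (F : ℝ × ℝ → ℝ × ℝ) : Prop :=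
  ∀ z (m n : ℤ), F (z + ((m : ℝ), (n : ℝ))) = F z + ((m : ℝ), (n : ℝ))

theorem IsEquivariant.fderiv_periodic {F : ℝ × ℝ → ℝ × ℝ} (h : IsEquivariant F) (z : ℝ × ℝ)
    (m n : ℤ) : fderiv ℝ F (z + ((m : ℝ), (n : ℝ))) = fderiv ℝ F z := by
  have h1 : (fun z => F (z + ((m : ℝ), (n : ℝ)))) = fun z => F z + ((m : ℝ), (n : ℝ)) :=
    funext fun z => h z m n
  have h2 := congrArg (fun G => fderiv ℝ G z) h1
  simpa [fderiv_comp_add_right, fderiv_add_const] using h2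

theorem IsEquivariant.exists_lipschitz {F : ℝ × ℝ → ℝ × ℝ} (h : IsEquivariant F)
    (hF : ContDiff ℝ ∞ F) : ∃ C : ℝ, 0 ≤ C ∧ ∀ z w, dist (F z) (F w) ≤ C * dist z w := by
  obtain ⟨C, hC0, hC⟩ := exists_norm_le_of_periodic (hF.continuous_fderiv (by simp))
    h.fderiv_periodic
  have hl : LipschitzWith ⟨C, hC0⟩ F :=
    lipschitzWith_of_nnnorm_fderiv_le (hF.differentiable (by simp)) (fun z => hC z)
  exact ⟨C, hC0, fun z w => hl.dist_le_mul z w⟩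

/-- Pairs of a `ℤ²`-equivariant diffeomorphism of the plane and the area-preserving diffeomorphism
of the torus that it lifts. -/
def liftGroup : Subgroup (Equiv.Perm (ℝ × ℝ) × Equiv.Perm Torus) where
  carrier := {P | (ContDiff ℝ ∞ P.1 ∧ ContDiff ℝ ∞ P.1.symm) ∧ IsEquivariant P.1 ∧
    (∀ z, proj (P.1 z) = P.2 (proj z)) ∧
    MeasurePreserving P.2 volume volume ∧ MeasurePreserving P.2.symm volume volume}
  one_mem' := ⟨⟨contDiff_id, contDiff_id⟩, fun _ _ _ => rfl, fun _ => rfl,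
    MeasurePreserving.id _, MeasurePreserving.id _⟩
  mul_mem' := by
    rintro P Q ⟨⟨h1, h2⟩, h3, h4, h5, h6⟩ ⟨⟨k1, k2⟩, k3, k4, k5, k6⟩
    refine ⟨⟨h1.comp k1, k2.comp h2⟩, fun z m n => ?_, fun z => ?_, h5.comp k5, k6.comp h6⟩
    · simp only [Prod.fst_mul, Equiv.Perm.mul_apply, k3 z m n, h3 _ m n]
    · simp only [Prod.fst_mul, Prod.snd_mul, Equiv.Perm.mul_apply, h4, k4]
  inv_mem' := by
    rintro P ⟨⟨h1, h2⟩, h3, h4, h5, h6⟩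
    refine ⟨⟨h2, h1⟩, fun z m n => ?_, fun z => ?_, h6, h5⟩
    · change P.1.symm _ = P.1.symm z + _
      rw [Equiv.symm_apply_eq, h3, Equiv.apply_symm_apply]
    · change proj (P.1.symm z) = P.2.symm (proj z)
      rw [Equiv.eq_symm_apply, ← h4, Equiv.apply_symm_apply]

theorem lipschitz_of_mem_liftGroup {P : Equiv.Perm (ℝ × ℝ) × Equiv.Perm Torus}
    (hP : P ∈ liftGroup) :
    ∃ C : ℝ, 0 ≤ C ∧ ∀ a b, dist (P.2 a) (P.2 b) ≤ C * dist a b := by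
  obtain ⟨⟨h1, -⟩, h2, h3, -⟩ := hP
  obtain ⟨C, hC0, hC⟩ := h2.exists_lipschitz h1
  refine ⟨C, hC0, fun a b => ?_⟩
  obtain ⟨z, rfl⟩ := proj_surjective a
  obtain ⟨w, rfl, hw⟩ := exists_proj_eq_dist_eq z b
  rw [← hw, ← h3, ← h3]
  exact (dist_proj_le _ _).trans (hC z w)

theorem continuous_of_mem_liftGroup {P : Equiv.Perm (ℝ × ℝ) × Equiv.Perm Torus}
    (hP : P ∈ liftGroup) : Continuous P.2 := by
  obtain ⟨C, hC0, hC⟩ := lipschitz_of_mem_liftGroup hP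
  exact (LipschitzWith.of_dist_le_mul (K := ⟨C, hC0⟩) hC).continuous

theorem isSmoothAreaPreservingDiffeo_of_mem_liftGroup
    {P : Equiv.Perm (ℝ × ℝ) × Equiv.Perm Torus} (hP : P ∈ liftGroup) :
    IsSmoothAreaPreservingDiffeo P.2 :=
  ⟨⟨P.1, hP.1.1, hP.2.2.1⟩, ⟨P.1.symm, hP.1.2, (liftGroup.inv_mem hP).2.2.1⟩, hP.2.2.2.1⟩

/-! ### Shears and their horizontal rescalings. -/

/-- The translation `(x, y) ↦ (x + t, y)` of the plane. -/
def shift (t : ℝ) : Equiv.Perm (ℝ × ℝ) :=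
  (Equiv.addRight t).prodCongr (Equiv.refl ℝ)

/-- The shear `(x, y) ↦ (x + f y, y)`. -/
def hshear (f : ℝ → ℝ) : Equiv.Perm (ℝ × ℝ) where
  toFun z := (z.1 + f z.2, z.2)
  invFun z := (z.1 - f z.2, z.2)
  left_inv z := by simp
  right_inv z := by simp

/-- The shear `(x, y) ↦ (x, y + g x)`. -/
def vshear (g : ℝ → ℝ) : Equiv.Perm (ℝ × ℝ) where
  toFun z := (z.1, z.2 + g z.1)
  invFun z := (z.1, z.2 - g z.1)
  left_inv z := by simp
  right_inv z := by simp

/-- The linear map `(x, y) ↦ (q x, y)`. -/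
noncomputable def hscale (q : ℝ) (hq : q ≠ 0) : Equiv.Perm (ℝ × ℝ) :=
  (Equiv.mulRight₀ q hq).prodCongr (Equiv.refl ℝ)

/-- The torus shear `(x, y) ↦ (x + f y, y)`. -/
def torusHshear {f : ℝ → ℝ} (hf : Function.Periodic f 1) : Equiv.Perm Torus where
  toFun z := (z.1 + ((hf.lift z.2 : ℝ) : UnitAddCircle), z.2)
  invFun z := (z.1 - ((hf.lift z.2 : ℝ) : UnitAddCircle), z.2)
  left_inv z := by simp
  right_inv z := by simp

/-- The torus shear `(x, y) ↦ (x, y + g x)`. -/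
def torusVshear {g : ℝ → ℝ} (hg : Function.Periodic g 1) : Equiv.Perm Torus where
  toFun z := (z.1, z.2 + ((hg.lift z.1 : ℝ) : UnitAddCircle))
  invFun z := (z.1, z.2 - ((hg.lift z.1 : ℝ) : UnitAddCircle))
  left_inv z := by simp
  right_inv z := by simp

theorem measurePreserving_skew_snd {u : UnitAddCircle → UnitAddCircle} (hu : Continuous u) :
    MeasurePreserving (fun z : Torus => (z.1, z.2 + u z.1)) volume volume := by
  refine (MeasurePreserving.id (volume : Measure UnitAddCircle)).skew_product
    (μc := (volume : Measure UnitAddCircle)) (μd := (volume : Measure UnitAddCircle))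
    (g := fun a c => c + u a) ?_ (ae_of_all _ fun a => ?_)
  · exact (continuous_snd.add (hu.comp continuous_fst)).measurable
  · exact (measurePreserving_add_right volume (u a)).map_eq

theorem measurePreserving_skew_fst {u : UnitAddCircle → UnitAddCircle} (hu : Continuous u) :
    MeasurePreserving (fun z : Torus => (z.1 + u z.2, z.2)) volume volume :=
  (Measure.measurePreserving_swap.comp (measurePreserving_skew_snd hu)).comp
    Measure.measurePreserving_swap

theorem continuous_periodic_lift {f : ℝ → ℝ} (hf : Function.Periodic f 1) (hc : Continuous f) :
    Continuous fun y : UnitAddCircle => ((hf.lift y : ℝ) : UnitAddCircle) :=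
  (AddCircle.continuous_mk' 1).comp (continuous_coinduced_dom.2 hc)

theorem periodic_add_int {f : ℝ → ℝ} (hf : Function.Periodic f 1) (x : ℝ) (n : ℤ) :
    f (x + n) = f x := by
  simpa using hf.int_mul n x

theorem hshear_mem_liftGroup {f : ℝ → ℝ} (hf : Function.Periodic f 1) (hs : ContDiff ℝ ∞ f) :
    (hshear f, torusHshear hf) ∈ liftGroup := by
  refine ⟨⟨?_, ?_⟩, fun z m n => ?_, fun z => rfl, ?_, ?_⟩
  · exact (contDiff_fst.add (hs.comp contDiff_snd)).prodMk contDiff_snd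
  · exact (contDiff_fst.sub (hs.comp contDiff_snd)).prodMk contDiff_snd
  · ext
    · simp [hshear, periodic_add_int hf]; ring
    · simp [hshear]
  · exact measurePreserving_skew_fst (continuous_periodic_lift hf hs.continuous)
  · have := measurePreserving_skew_fst (continuous_periodic_lift hf hs.continuous).neg
    simp only [Pi.neg_apply, ← sub_eq_add_neg] at this
    exact this

theorem vshear_mem_liftGroup {g : ℝ → ℝ} (hg : Function.Periodic g 1) (hs : ContDiff ℝ ∞ g) :
    (vshear g, torusVshear hg) ∈ liftGroup := by
  refine ⟨⟨?_, ?_⟩, fun z m n => ?_, fun z => rfl, ?_, ?_⟩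
  · exact contDiff_fst.prodMk (contDiff_snd.add (hs.comp contDiff_fst))
  · exact contDiff_fst.prodMk (contDiff_snd.sub (hs.comp contDiff_fst))
  · ext
    · simp [vshear]
    · simp [vshear, periodic_add_int hg]; ring
  · exact measurePreserving_skew_snd (continuous_periodic_lift hg hs.continuous)
  · have := measurePreserving_skew_snd (continuous_periodic_lift hg hs.continuous).neg
    simp only [Pi.neg_apply, ← sub_eq_add_neg] at this
    exact this

theorem shift_mem_liftGroup (t : ℝ) : (shift t, rotation t) ∈ liftGroup := by
  have hf : Function.Periodic (fun _ : ℝ => t) 1 := fun _ => rfl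
  have h := hshear_mem_liftGroup hf contDiff_const
  have h2 : torusHshear hf = rotation t := by
    ext z
    · obtain ⟨⟨x, y⟩, rfl⟩ := proj_surjective z
      rfl
    · rfl
  have h1 : hshear (fun _ => t) = shift t := by
    ext z
    · rfl
    · rfl
  rwa [h1, h2] at h

/-- `F` commutes with integer translations together with all its horizontal rescalings, which then
lift diffeomorphisms of the torus. -/
def IsScalable (F : Equiv.Perm (ℝ × ℝ)) : Prop :=
  ∀ (q : ℕ) (hq : (q : ℝ) ≠ 0), ∃ f : Equiv.Perm Torus,
    ((hscale q hq)⁻¹ * F * hscale q hq, f) ∈ liftGroup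

theorem IsScalable.mul {F G : Equiv.Perm (ℝ × ℝ)} (hF : IsScalable F) (hG : IsScalable G) :
    IsScalable (F * G) := fun q hq => by
  obtain ⟨f, hf⟩ := hF q hq
  obtain ⟨g, hg⟩ := hG q hq
  refine ⟨f * g, ?_⟩
  have := liftGroup.mul_mem hf hg
  simpa [mul_assoc] using this

theorem IsScalable.inv {F : Equiv.Perm (ℝ × ℝ)} (hF : IsScalable F) : IsScalable F⁻¹ :=
  fun q hq => by
  obtain ⟨f, hf⟩ := hF q hq
  refine ⟨f⁻¹, ?_⟩
  have := liftGroup.inv_mem hf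
  simpa [mul_assoc] using this

/-- Rescaling replaces `f` by `f / q`, which is still `1`-periodic; for a vertical shear it replaces
`g` by `g (q ·)`, periodic because `q` is an integer. Products of such shears therefore supply
area-preserving maps commuting with the rotation by `1 / q`. -/
theorem isScalable_hshear {f : ℝ → ℝ} (hf : Function.Periodic f 1) (hs : ContDiff ℝ ∞ f) :
    IsScalable (hshear f) := fun q hq => by
  have hp : Function.Periodic (fun y => f y / q) 1 := fun y => by simp [hf y]
  refine ⟨torusHshear hp, ?_⟩
  convert hshear_mem_liftGroup hp (hs.div_const _) using 2
  ext z
  · simp [hshear, hscale, Equiv.Perm.inv_def]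
    field_simp
  · simp [hshear, hscale, Equiv.Perm.inv_def]

theorem isScalable_vshear {g : ℝ → ℝ} (hg : Function.Periodic g 1) (hs : ContDiff ℝ ∞ g) :
    IsScalable (vshear g) := fun q hq => by
  have hp : Function.Periodic (fun x => g (x * q)) 1 := fun x => by
    have := periodic_add_int hg (x * q) q
    simpa [add_mul] using this
  refine ⟨torusVshear hp, ?_⟩
  convert vshear_mem_liftGroup hp (hs.comp (contDiff_id.mul contDiff_const)) using 2
  ext z
  · simp [vshear, hscale, Equiv.Perm.inv_def]
    field_simp
  · simp [vshear, hscale, Equiv.Perm.inv_def]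

/-! ### Periodic cutoff functions and the ramp. -/

/-- The `1`-periodic extension of the restriction of `φ` to `[-1/2, 1/2)`. -/
noncomputable def periodize (φ : ℝ → ℝ) (t : ℝ) : ℝ := φ (t - round t)

theorem periodize_periodic (φ : ℝ → ℝ) : Function.Periodic (periodize φ) 1 := fun t => by
  simp only [periodize, round_add_one]
  push_cast
  congr 1
  ring

theorem round_eq_of_abs_sub_lt {t : ℝ} {n : ℤ} (h : |t - n| < 1 / 2) : round t = n := by
  rw [abs_lt] at h
  rw [round_eq, Int.floor_eq_iff]
  constructor <;> linarith

theorem periodize_eq {φ : ℝ → ℝ} {t : ℝ} (h : |t| < 1 / 2) : periodize φ t = φ t := by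
  have : round t = 0 := round_eq_of_abs_sub_lt (by simpa using h)
  simp [periodize, this]

/-- The only possible singularities are the half-integers, and near those the periodization vanishes
because `c < 1 / 2`. -/
theorem contDiff_periodize {φ : ℝ → ℝ} (hφ : ContDiff ℝ ∞ φ) {c : ℝ} (hc : c < 1 / 2)
    (h0 : ∀ t, c ≤ |t| → φ t = 0) : ContDiff ℝ ∞ (periodize φ) := by
  rw [contDiff_iff_contDiffAt]
  intro t
  rcases (abs_sub_round t).lt_or_eq with h | h
  · have hev : periodize φ =ᶠ[𝓝 t] fun s => φ (s - round t) := by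
      have ho : IsOpen {s : ℝ | |s - round t| < 1 / 2} :=
        isOpen_lt (by fun_prop) continuous_const
      filter_upwards [ho.mem_nhds h] with s hs
      simp [periodize, round_eq_of_abs_sub_lt hs]
    exact ContDiffAt.congr_of_eventuallyEq
      (hφ.comp (contDiff_id.sub contDiff_const)).contDiffAt hev
  · have hev : periodize φ =ᶠ[𝓝 t] fun _ => 0 := by
      have ho : IsOpen {s : ℝ | |s - t| < 1 / 2 - c} :=
        isOpen_lt (by fun_prop) continuous_const
      filter_upwards [ho.mem_nhds (by simpa using hc)] with s hs
      refine h0 _ ?_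
      have h1 := round_le t (round s)
      rw [h] at h1
      have h2 := abs_sub_abs_le_abs_sub (t - round s) (s - round s)
      rw [show t - round s - (s - round s) = -(s - t) by ring, abs_neg] at h2
      have hs : |s - t| < 1 / 2 - c := hs
      linarith
    exact ContDiffAt.congr_of_eventuallyEq contDiffAt_const hev

/-- A periodic smooth function that is the identity near `0` and vanishes away from the integers. -/
theorem exists_periodic_linear {r R : ℝ} (hr : 0 < r) (hrR : r < R) (hR : R < 1 / 2) :
    ∃ χ : ℝ → ℝ, Function.Periodic χ 1 ∧ ContDiff ℝ ∞ χ ∧ (∀ t, |t| ≤ r → χ t = t) ∧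
      (∀ t : ℝ, R ≤ ‖(t : UnitAddCircle)‖ → χ t = 0) ∧ ∀ t, |χ t| ≤ 1 / 2 := by
  let b : ContDiffBump (0 : ℝ) := ⟨r, R, hr, hrR⟩
  have hb0 : ∀ t, R ≤ |t| → b t = 0 := fun t ht => b.zero_of_le_dist (by simpa using ht)
  refine ⟨periodize fun t => t * b t, periodize_periodic _,
    contDiff_periodize (contDiff_id.mul b.contDiff) hR fun t ht => by simp [hb0 t ht],
    fun t ht => ?_, fun t ht => ?_, fun t => ?_⟩
  · rw [periodize_eq (by linarith), b.one_of_mem_closedBall (by simpa using ht), mul_one]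
  · rw [UnitAddCircle.norm_eq] at ht
    simp [periodize, hb0 _ ht]
  · simp only [periodize, abs_mul]
    have h1 : |b (t - round t)| ≤ 1 := by
      rw [abs_of_nonneg b.nonneg]; exact b.le_one
    exact (mul_le_of_le_one_right (abs_nonneg _) h1).trans (abs_sub_round t)

/-- An even smooth function, `0` near `0`, then equal to `M |t|`, with compact support. -/
theorem exists_even_ramp {a : ℝ} (M : ℝ) (ha : 0 < a) :
    ∃ G : ℝ → ℝ, ContDiff ℝ ∞ G ∧ (∀ t, G (-t) = G t) ∧ (∀ t, |t| ≤ a → G t = 0) ∧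
      (∀ t, a + a ^ 2 ≤ t → t ≤ 1 / 2 → G t = M * t) ∧ ∀ t, 1 ≤ |t| → G t = 0 := by
  let b : ContDiffBump (0 : ℝ) := ⟨1 / 2, 1, by norm_num, by norm_num⟩
  let g : ℝ → ℝ := fun t => M * t * Real.smoothTransition ((t - a) / a ^ 2) * b t
  have ha2 : 0 < a ^ 2 := by positivity
  have hg0 : ∀ t, t ≤ a → g t = 0 := fun t ht => by
    have : Real.smoothTransition ((t - a) / a ^ 2) = 0 :=
      Real.smoothTransition.zero_of_nonpos (div_nonpos_of_nonpos_of_nonneg (by linarith) ha2.le)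
    simp [g, this]
  have hb0 : ∀ t, 1 ≤ |t| → g t = 0 := fun t ht => by
    have : b t = 0 := b.zero_of_le_dist (by simpa using ht)
    simp [g, this]
  have hgs : ContDiff ℝ ∞ g := by
    refine ((contDiff_const.mul contDiff_id).mul ?_).mul b.contDiff
    exact Real.smoothTransition.contDiff.comp
      ((contDiff_id.sub contDiff_const).div_const _)
  -- `g` vanishes for `t ≤ a`, so the two summands have disjoint supports and symmetrizing leaves
  -- `g` unchanged on the positive side.
  refine ⟨fun t => g t + g (-t), hgs.add (hgs.comp contDiff_neg), fun t => ?_, fun t ht => ?_,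
    fun t h1 h2 => ?_, fun t ht => ?_⟩
  · simp [add_comm]
  · rw [abs_le] at ht
    simp [hg0 t ht.2, hg0 (-t) (by linarith)]
  · have h3 : Real.smoothTransition ((t - a) / a ^ 2) = 1 :=
      Real.smoothTransition.one_of_one_le ((one_le_div ha2).2 (by linarith))
    have h4 : b t = 1 := b.one_of_mem_closedBall (by
      simp only [Metric.mem_closedBall, Real.dist_eq, sub_zero]
      change |t| ≤ 1 / 2
      rw [abs_le]; constructor <;> linarith)
    simp only [hg0 (-t) (by linarith)]
    simp [g, h3, h4]
  · simp [hb0 t ht, hb0 (-t) (by simpa using ht)]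

/-! ### Time averages along a rapidly winding curve. -/

section Integral

variable {θ : ℝ → ℝ} {μ : ℝ}

/-- Whole periods contribute zero, and the remaining interval has length less than one. -/
theorem abs_integral_sub_mean_le_one (hθ : Continuous θ) (hp : Function.Periodic θ 1)
    (hμ : ∫ t in (0 : ℝ)..1, θ t = μ) (hosc : ∀ t, |θ t - μ| ≤ 1) (a b : ℝ) :
    |∫ t in a..b, (θ t - μ)| ≤ 1 := by
  have hi : ∀ c d, IntervalIntegrable (fun t => θ t - μ) volume c d := fun c d =>
    (hθ.sub continuous_const).intervalIntegrable c d
  have hp' : Function.Periodic (fun t => θ t - μ) 1 := fun t => by simp [hp t]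
  have hz : ∫ t in a..a + ⌊b - a⌋, (θ t - μ) = 0 := by
    have h1 := hp'.intervalIntegral_add_zsmul_eq ⌊b - a⌋ a
      (by intro c d; exact hi c d)
    have h2 : ∫ t in (0 : ℝ)..1, (θ t - μ) = 0 := by
      rw [intervalIntegral.integral_sub (hθ.intervalIntegrable _ _) (by simp), hμ]
      simp
    rw [hp'.intervalIntegral_add_eq a 0, zero_add, h2] at h1
    simpa using h1
  rw [← intervalIntegral.integral_add_adjacent_intervals (hi a (a + ⌊b - a⌋)) (hi _ b), hz,
    zero_add]
  have h2 := intervalIntegral.norm_integral_le_of_norm_le_const (a := a + ⌊b - a⌋) (b := b)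
    (f := fun t => θ t - μ) (C := 1) fun t _ => hosc t
  refine h2.trans ?_
  rw [one_mul, abs_le]
  have := Int.floor_le (b - a)
  have := Int.lt_floor_add_one (b - a)
  constructor <;> linarith

theorem abs_integral_comp_linear_le (hθ : Continuous θ) (hp : Function.Periodic θ 1)
    (hμ : ∫ t in (0 : ℝ)..1, θ t = μ) (hosc : ∀ t, |θ t - μ| ≤ 1) {M : ℝ} (a b y : ℝ)
    (hM : 0 < M) :
    |∫ t in a..b, (θ (y + M * t) - μ)| ≤ 1 / M := by
  have h := intervalIntegral.integral_comp_add_mul (fun s => θ s - μ) hM.ne' y (a := a) (b := b)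
  rw [h, smul_eq_mul, abs_mul, abs_of_pos (inv_pos.2 hM), one_div]
  exact mul_le_of_le_one_right (inv_pos.2 hM).le
    (abs_integral_sub_mean_le_one hθ hp hμ hosc _ _)

theorem abs_integral_le_of_forall_le {f : ℝ → ℝ} {a b c : ℝ} (hab : a ≤ b)
    (h : ∀ t ∈ Set.Icc a b, |f t| ≤ c) : |∫ t in a..b, f t| ≤ c * (b - a) := by
  have := intervalIntegral.norm_integral_le_of_norm_le_const (a := a) (b := b) (f := f) (C := c)
    fun t ht => by
      rw [Set.uIoc_of_le hab] at ht
      exact h t ⟨ht.1.le, ht.2⟩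
  rwa [abs_of_nonneg (sub_nonneg.2 hab)] at this

/-- A curve `Y` that stays at its initial height for a short time and then winds quickly around the
circle equidistributes at all later times. -/
theorem abs_integral_winding_le (hθ : Continuous θ) (hp : Function.Periodic θ 1)
    (hμ : ∫ t in (0 : ℝ)..1, θ t = μ) (hosc : ∀ t, |θ t - μ| ≤ 1)
    {a M η τ e y : ℝ} {G Y : ℝ → ℝ} (ha : 0 < a) (hη : 0 < η) (haτ : a ≤ τ / 100)
    (hητ : η ≤ τ / 100) (hτ : τ ≤ 1) (hM : 1 / a ^ 2 ≤ M)
    (hGeven : ∀ t, G (-t) = G t) (hG0 : ∀ t, |t| ≤ a → G t = 0)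
    (hGM : ∀ t, a + a ^ 2 ≤ t → t ≤ 1 / 2 → G t = M * t)
    (hY : Continuous Y) (hYp : Function.Periodic Y 1)
    (hYG : ∀ t, |t| ≤ 1 / 2 - η → Y t = y + G t) (he : |θ y - μ| ≤ e) (he0 : e ≤ 1) :
    (∀ S, 0 ≤ S → |∫ t in (0 : ℝ)..S, (θ (Y t) - μ)| ≤ (e + τ) * S) ∧
      |∫ t in (0 : ℝ)..1, (θ (Y t) - μ)| ≤ τ := by
  have hc : Continuous fun t => θ (Y t) - μ := (hθ.comp hY).sub continuous_const
  have hi : ∀ c d, IntervalIntegrable (fun t => θ (Y t) - μ) volume c d := fun c d =>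
    hc.intervalIntegrable c d
  have hsplit : ∀ a b c, ∫ t in a..c, (θ (Y t) - μ) =
      (∫ t in a..b, (θ (Y t) - μ)) + ∫ t in b..c, (θ (Y t) - μ) := fun a b c =>
    (intervalIntegral.integral_add_adjacent_intervals (hi a b) (hi b c)).symm
  have he' : 0 ≤ e := (abs_nonneg _).trans he
  have ha2 : 0 < a ^ 2 := by positivity
  have hMpos : 0 < M := lt_of_lt_of_le (by positivity) hM
  have hM' : 1 / M ≤ a ^ 2 := by
    rw [div_le_iff₀ ha2] at hM
    rw [div_le_iff₀ hMpos]; linarith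
  have haa : a ^ 2 ≤ a / 100 := by nlinarith
  have hsmall : ∀ S, 0 ≤ S → S ≤ a → |∫ t in (0 : ℝ)..S, (θ (Y t) - μ)| ≤ e * S := by
    intro S h0 h1
    have := abs_integral_le_of_forall_le (f := fun t => θ (Y t) - μ) (c := e) h0 fun t ht => by
      have hta : |t| ≤ a := by rw [abs_of_nonneg ht.1]; exact ht.2.trans h1
      rw [hYG t (by linarith), hG0 t hta, add_zero]; exact he
    simpa using this
  have hbd : ∀ c d, c ≤ d → |∫ t in c..d, (θ (Y t) - μ)| ≤ d - c := by
    intro c d hcd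
    have := abs_integral_le_of_forall_le (f := fun t => θ (Y t) - μ) (c := 1) hcd
      fun t _ => hosc _
    simpa using this
  -- The rest period costs `e * a`, the transition at most its length `a ^ 2`, and the winding at
  -- most `1 / M ≤ a ^ 2`. The last two are negligible compared with the elapsed time `S ≥ a`, which
  -- is why the transition has length `a ^ 2`.
  have hmid : ∀ S, a ≤ S → S ≤ 1 / 2 - η →
      |∫ t in (0 : ℝ)..S, (θ (Y t) - μ)| ≤ e * a + 2 * a ^ 2 := by
    intro S h1 h2
    rw [hsplit 0 a S]
    have h3 := hsmall a ha.le le_rfl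
    have h4 : |∫ t in a..S, (θ (Y t) - μ)| ≤ 2 * a ^ 2 := by
      rcases le_total S (a + a ^ 2) with h | h
      · refine (hbd a S h1).trans ?_
        linarith
      · rw [hsplit a (a + a ^ 2) S]
        have h5 := hbd a (a + a ^ 2) (by linarith)
        have h6 : |∫ t in (a + a ^ 2)..S, (θ (Y t) - μ)| ≤ 1 / M := by
          have : ∫ t in (a + a ^ 2)..S, (θ (Y t) - μ) =
              ∫ t in (a + a ^ 2)..S, (θ (y + M * t) - μ) := by
            refine intervalIntegral.integral_congr fun t ht => ?_
            rw [Set.uIcc_of_le h] at ht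
            have h0 : 0 ≤ t := by linarith [ht.1]
            rw [hYG t (by rw [abs_of_nonneg h0]; linarith [ht.2]), hGM t ht.1 (by linarith [ht.2])]
          rw [this]
          exact abs_integral_comp_linear_le hθ hp hμ hosc _ _ y hMpos
        refine (abs_add_le _ _).trans ?_
        linarith
    exact (abs_add_le _ _).trans (by linarith)
  have hhalf : ∀ S, 0 ≤ S → S ≤ 1 / 2 - η →
      |∫ t in (0 : ℝ)..S, (θ (Y t) - μ)| ≤ 2 * a := by
    intro S h0 h2
    rcases le_total S a with h | h
    · exact (hsmall S h0 h).trans (by nlinarith)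
    · exact (hmid S h h2).trans (by nlinarith)
  -- Since `G` is even and `Y` is periodic, the second half of the period is the mirror image of the
  -- first. Only the window of half-width `η` around `1 / 2` is uncontrolled.
  have hrefl : ∀ S, 1 / 2 + η ≤ S → S ≤ 1 → ∫ t in (1 / 2 + η)..S, (θ (Y t) - μ) =
      ∫ t in (1 - S)..(1 / 2 - η), (θ (Y t) - μ) := by
    intro S h1 h2
    have h := intervalIntegral.integral_comp_sub_left (fun t => θ (Y t) - μ) (1 : ℝ)
      (a := 1 - S) (b := 1 / 2 - η)
    rw [show (1 : ℝ) - (1 / 2 - η) = 1 / 2 + η by ring, sub_sub_cancel] at h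
    rw [← h]
    refine intervalIntegral.integral_congr fun t ht => ?_
    rw [Set.uIcc_of_le (by linarith)] at ht
    have h0 : |t| ≤ 1 / 2 - η := by rw [abs_of_nonneg (by linarith [ht.1])]; exact ht.2
    have h3 : Y (1 - t) = Y (-t) := by rw [← hYp (-t)]; congr 1; ring
    rw [h3, hYG t h0, hYG (-t) (by rwa [abs_neg]), hGeven]
  have hunif : ∀ S, 0 ≤ S → S ≤ 1 →
      |∫ t in (0 : ℝ)..S, (θ (Y t) - μ)| ≤ 6 * a + 2 * η := by
    intro S h0 h1
    rcases le_total S (1 / 2 - η) with h | h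
    · exact (hhalf S h0 h).trans (by linarith)
    · rw [hsplit 0 (1 / 2 - η) S]
      have h2 := hhalf (1 / 2 - η) (by linarith) le_rfl
      rcases le_total S (1 / 2 + η) with h' | h'
      · have h3 := hbd (1 / 2 - η) S h
        exact (abs_add_le _ _).trans (by linarith)
      · rw [hsplit (1 / 2 - η) (1 / 2 + η) S, hrefl S h' h1]
        have h3 := hbd (1 / 2 - η) (1 / 2 + η) (by linarith)
        have h4 := hhalf (1 - S) (by linarith) (by linarith)
        have h5 := hsplit 0 (1 - S) (1 / 2 - η)
        have h6 : |∫ t in (1 - S)..(1 / 2 - η), (θ (Y t) - μ)| ≤ 4 * a := by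
          rw [show ∫ t in (1 - S)..(1 / 2 - η), (θ (Y t) - μ) =
            (∫ t in (0 : ℝ)..(1 / 2 - η), (θ (Y t) - μ)) -
              ∫ t in (0 : ℝ)..(1 - S), (θ (Y t) - μ) by linarith]
          exact (abs_sub _ _).trans (by linarith)
        refine (abs_add_le _ _).trans ?_
        have := abs_add_le (∫ t in (1 / 2 - η)..(1 / 2 + η), (θ (Y t) - μ))
          (∫ t in (1 - S)..(1 / 2 - η), (θ (Y t) - μ))
        linarith
  have hone : |∫ t in (0 : ℝ)..1, (θ (Y t) - μ)| ≤ τ :=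
    (hunif 1 zero_le_one le_rfl).trans (by linarith)
  have hunit : ∀ S, 0 ≤ S → S ≤ 1 →
      |∫ t in (0 : ℝ)..S, (θ (Y t) - μ)| ≤ (e + τ) * S := by
    intro S h0 h1
    -- Three regimes: at rest the error is `e * S`; up to `1 / 4` the excess `2 * a ^ 2` is compared
    -- with `τ * S` through `a ≤ S`; beyond that the uniform bound is at most `τ / 4`.
    rcases le_total S a with h | h
    · exact (hsmall S h0 h).trans (by nlinarith)
    · rcases le_total S (1 / 4) with h' | h'
      · refine (hmid S h (by linarith)).trans ?_
        nlinarith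
      · refine (hunif S h0 h1).trans ?_
        nlinarith
  refine ⟨fun S hS => ?_, hone⟩
  have hper : Function.Periodic (fun t => θ (Y t) - μ) 1 := fun t => by simp [hYp t]
  -- Longer times split into full periods, each with error at most `τ`, and one partial period.
  have h1 : ∫ t in (0 : ℝ)..S, (θ (Y t) - μ) = (∫ t in (0 : ℝ)..Int.fract S, (θ (Y t) - μ)) +
      ⌊S⌋ • ∫ t in (0 : ℝ)..1, (θ (Y t) - μ) := by
    have h2 := hper.intervalIntegral_add_zsmul_eq ⌊S⌋ (Int.fract S) (by intro c d; exact hi c d)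
    rw [hper.intervalIntegral_add_eq _ 0, zero_add] at h2
    rw [← h2, ← hsplit]
    simp
  rw [h1]
  have h3 := hunit (Int.fract S) (Int.fract_nonneg S) (Int.fract_lt_one S).le
  have h4 : |⌊S⌋ • ∫ t in (0 : ℝ)..1, (θ (Y t) - μ)| ≤ ⌊S⌋ * τ := by
    have hf : (0 : ℝ) ≤ ⌊S⌋ := by exact_mod_cast Int.floor_nonneg.2 hS
    rw [zsmul_eq_mul, abs_mul, abs_of_nonneg hf]
    gcongr
  refine (abs_add_le _ _).trans ((add_le_add h3 h4).trans ?_)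
  have h5 := Int.floor_add_fract S
  have hf : (0 : ℝ) ≤ ⌊S⌋ := by exact_mod_cast Int.floor_nonneg.2 hS
  nlinarith [mul_nonneg hf he']

end Integral

/-! ### Localized quarter turns and the winding diffeomorphism. -/

/-- A localized quarter turn, written as a product of shears. -/
def quarterTurn (f g : ℝ → ℝ) : Equiv.Perm (ℝ × ℝ) :=
  vshear f * hshear g * (vshear f)⁻¹ * hshear g * hshear g

/-- The localized quarter turn with the roles of the two coordinates exchanged. -/
def quarterTurn' (f g : ℝ → ℝ) : Equiv.Perm (ℝ × ℝ) :=
  hshear f * vshear g * (hshear f)⁻¹ * vshear g * vshear g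

theorem quarterTurn_apply (f g : ℝ → ℝ) (t y : ℝ) :
    quarterTurn f g (t, y) =
      let t₁ := t + g y + g y
      let y₁ := y - f t₁
      let t₂ := t₁ + g y₁
      (t₂, y₁ + f t₂) := rfl

theorem quarterTurn'_apply (f g : ℝ → ℝ) (z : ℝ × ℝ) :
    quarterTurn' f g z = (quarterTurn f g z.swap).swap := rfl

theorem norm_coe_sub_le (y s : ℝ) :
    ‖(y : UnitAddCircle)‖ - |s| ≤ ‖((y - s : ℝ) : UnitAddCircle)‖ := by
  have h := UnitAddCircle.dist_coe_le y (y - s)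
  rw [dist_eq_norm, Real.dist_eq, sub_sub_cancel] at h
  have := norm_sub_norm_le (y : UnitAddCircle) ((y - s : ℝ) : UnitAddCircle)
  linarith

section

variable {χ ξ : ℝ → ℝ} {r ρ : ℝ}

/-- The vertical shear moves heights by at most `ρ / 2`, so the orbit stays where the horizontal
shears are trivial, and the two vertical shears cancel. -/
theorem quarterTurn_eq_self (hρ : 0 < ρ) (hχb : ∀ t, |χ t| ≤ 1 / 2)
    (hξ0 : ∀ t : ℝ, 2 * ρ ≤ ‖(t : UnitAddCircle)‖ → ξ t = 0) {t y : ℝ}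
    (hy : 4 * ρ ≤ ‖(y : UnitAddCircle)‖) :
    quarterTurn (fun t => ρ * χ t) (fun y => ρ⁻¹ * ξ y) (t, y) = (t, y) := by
  have h1 : ξ y = 0 := hξ0 y (by linarith)
  have h2 : ξ (y - ρ * χ t) = 0 := hξ0 _ (by
    have := norm_coe_sub_le y (ρ * χ t)
    have h3 : |ρ * χ t| ≤ ρ * (1 / 2) := by
      rw [abs_mul, abs_of_pos hρ]; exact mul_le_mul_of_nonneg_left (hχb t) hρ.le
    linarith)
  simp [quarterTurn_apply, h1, h2]

/-- Near the origin both cutoffs are the identity at all intermediate points, so the shears multiply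
as matrices; in the coordinates `(t, y / ρ)` the product is a clockwise quarter turn. -/
theorem quarterTurn_eq_linear (hρ : 0 < ρ) (hr : r ≤ 1 / 2) (hχ : ∀ t, |t| ≤ r → χ t = t)
    (hξ : ∀ y, |y| ≤ ρ → ξ y = y) {t y : ℝ} (h : |t| + 2 * (|y| / ρ) ≤ r) :
    quarterTurn (fun t => ρ * χ t) (fun y => ρ⁻¹ * ξ y) (t, y) = (y / ρ, -(ρ * t)) := by
  have hy0 : 0 ≤ |y| / ρ := by positivity
  have ht0 := abs_nonneg t
  have hyρ : |y| / ρ * ρ = |y| := div_mul_cancel₀ _ hρ.ne'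
  have h1 : ξ y = y := hξ y (by nlinarith)
  have h2 : t + ρ⁻¹ * y + ρ⁻¹ * y = t + 2 * (y / ρ) := by field_simp; ring
  have h3 : χ (t + 2 * (y / ρ)) = t + 2 * (y / ρ) := hχ _ (by
    refine (abs_add_le _ _).trans ?_
    rw [abs_mul, abs_div, abs_two, abs_of_pos hρ]
    exact h)
  have h4 : y - ρ * (t + 2 * (y / ρ)) = -(ρ * t + y) := by field_simp; ring
  have h5 : ξ (-(ρ * t + y)) = -(ρ * t + y) := hξ _ (by
    rw [abs_neg]
    refine (abs_add_le _ _).trans ?_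
    rw [abs_mul, abs_of_pos hρ]
    nlinarith)
  have h6 : t + 2 * (y / ρ) + ρ⁻¹ * -(ρ * t + y) = y / ρ := by field_simp; ring
  have h7 : χ (y / ρ) = y / ρ := hχ _ (by rw [abs_div, abs_of_pos hρ]; linarith)
  simp only [quarterTurn_apply, h1, h2, h3, h4, h5, h6, h7]
  refine Prod.ext rfl ?_
  simp only
  field_simp
  ring

end

theorem isScalable_quarterTurn {f g : ℝ → ℝ} (hf : Function.Periodic f 1)
    (hf' : ContDiff ℝ ∞ f) (hg : Function.Periodic g 1) (hg' : ContDiff ℝ ∞ g) :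
    IsScalable (quarterTurn f g) :=
  ((((isScalable_vshear hf hf').mul (isScalable_hshear hg hg')).mul
    (isScalable_vshear hf hf').inv).mul (isScalable_hshear hg hg')).mul (isScalable_hshear hg hg')

theorem isScalable_quarterTurn' {f g : ℝ → ℝ} (hf : Function.Periodic f 1)
    (hf' : ContDiff ℝ ∞ f) (hg : Function.Periodic g 1) (hg' : ContDiff ℝ ∞ g) :
    IsScalable (quarterTurn' f g) :=
  ((((isScalable_hshear hf hf').mul (isScalable_vshear hg hg')).mul
    (isScalable_hshear hf hf').inv).mul (isScalable_vshear hg hg')).mul (isScalable_vshear hg hg')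

theorem IsScalable.exists_mem_liftGroup {F : Equiv.Perm (ℝ × ℝ)} (hF : IsScalable F) :
    ∃ f, (F, f) ∈ liftGroup := by
  obtain ⟨f, hf⟩ := hF 1 (by norm_num)
  refine ⟨f, ?_⟩
  convert hf using 2
  ext ⟨x, y⟩ <;> simp [hscale, Equiv.Perm.inv_def]

/-- A diffeomorphism supported near the union of the two coordinate circles that squeezes
horizontal circles near height `0` into a thin vertical strip along which they wind quickly. -/
theorem exists_winding_diffeo {τ w δ : ℝ} (hτ : 0 < τ) (hτ1 : τ ≤ 1) (hw : 0 < w)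
    (hw8 : w ≤ 1 / 8) (hδ : 0 < δ) :
    ∃ F : Equiv.Perm (ℝ × ℝ), IsScalable F ∧
      (∀ z : ℝ × ℝ, δ ≤ ‖(z.1 : UnitAddCircle)‖ → δ ≤ ‖(z.2 : UnitAddCircle)‖ → F z = z) ∧
      ∃ w', 0 < w' ∧ w' ≤ w ∧
        (∀ y, |y| ≤ w → ∃ y', |y'| ≤ w' ∧ F (0, y') = (0, y)) ∧
        ∀ y', |y'| ≤ w' → |(F (0, y')).2| ≤ w ∧
          ∀ (θ : ℝ → ℝ) (μ e : ℝ), Continuous θ → Function.Periodic θ 1 →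
            ∫ t in (0 : ℝ)..1, θ t = μ → (∀ t, |θ t - μ| ≤ 1) →
            |θ (F (0, y')).2 - μ| ≤ e → e ≤ 1 →
            (∀ S, 0 ≤ S → |∫ t in (0 : ℝ)..S, (θ (F (t, y')).2 - μ)| ≤ (e + τ) * S) ∧
              |∫ t in (0 : ℝ)..1, (θ (F (t, y')).2 - μ)| ≤ τ := by
  -- `ρ` controls the width of the support, and `4 * ρ ≤ δ` keeps it in the prescribed cross. The
  -- losses `a` and `2 * η` are both `τ / 100`, as `abs_integral_winding_le` requires.
  set η := τ / 200 with hη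
  set ρ := min η (δ / 4) with hρdef
  set a := τ / 100 with ha
  have hη0 : 0 < η := by positivity
  have hρ0 : 0 < ρ := lt_min hη0 (by positivity)
  have hρη : ρ ≤ η := min_le_left _ _
  have hρδ : 4 * ρ ≤ δ := by have := min_le_right η (δ / 4); linarith
  have ha0 : 0 < a := by positivity
  have hη1 : η ≤ 1 / 200 := by linarith
  have hρ2 : ρ ^ 2 ≤ ρ / 200 := by nlinarith
  have hρ20 : 0 < ρ ^ 2 := by positivity
  obtain ⟨χ, hχp, hχs, hχ, -, hχb⟩ :=
    exists_periodic_linear (r := 1 / 2 - η) (R := 1 / 2 - η / 2) (by linarith) (by linarith)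
      (by linarith)
  obtain ⟨ξ, hξp, hξs, hξ, hξ0, -⟩ :=
    exists_periodic_linear (r := ρ) (R := 2 * ρ) hρ0 (by linarith) (by linarith)
  obtain ⟨G, hGs, hGe, hG0, hGM, hG1⟩ := exists_even_ramp (1 / a ^ 2) ha0
  set f : ℝ → ℝ := fun t => ρ * χ t with hf
  set g : ℝ → ℝ := fun y => ρ⁻¹ * ξ y with hg
  set k : ℝ → ℝ := periodize fun t => G (t / ρ ^ 2) with hk
  have hfp : Function.Periodic f 1 := fun t => by simp [hf, hχp t]
  have hgp : Function.Periodic g 1 := fun t => by simp [hg, hξp t]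
  have hfs : ContDiff ℝ ∞ f := contDiff_const.mul hχs
  have hgs : ContDiff ℝ ∞ g := contDiff_const.mul hξs
  have hGρ : ∀ t, ρ ^ 2 ≤ |t| → G (t / ρ ^ 2) = 0 := fun t ht => hG1 _ (by
    rw [abs_div, abs_of_pos hρ20, le_div_iff₀ hρ20]; linarith)
  have hks : ContDiff ℝ ∞ k :=
    contDiff_periodize (hGs.comp (contDiff_id.div_const _)) (c := ρ ^ 2) (by linarith) hGρ
  have hkp : Function.Periodic k 1 := periodize_periodic _
  have hscal : IsScalable (vshear k * quarterTurn' f g * quarterTurn f g) :=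
    ((isScalable_vshear hkp hks).mul (isScalable_quarterTurn' hfp hfs hgp hgs)).mul
      (isScalable_quarterTurn hfp hfs hgp hgs)
  -- Two quarter turns, one along each coordinate circle, compose to the hyperbolic map `(ρ ^ 2 * t,
  -- y / ρ ^ 2)`: almost all of a horizontal circle is squeezed into a thin vertical strip. The
  -- shear by `k` then stretches it into the ramp `G`.
  have hlin : ∀ t y, |t| ≤ 1 / 2 - 2 * η → |y| ≤ w * ρ ^ 2 →
      (vshear k * quarterTurn' f g * quarterTurn f g) (t, y) = (ρ ^ 2 * t, y / ρ ^ 2 + G t) := by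
    intro t y ht hy
    have hyρ : |y| / ρ ≤ w * ρ := by
      rw [div_le_iff₀ hρ0]; linarith [hy, show w * ρ * ρ = w * ρ ^ 2 by ring]
    have ht0 := abs_nonneg t
    have h1 : quarterTurn f g (t, y) = (y / ρ, -(ρ * t)) :=
      quarterTurn_eq_linear hρ0 (by linarith) hχ hξ (by nlinarith)
    have h2 : quarterTurn f g (-(ρ * t), y / ρ) = (y / ρ / ρ, -(ρ * -(ρ * t))) := by
      refine quarterTurn_eq_linear hρ0 (by linarith) hχ hξ ?_
      -- After the first turn the long coordinate is `y / ρ ^ 2`, of size at most `w`; the second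
      -- turn needs `2 * w` well below `1 / 2`, which `w ≤ 1 / 8` provides.
      have h3 : |y| / ρ / ρ ≤ w := by rw [div_le_iff₀ hρ0]; exact hyρ
      rw [abs_neg, abs_mul, abs_div, abs_of_pos hρ0]
      nlinarith
    have h3 : k (ρ ^ 2 * t) = G t := by
      rw [hk, periodize_eq]
      · congr 1; field_simp
      · rw [abs_mul, abs_of_pos hρ20]; nlinarith
    rw [Equiv.Perm.mul_apply, Equiv.Perm.mul_apply, h1, quarterTurn'_apply]
    simp only [Prod.swap_prod_mk]
    rw [h2, Prod.swap_prod_mk, show -(ρ * -(ρ * t)) = ρ ^ 2 * t by ring]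
    change (ρ ^ 2 * t, y / ρ / ρ + k (ρ ^ 2 * t)) = _
    rw [h3, div_div, sq]
  obtain ⟨f', hf'⟩ := hscal.exists_mem_liftGroup
  have hzero : ∀ y, |y| ≤ w * ρ ^ 2 →
      (vshear k * quarterTurn' f g * quarterTurn f g) (0, y) = (0, y / ρ ^ 2) := fun y hy => by
    rw [hlin 0 y (by rw [abs_zero]; linarith) hy, hG0 0 (by rw [abs_zero]; exact ha0.le)]
    simp
  refine ⟨_, hscal, ?_, w * ρ ^ 2, by positivity, by nlinarith, fun y hy => ?_,
    fun y hy => ⟨?_, ?_⟩⟩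
  · rintro ⟨t, y⟩ ht hy
    simp only at ht hy
    have h1 : quarterTurn f g (t, y) = (t, y) :=
      quarterTurn_eq_self hρ0 hχb hξ0 (by linarith)
    have h2 : quarterTurn f g (y, t) = (y, t) :=
      quarterTurn_eq_self hρ0 hχb hξ0 (by linarith)
    rw [Equiv.Perm.mul_apply, Equiv.Perm.mul_apply, h1, quarterTurn'_apply]
    simp only [Prod.swap_prod_mk]
    rw [h2, Prod.swap_prod_mk]
    have h3 : k t = 0 := hGρ _ (by
      rw [← UnitAddCircle.norm_eq]; linarith)
    change (t, y + k t) = _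
    rw [h3, add_zero]
  · have h1 : |ρ ^ 2 * y| ≤ w * ρ ^ 2 := by
      rw [abs_mul, abs_of_pos hρ20, mul_comm]; gcongr
    refine ⟨ρ ^ 2 * y, h1, ?_⟩
    rw [hzero _ h1]
    congr 1
    field_simp
  · rw [hzero y hy, abs_div, abs_of_pos hρ20, div_le_iff₀ hρ20]
    exact hy
  · intro θ μ e hθ hp hμ hosc he he1
    rw [hzero y hy] at he
    refine abs_integral_winding_le (a := a) (M := 1 / a ^ 2) (η := 2 * η) (τ := τ) (G := G)
      (Y := fun t => ((vshear k * quarterTurn' f g * quarterTurn f g) (t, y)).2)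
      hθ hp hμ hosc ha0 (by positivity) le_rfl (by linarith) hτ1 le_rfl hGe hG0 hGM ?_ ?_ ?_ he he1
    · exact continuous_snd.comp (hf'.1.1.continuous.comp (by fun_prop))
    · intro t
      have := congrArg Prod.snd (hf'.2.1 (t, y) 1 0)
      simpa using this
    · intro t ht
      rw [hlin t y ht hy]

/-! ### Circle means and Riemann sums. -/

theorem abs_sum_sub_integral_le {K : ℝ → ℝ} {Λ : ℝ} (hK : ∀ s t, |K s - K t| ≤ Λ * |s - t|)
    {l : ℕ} (hl : 0 < l) (b : ℕ) :
    |∑ c ∈ Finset.range b, K (c / l) - l * ∫ t in (0 : ℝ)..b / l, K t| ≤ b * (Λ / l) := by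
  have hl' : (0 : ℝ) < l := by exact_mod_cast hl
  have hΛ : 0 ≤ Λ := by simpa using (abs_nonneg _).trans (hK 1 0)
  have hc : Continuous K := (LipschitzWith.of_dist_le_mul (K := ⟨Λ, hΛ⟩) fun s t => by
    rw [Real.dist_eq, Real.dist_eq]; exact hK s t).continuous
  have hsum := intervalIntegral.sum_integral_adjacent_intervals (f := K) (μ := volume)
    (a := fun c : ℕ => (c : ℝ) / l) (n := b) fun k _ => hc.intervalIntegrable _ _
  simp only [Nat.cast_zero, zero_div] at hsum
  rw [← hsum, Finset.mul_sum, ← Finset.sum_sub_distrib]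
  refine (Finset.abs_sum_le_sum_abs _ _).trans ?_
  rw [← nsmul_eq_mul]
  nth_rewrite 2 [← Finset.card_range b]
  refine Finset.sum_le_card_nsmul _ _ _ fun c _ => ?_
  have h0 : (c : ℝ) / l ≤ ((c + 1 : ℕ) : ℝ) / l := by gcongr; simp
  have hd : ((c + 1 : ℕ) : ℝ) / l - (c : ℝ) / l = 1 / l := by push_cast; ring
  have h1 : K (c / l) = l * ∫ t in (c : ℝ) / l..((c + 1 : ℕ) : ℝ) / l, K (c / l) := by
    rw [intervalIntegral.integral_const, hd, smul_eq_mul]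
    field_simp
  rw [h1, ← mul_sub, ← intervalIntegral.integral_sub (by simp) (hc.intervalIntegrable _ _),
    abs_mul, abs_of_pos hl']
  have h2 := abs_integral_le_of_forall_le (f := fun t => K (c / l) - K t) (c := Λ * (1 / l)) h0
    fun t ht => (hK _ _).trans (by
      gcongr
      rw [abs_sub_comm, abs_of_nonneg (by linarith [ht.1])]
      linarith [ht.2])
  rw [hd] at h2
  calc _ ≤ (l : ℝ) * (Λ * (1 / l) * (1 / l)) := by gcongr
    _ = Λ / l := by field_simp

/-- The mean of `Ψ` over the horizontal circle at height `y`. -/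
noncomputable def circleMean (Ψ : Torus → ℝ) (y : ℝ) : ℝ := ∫ u in (0 : ℝ)..1, Ψ (proj (u, y))

theorem proj_add_one_left (x y : ℝ) : proj (x + 1, y) = proj (x, y) := by
  simpa using proj_add_int (x, y) 1 0

theorem proj_add_one_right (x y : ℝ) : proj (x, y + 1) = proj (x, y) := by
  simpa using proj_add_int (x, y) 0 1

theorem circleMean_eq_integral_add (Ψ : Torus → ℝ) (x y : ℝ) :
    ∫ u in (0 : ℝ)..1, Ψ (proj (x + u, y)) = circleMean Ψ y := by
  have hp : Function.Periodic (fun u : ℝ => Ψ (proj (u, y))) 1 := fun u => by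
    simp only [proj_add_one_left]
  rw [intervalIntegral.integral_comp_add_left (fun u => Ψ (proj (u, y))) x, circleMean, add_zero,
    hp.intervalIntegral_add_eq x 0, zero_add]

theorem circleMean_periodic (Ψ : Torus → ℝ) : Function.Periodic (circleMean Ψ) 1 := fun y => by
  simp only [circleMean, proj_add_one_right]

theorem integral_circleMean {Ψ : Torus → ℝ} (hΨ : Continuous Ψ) :
    ∫ y in (0 : ℝ)..1, circleMean Ψ y = ∫ z, Ψ z := by
  have h1 (y : ℝ) : circleMean Ψ y = ∫ u : UnitAddCircle, Ψ (u, (y : UnitAddCircle)) := by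
    have := UnitAddCircle.intervalIntegral_preimage 0
      fun u : UnitAddCircle => Ψ (u, (y : UnitAddCircle))
    rw [zero_add] at this
    exact this
  have h2 := UnitAddCircle.intervalIntegral_preimage 0
    fun y : UnitAddCircle => ∫ u : UnitAddCircle, Ψ (u, y)
  rw [zero_add] at h2
  simp only [h1]
  rw [h2]
  have hi : Integrable Ψ ((volume : Measure UnitAddCircle).prod volume) :=
    hΨ.integrable_of_hasCompactSupport (HasCompactSupport.of_compactSpace Ψ)
  exact (integral_prod_symm Ψ hi).symm

theorem dist_le_half (a b : Torus) : dist a b ≤ 1 / 2 := by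
  have h (x y : UnitAddCircle) : dist x y ≤ 1 / 2 := by
    rw [dist_eq_norm]
    simpa using AddCircle.norm_le_half_period 1 (x := x - y) one_ne_zero
  exact max_le (h _ _) (h _ _)

/-- In the product metric the torus has diameter at most `1 / 2`. This normalizes the test
functions: their deviations from the mean never exceed `1`. -/
theorem abs_sub_integral_le_half {φ : Torus → ℝ} (hφ : LipschitzWith 1 φ) (a : Torus) :
    |φ a - ∫ z, φ z| ≤ 1 / 2 := by
  have hi : Integrable φ volume := 
    hφ.continuous.integrable_of_hasCompactSupport (HasCompactSupport.of_compactSpace φ)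
  have h1 : φ a - ∫ z, φ z = ∫ z, (φ a - φ z) := by
    rw [integral_sub (integrable_const _) hi]; simp
  rw [h1]
  have h2 := norm_integral_le_of_norm_le_const (μ := (volume : Measure Torus))
    (f := fun z => φ a - φ z) (C := 1 / 2) (ae_of_all _ fun z => by
      have h3 := hφ.dist_le_mul a z
      rw [Real.dist_eq] at h3
      have := dist_le_half a z
      simp only [NNReal.coe_one, one_mul] at h3
      exact h3.trans this)
  simpa using h2

theorem dist_proj_left (s t y : ℝ) : dist (proj (s, y)) (proj (t, y)) ≤ |s - t| :=
  (dist_proj_le _ _).trans (by simp [Prod.dist_eq, Real.dist_eq])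

theorem dist_proj_right (x s t : ℝ) : dist (proj (x, s)) (proj (x, t)) ≤ |s - t| :=
  (dist_proj_le _ _).trans (by simp [Prod.dist_eq, Real.dist_eq])

section

variable {Ψ : Torus → ℝ} {L : ℝ}

theorem continuous_of_abs_sub_le (hΨ : ∀ a b, |Ψ a - Ψ b| ≤ L * dist a b) : Continuous Ψ := by
  refine (LipschitzWith.of_dist_le_mul (K := Real.toNNReal L) fun a b => ?_).continuous
  rw [Real.dist_eq]
  exact (hΨ a b).trans (mul_le_mul_of_nonneg_right (Real.le_coe_toNNReal L) dist_nonneg)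

theorem abs_circleMean_sub_le (hL : 0 ≤ L) (hΨ : ∀ a b, |Ψ a - Ψ b| ≤ L * dist a b) (s t : ℝ) :
    |circleMean Ψ s - circleMean Ψ t| ≤ L * |s - t| := by
  have hc (y : ℝ) : IntervalIntegrable (fun u : ℝ => Ψ (proj (u, y))) volume 0 1 :=
    ((continuous_of_abs_sub_le hΨ).comp (continuous_proj.comp (by fun_prop))).intervalIntegrable _ _
  rw [circleMean, circleMean, ← intervalIntegral.integral_sub (hc s) (hc t)]
  have := abs_integral_le_of_forall_le (f := fun u => Ψ (proj (u, s)) - Ψ (proj (u, t)))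
    (c := L * |s - t|) zero_le_one fun u _ =>
      (hΨ _ _).trans (mul_le_mul_of_nonneg_left (dist_proj_right _ _ _) hL)
  simpa using this

theorem abs_sum_sub_circleMean_le (hL : 0 ≤ L) (hΨ : ∀ a b, |Ψ a - Ψ b| ≤ L * dist a b) {q : ℕ}
    (hq : 0 < q) (x y : ℝ) :
    |∑ j ∈ Finset.range q, Ψ (proj (x + j / q, y)) - q * circleMean Ψ y| ≤ L := by
  have hq' : (q : ℝ) ≠ 0 := by exact_mod_cast hq.ne'
  have h := abs_sum_sub_integral_le (K := fun u => Ψ (proj (x + u, y))) (Λ := L)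
    (fun s t => (hΨ _ _).trans (mul_le_mul_of_nonneg_left ((dist_proj_left _ _ _).trans
      (by rw [add_sub_add_left_eq_sub])) hL)) hq q
  rw [div_self hq', circleMean_eq_integral_add, mul_div_cancel₀ _ hq'] at h
  exact h

end

/-! ### Birkhoff sums of conjugated rotations. -/

/-- Multiplication by `p` permutes the residues modulo `q`, so an orbit of the rotation by `p / q`
is a full set of `q` equally spaced points. -/
theorem sum_mul_div_eq_sum_div (g : UnitAddCircle → ℝ) {q : ℕ} (hq : 0 < q) {p : ℤ}
    (hp : IsCoprime p q) :
    ∑ j ∈ Finset.range q, g ((j * p / q : ℝ) : UnitAddCircle) =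
      ∑ j ∈ Finset.range q, g ((j / q : ℝ) : UnitAddCircle) := by
  have : NeZero q := ⟨hq.ne'⟩
  have hu : IsUnit (p : ZMod q) := by
    obtain ⟨a, b, hab⟩ := hp
    have := congrArg (Int.cast : ℤ → ZMod q) hab
    push_cast at this
    rw [CharP.cast_eq_zero, mul_zero, add_zero] at this
    exact IsUnit.of_mul_eq_one_right _ this
  have h1 (k : ℤ) : g ((k / q : ℝ) : UnitAddCircle) = g (ZMod.toAddCircle (k : ZMod q)) := by
    rw [ZMod.toAddCircle_intCast]
  have hcast (F : ZMod q → ℝ) : ∑ j ∈ Finset.range q, F (j : ZMod q) = ∑ x : ZMod q, F x := by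
    refine Finset.sum_bij (fun j _ => (j : ZMod q)) (fun _ _ => Finset.mem_univ _) ?_ ?_
      (fun _ _ => rfl)
    · intro a ha b hb hab
      rw [Finset.mem_range] at ha hb
      have := congrArg ZMod.val hab
      rwa [ZMod.val_natCast_of_lt ha, ZMod.val_natCast_of_lt hb] at this
    · intro x _
      exact ⟨x.val, Finset.mem_range.2 (ZMod.val_lt x), by simp⟩
  have h2 : ∑ j ∈ Finset.range q, g ((j * p / q : ℝ) : UnitAddCircle) =
      ∑ j ∈ Finset.range q, g (ZMod.toAddCircle ((j : ZMod q) * (p : ZMod q))) :=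
    Finset.sum_congr rfl fun j _ => by
      have := h1 (j * p)
      push_cast at this
      exact this
  have h3 : ∑ j ∈ Finset.range q, g ((j / q : ℝ) : UnitAddCircle) =
      ∑ j ∈ Finset.range q, g (ZMod.toAddCircle (j : ZMod q)) :=
    Finset.sum_congr rfl fun j _ => by
      have := h1 j
      push_cast at this
      exact this
  rw [h2, h3, hcast fun x => g (ZMod.toAddCircle (x * (p : ZMod q))),
    hcast fun x => g (ZMod.toAddCircle x)]
  obtain ⟨u, hu⟩ := hu
  rw [← hu]
  exact (Equiv.sum_comp (Units.mulRight u) fun x => g (ZMod.toAddCircle x))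

section

variable {F : Equiv.Perm (ℝ × ℝ)} {f : Equiv.Perm Torus} {q : ℕ}

theorem scaled_apply_proj {hq : (q : ℝ) ≠ 0}
    (hf : ((hscale q hq)⁻¹ * F * hscale q hq, f) ∈ liftGroup) (x y : ℝ) :
    f (proj (x, y)) = proj ((F (x * q, y)).1 / q, (F (x * q, y)).2) := by
  rw [← hf.2.2.1]
  rfl

theorem scaled_apply_proj_add (hFe : IsEquivariant F) {hq : (q : ℝ) ≠ 0}
    (hf : ((hscale q hq)⁻¹ * F * hscale q hq, f) ∈ liftGroup) (x y : ℝ) (m : ℤ) :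
    f (proj (x + m / q, y)) = proj ((F (x * q, y)).1 / q + m / q, (F (x * q, y)).2) := by
  rw [scaled_apply_proj hf]
  have h := hFe (x * q, y) m 0
  have h1 : (x + m / q) * q = x * q + m := by field_simp
  simp only [Int.cast_zero, Prod.mk_add_mk, add_zero] at h
  rw [h1, h]
  simp [add_div]

variable {Ψ : Torus → ℝ} {L : ℝ}

theorem equivariant_snd_periodic (hFe : IsEquivariant F) (y : ℝ) :
    Function.Periodic (fun t => (F (t, y)).2) 1 := fun t => by
  have := congrArg Prod.snd (hFe (t, y) 1 0)
  simpa using this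

/-- The mean is unchanged by averaging over the translates by `j / q`. These are carried by `f` to
`q` equally spaced points of one horizontal circle, whose average is a circle mean up to `L / q`. -/
theorem abs_circleMean_comp_sub_le (hL : 0 ≤ L) (hΨ : ∀ a b, |Ψ a - Ψ b| ≤ L * dist a b)
    (hFe : IsEquivariant F) (hFc : Continuous F) (hq0 : 0 < q) {hq : (q : ℝ) ≠ 0}
    (hf : ((hscale q hq)⁻¹ * F * hscale q hq, f) ∈ liftGroup) (y : ℝ) :
    |circleMean (fun z => Ψ (f z)) y - ∫ t in (0 : ℝ)..1, circleMean Ψ (F (t, y)).2| ≤ L / q := by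
  have hq' : (0 : ℝ) < q := by exact_mod_cast hq0
  have hΨc := continuous_of_abs_sub_le hΨ
  have hθc : Continuous (circleMean Ψ) :=
    (LipschitzWith.of_dist_le_mul (K := ⟨L, hL⟩) fun s t => by
      rw [Real.dist_eq, Real.dist_eq]; exact abs_circleMean_sub_le hL hΨ s t).continuous
  have hfc : Continuous f := continuous_of_mem_liftGroup hf
  have hYc : Continuous fun t => circleMean Ψ (F (t, y)).2 :=
    hθc.comp (continuous_snd.comp (hFc.comp (by fun_prop)))
  have h1 (j : ℕ) : IntervalIntegrable (fun u : ℝ => Ψ (f (proj (u + j / q, y)))) volume 0 1 :=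
    (hΨc.comp (hfc.comp (continuous_proj.comp (by fun_prop)))).intervalIntegrable _ _
  have h2 (j : ℕ) : ∫ u in (0 : ℝ)..1, Ψ (f (proj (u + j / q, y))) =
      circleMean (fun z => Ψ (f z)) y := by
    rw [← circleMean_eq_integral_add _ (j / q)]
    simp only [add_comm]
  have h3 : (q : ℝ) * circleMean (fun z => Ψ (f z)) y =
      ∫ u in (0 : ℝ)..1, ∑ j ∈ Finset.range q, Ψ (f (proj (u + j / q, y))) := by
    rw [intervalIntegral.integral_finsetSum fun j _ => h1 j]
    simp [h2]
  have hp : Function.Periodic (fun t => circleMean Ψ (F (t, y)).2) 1 := fun t => by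
    have := equivariant_snd_periodic hFe y t
    simp only at this ⊢
    rw [this]
  have h4 : ∫ u in (0 : ℝ)..1, circleMean Ψ (F (u * q, y)).2 =
      ∫ t in (0 : ℝ)..1, circleMean Ψ (F (t, y)).2 := by
    rw [intervalIntegral.integral_comp_mul_right (fun t => circleMean Ψ (F (t, y)).2) hq, zero_mul,
      one_mul]
    have := hp.intervalIntegral_add_zsmul_eq q 0 (fun c d => hYc.intervalIntegrable c d)
    simp only [natCast_zsmul, nsmul_eq_mul, mul_one, zero_add] at this
    rw [this, smul_eq_mul]
    field_simp
  have h5 : |(q : ℝ) * circleMean (fun z => Ψ (f z)) y -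
      q * ∫ t in (0 : ℝ)..1, circleMean Ψ (F (t, y)).2| ≤ L := by
    have hi2 : IntervalIntegrable (fun u : ℝ => q * circleMean Ψ (F (u * q, y)).2) volume 0 1 :=
      (continuous_const.mul (hYc.comp (by fun_prop : Continuous fun u : ℝ => u * q))).intervalIntegrable _ _
    have hi1 : IntervalIntegrable
        (fun u : ℝ => ∑ j ∈ Finset.range q, Ψ (f (proj (u + j / q, y)))) volume 0 1 :=
      (continuous_finsetSum _ fun j _ =>
        hΨc.comp (hfc.comp (continuous_proj.comp (by fun_prop)))).intervalIntegrable _ _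
    rw [h3, ← h4, ← intervalIntegral.integral_const_mul, ← intervalIntegral.integral_sub hi1 hi2]
    have := abs_integral_le_of_forall_le (c := L) zero_le_one (f := fun u : ℝ =>
      ∑ j ∈ Finset.range q, Ψ (f (proj (u + j / q, y))) - q * circleMean Ψ (F (u * q, y)).2)
      fun u _ => by
        have h6 : ∑ j ∈ Finset.range q, Ψ (f (proj (u + j / q, y))) =
            ∑ j ∈ Finset.range q, Ψ (proj ((F (u * q, y)).1 / q + j / q, (F (u * q, y)).2)) :=
          Finset.sum_congr rfl fun j _ => by
            have := scaled_apply_proj_add hFe hf u y j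
            simp only [Int.cast_natCast] at this
            rw [this]
        rw [h6]
        exact abs_sum_sub_circleMean_le hL hΨ hq0 _ _
    simpa using this
  rw [← mul_sub, abs_mul, abs_of_pos hq'] at h5
  rw [le_div_iff₀ hq', mul_comm]
  exact h5

/-- Birkhoff sums of the rotation by `p / q + 1 / (l q²)`, seen through a diffeomorphism commuting
with the rotation by `1 / q`, are sums of circle means along a transversal curve. -/
theorem abs_sum_sub_sum_circleMean_le (hL : 0 ≤ L) (hΨ : ∀ a b, |Ψ a - Ψ b| ≤ L * dist a b)
    (hFe : IsEquivariant F) (hq0 : 0 < q) {hq : (q : ℝ) ≠ 0}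
    (hf : ((hscale q hq)⁻¹ * F * hscale q hq, f) ∈ liftGroup) {p : ℤ} (hp : IsCoprime p q)
    {L' : ℝ} (hL' : 0 ≤ L') (hΨf : ∀ a b, |Ψ (f a) - Ψ (f b)| ≤ L' * dist a b) {l : ℕ}
    (hl : 0 < l) (y : ℝ) (b : ℕ) :
    |∑ i ∈ Finset.range (b * q), Ψ (f (proj (i * (p / q + 1 / (l * q ^ 2)), y))) -
      q * ∑ c ∈ Finset.range b, circleMean Ψ (F (c / l, y)).2| ≤ b * (L' / l + L) := by
  have hq' : (0 : ℝ) < q := by exact_mod_cast hq0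
  have hl' : (0 : ℝ) < l := by exact_mod_cast hl
  have hblock (c : ℕ) : |∑ j ∈ Finset.range q,
      Ψ (f (proj (((c * q + j : ℕ) : ℝ) * (p / q + 1 / (l * q ^ 2)), y))) -
      q * circleMean Ψ (F (c / l, y)).2| ≤ L' / l + L := by
    -- The drift accumulated after `c` blocks of length `q`; after rescaling by `q` it is the time
    -- `c / l` on the curve. Inside a block the further drift is at most `1 / (l * q)`.
    set x : ℝ := c / (l * q) with hx
    have hxq : x * q = c / l := by rw [hx]; field_simp
    have h1 (j : ℕ) (hj : j ∈ Finset.range q) :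
        |Ψ (f (proj (((c * q + j : ℕ) : ℝ) * (p / q + 1 / (l * q ^ 2)), y))) -
          Ψ (f (proj (x + ((j * p : ℤ) : ℝ) / q, y)))| ≤ L' * (1 / (l * q)) := by
      have hjq : (j : ℝ) ≤ q := by exact_mod_cast (Finset.mem_range.1 hj).le
      have h2 : proj (((c * q + j : ℕ) : ℝ) * (p / q + 1 / (l * q ^ 2)), y) =
          proj (x + ((j * p : ℤ) : ℝ) / q + j / (l * q ^ 2), y) := by
        rw [eq_comm, proj_eq_iff]
        refine ⟨c * p, 0, ?_⟩
        ext
        · simp [hx]; field_simp; ring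
        · simp
      rw [h2]
      refine (hΨf _ _).trans (mul_le_mul_of_nonneg_left ((dist_proj_left _ _ _).trans ?_) hL')
      rw [add_sub_cancel_left, abs_of_nonneg (by positivity), div_le_div_iff₀ (by positivity)
        (by positivity)]
      nlinarith [mul_pos hl' hq']
    have h3 : ∑ j ∈ Finset.range q, Ψ (f (proj (x + ((j * p : ℤ) : ℝ) / q, y))) =
        ∑ j ∈ Finset.range q, Ψ (proj ((F (c / l, y)).1 / q + j / q, (F (c / l, y)).2)) := by
      simp only [scaled_apply_proj_add hFe hf, hxq]
      have := sum_mul_div_eq_sum_div (fun s => Ψ (((((F (c / l, y)).1 / q : ℝ) : UnitAddCircle) + s),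
        (((F (c / l, y)).2 : ℝ) : UnitAddCircle))) hq0 hp
      push_cast
      exact this
    have h4 := abs_sum_sub_circleMean_le hL hΨ hq0 ((F (c / l, y)).1 / q) (F (c / l, y)).2
    rw [← h3] at h4
    have h5 : |∑ j ∈ Finset.range q,
        Ψ (f (proj (((c * q + j : ℕ) : ℝ) * (p / q + 1 / (l * q ^ 2)), y))) -
        ∑ j ∈ Finset.range q, Ψ (f (proj (x + ((j * p : ℤ) : ℝ) / q, y)))| ≤ L' / l := by
      rw [← Finset.sum_sub_distrib]
      refine (Finset.abs_sum_le_sum_abs _ _).trans ((Finset.sum_le_card_nsmul _ _ _ h1).trans ?_)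
      rw [Finset.card_range, nsmul_eq_mul]
      apply le_of_eq
      field_simp
    have := abs_sub_le (∑ j ∈ Finset.range q,
        Ψ (f (proj (((c * q + j : ℕ) : ℝ) * (p / q + 1 / (l * q ^ 2)), y))))
      (∑ j ∈ Finset.range q, Ψ (f (proj (x + ((j * p : ℤ) : ℝ) / q, y))))
      (q * circleMean Ψ (F (c / l, y)).2)
    linarith
  have hsum : ∑ i ∈ Finset.range (b * q), Ψ (f (proj (i * (p / q + 1 / (l * q ^ 2)), y))) =
      ∑ c ∈ Finset.range b, ∑ j ∈ Finset.range q,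
        Ψ (f (proj (((c * q + j : ℕ) : ℝ) * (p / q + 1 / (l * q ^ 2)), y))) := by
    induction b with
    | zero => simp
    | succ b ih => rw [add_mul, one_mul, Finset.sum_range_add, ih, Finset.sum_range_succ]
  rw [hsum, Finset.mul_sum, ← Finset.sum_sub_distrib]
  refine (Finset.abs_sum_le_sum_abs _ _).trans
    ((Finset.sum_le_card_nsmul _ _ _ fun c _ => hblock c).trans ?_)
  rw [Finset.card_range, nsmul_eq_mul]

/-- The errors are: `κ` from the time average along the curve, `L / q` from sampling circles by `q`
points, the `1 / l` term from the drift within a block and from sampling the curve, and `q / N` from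
the incomplete last block. -/
theorem abs_average_sub_le (hL : 0 ≤ L) (hΨ : ∀ a b, |Ψ a - Ψ b| ≤ L * dist a b)
    (hFe : IsEquivariant F) (hq0 : 0 < q) {hq : (q : ℝ) ≠ 0}
    (hf : ((hscale q hq)⁻¹ * F * hscale q hq, f) ∈ liftGroup) {p : ℤ} (hp : IsCoprime p q)
    {L' C : ℝ} (hL' : 0 ≤ L') (hΨf : ∀ a b, |Ψ (f a) - Ψ (f b)| ≤ L' * dist a b)
    (hC : ∀ z w, dist (F z) (F w) ≤ C * dist z w) (hC0 : 0 ≤ C) {l : ℕ} (hl : 0 < l) (y : ℝ)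
    {μ κ : ℝ} (hosc : ∀ z, |Ψ z - μ| ≤ 1) (hκ : 0 ≤ κ)
    (hwind : ∀ S, 0 ≤ S → |∫ t in (0 : ℝ)..S, (circleMean Ψ (F (t, y)).2 - μ)| ≤ κ * S)
    {N : ℕ} (hN : 0 < N) :
    |(1 / (N : ℝ)) * ∑ i ∈ Finset.range N, Ψ (f (proj (i * (p / q + 1 / (l * q ^ 2)), y))) - μ| ≤
      κ + L / q + (L' + L * C) / l + q / N := by
  have hq' : (0 : ℝ) < q := by exact_mod_cast hq0
  have hl' : (0 : ℝ) < l := by exact_mod_cast hl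
  have hN' : (0 : ℝ) < N := by exact_mod_cast hN
  have hq1 : (1 : ℝ) ≤ q := by exact_mod_cast hq0
  set b := N / q with hb
  set a : ℕ → ℝ := fun i => Ψ (f (proj (i * (p / q + 1 / (l * q ^ 2)), y))) with ha
  have hK (s t : ℝ) : |circleMean Ψ (F (s, y)).2 - μ - (circleMean Ψ (F (t, y)).2 - μ)| ≤
      L * C * |s - t| := by
    rw [sub_sub_sub_cancel_right, mul_assoc]
    refine (abs_circleMean_sub_le hL hΨ _ _).trans (mul_le_mul_of_nonneg_left ?_ hL)
    have h1 := hC (s, y) (t, y)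
    have h2 : dist ((s, y) : ℝ × ℝ) (t, y) = |s - t| := by simp [Prod.dist_eq, Real.dist_eq]
    rw [h2] at h1
    exact (le_max_right _ _).trans h1
  have h1 := abs_sum_sub_sum_circleMean_le hL hΨ hFe hq0 hf hp hL' hΨf hl y b
  have h2 := abs_sum_sub_integral_le hK hl b
  have h3 := hwind (b / l) (by positivity)
  have h4 : |∑ c ∈ Finset.range b, (circleMean Ψ (F (c / l, y)).2 - μ)| ≤
      b * (L * C / l) + κ * b := by
    have h5 : |(l : ℝ) * ∫ t in (0 : ℝ)..b / l, (circleMean Ψ (F (t, y)).2 - μ)| ≤ κ * b := by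
      rw [abs_mul, abs_of_pos hl']
      calc _ ≤ l * (κ * (b / l)) := by gcongr
        _ = κ * b := by field_simp
    have := abs_sub_abs_le_abs_sub (∑ c ∈ Finset.range b, (circleMean Ψ (F (c / l, y)).2 - μ))
      (l * ∫ t in (0 : ℝ)..b / l, (circleMean Ψ (F (t, y)).2 - μ))
    linarith
  rw [Finset.sum_sub_distrib, Finset.sum_const, Finset.card_range, nsmul_eq_mul] at h4
  have h6 : |∑ i ∈ Finset.range (b * q), (a i - μ)| ≤
      b * (L' / l + L) + q * (b * (L * C / l) + κ * b) := by
    rw [Finset.sum_sub_distrib, Finset.sum_const, Finset.card_range, nsmul_eq_mul]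
    have h7 : |q * (∑ c ∈ Finset.range b, circleMean Ψ (F (c / l, y)).2 - b * μ)| ≤
        q * (b * (L * C / l) + κ * b) := by
      rw [abs_mul, abs_of_pos hq']; gcongr
    have := abs_add_le (∑ i ∈ Finset.range (b * q), a i -
      q * ∑ c ∈ Finset.range b, circleMean Ψ (F (c / l, y)).2)
      (q * (∑ c ∈ Finset.range b, circleMean Ψ (F (c / l, y)).2 - b * μ))
    have h8 : ∑ i ∈ Finset.range (b * q), a i - ((b * q : ℕ) : ℝ) * μ =
      (∑ i ∈ Finset.range (b * q), a i - q * ∑ c ∈ Finset.range b, circleMean Ψ (F (c / l, y)).2) +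
      (q * (∑ c ∈ Finset.range b, circleMean Ψ (F (c / l, y)).2 - b * μ)) := by
      push_cast; ring
    rw [h8]
    linarith
  have h9 : |∑ i ∈ Finset.range N, (a i - μ)| ≤
      b * (L' / l + L) + q * (b * (L * C / l) + κ * b) + q := by
    have hdiv : N = b * q + N % q := by rw [hb, mul_comm]; exact (Nat.div_add_mod N q).symm
    rw [hdiv, Finset.sum_range_add]
    refine (abs_add_le _ _).trans (add_le_add h6 ?_)
    refine (Finset.abs_sum_le_sum_abs _ _).trans
      ((Finset.sum_le_card_nsmul _ _ 1 fun i _ => hosc _).trans ?_)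
    rw [Finset.card_range, nsmul_eq_mul, mul_one]
    exact_mod_cast (Nat.mod_lt _ hq0).le
  have hbq : (b : ℝ) * q ≤ N := by exact_mod_cast Nat.div_mul_le_self N q
  have h10 : (1 / (N : ℝ)) * ∑ i ∈ Finset.range N, a i - μ =
      (1 / (N : ℝ)) * ∑ i ∈ Finset.range N, (a i - μ) := by
    rw [Finset.sum_sub_distrib, Finset.sum_const, Finset.card_range, nsmul_eq_mul]
    field_simp
  rw [h10, abs_mul, abs_of_pos (by positivity), one_div, inv_mul_le_iff₀ hN']
  refine h9.trans ?_
  have e1 : (b : ℝ) * (L' / l + L) + q * (b * (L * C / l) + κ * b) + q =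
      (b * q) * (κ + L / q + (L' / q + L * C) / l) + q := by field_simp; ring
  have e2 : (N : ℝ) * (κ + L / q + (L' + L * C) / l + q / N) =
      N * (κ + L / q + (L' + L * C) / l) + q := by field_simp
  rw [e1, e2]
  have hLq : L' / q ≤ L' := div_le_self hL' hq1
  gcongr

end

/-! ### The conjugating diffeomorphism of one step. -/

theorem abs_comp_sub_le {φ : Torus → ℝ} (hφ : LipschitzWith 1 φ) {H : Torus → Torus} {L : ℝ}
    (hH : ∀ a b, dist (H a) (H b) ≤ L * dist a b) (a b : Torus) :
    |φ (H a) - φ (H b)| ≤ L * dist a b := by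
  have := hφ.dist_le_mul (H a) (H b)
  rw [Real.dist_eq, NNReal.coe_one, one_mul] at this
  exact this.trans (hH a b)

theorem shift_mul_scaled {F : Equiv.Perm (ℝ × ℝ)} (hFe : IsEquivariant F) {q : ℕ}
    (hq : (q : ℝ) ≠ 0) (p : ℤ) :
    shift (p / q) * ((hscale q hq)⁻¹ * F * hscale q hq) =
      (hscale q hq)⁻¹ * F * hscale q hq * shift (p / q) := by
  ext1 z
  have h := hFe (z.1 * q, z.2) p 0
  have h1 : (z.1 + p / q) * q = z.1 * q + p := by field_simp
  change ((F (z.1 * q, z.2)).1 * (q : ℝ)⁻¹ + p / q, (F (z.1 * q, z.2)).2) =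
    ((F ((z.1 + p / q) * q, z.2)).1 * (q : ℝ)⁻¹, (F ((z.1 + p / q) * q, z.2)).2)
  simp only [Int.cast_zero, Prod.mk_add_mk, add_zero] at h
  rw [h1, h]
  simp [add_mul, div_eq_mul_inv]

theorem rotation_apply_proj (t : ℝ) (z : ℝ × ℝ) :
    rotation t (proj z) = proj (z.1 + t, z.2) := rfl

theorem mul_eq_mul_of_lift {F G F' G' : Equiv.Perm (ℝ × ℝ)} {f g f' g' : Equiv.Perm Torus}
    (hF : ∀ z, proj (F z) = f (proj z)) (hG : ∀ z, proj (G z) = g (proj z))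
    (hF' : ∀ z, proj (F' z) = f' (proj z)) (hG' : ∀ z, proj (G' z) = g' (proj z))
    (h : F * G = F' * G') : f * g = f' * g' := by
  ext1 x
  obtain ⟨z, rfl⟩ := proj_surjective x
  rw [Equiv.Perm.mul_apply, Equiv.Perm.mul_apply, ← hG, ← hF, ← hG', ← hF',
    ← Equiv.Perm.mul_apply, h, Equiv.Perm.mul_apply]

/-- The conjugating diffeomorphism of one step of the construction. -/
theorem exists_step_diffeo {P : Equiv.Perm (ℝ × ℝ) × Equiv.Perm Torus} (hP : P ∈ liftGroup)
    {L : ℝ} (hL : 0 ≤ L) (hH : ∀ a b, dist (P.2 a) (P.2 b) ≤ L * dist a b) {q : ℕ} (hq0 : 0 < q)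
    {p : ℤ} (hp : IsCoprime p q) {w e τ δ : ℝ} (hw : 0 < w) (hw8 : w ≤ 1 / 8) (he1 : e ≤ 1)
    (hτ : 0 < τ) (hτ1 : τ ≤ 1) (hδ : 0 < δ)
    (hmean : ∀ φ : Torus → ℝ, LipschitzWith 1 φ → ∀ y, |y| ≤ w →
      |circleMean (fun z => φ (P.2 z)) y - ∫ z, φ z| ≤ e) :
    ∃ R ∈ liftGroup, shift (p / q) * R.1 = R.1 * shift (p / q) ∧
      (∀ z : ℝ × ℝ, δ ≤ ‖((z.1 * q : ℝ) : UnitAddCircle)‖ → δ ≤ ‖(z.2 : UnitAddCircle)‖ →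
        R.2 (proj z) = proj z) ∧
      ∃ w', 0 < w' ∧ w' ≤ w ∧
        (∀ y, |y| ≤ w → ∃ y', |y'| ≤ w' ∧ R.2 (proj (0, y')) = proj (0, y)) ∧
        (∀ φ : Torus → ℝ, LipschitzWith 1 φ → ∀ y, |y| ≤ w' →
          |circleMean (fun z => φ (P.2 (R.2 z))) y - ∫ z, φ z| ≤ τ + L / q) ∧
        ∃ Λ, 0 ≤ Λ ∧ ∀ φ : Torus → ℝ, LipschitzWith 1 φ → ∀ y, |y| ≤ w' → ∀ l : ℕ, 0 < l →
          ∀ N : ℕ, 0 < N → |(1 / (N : ℝ)) * ∑ i ∈ Finset.range N,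
            φ (P.2 (R.2 (proj (i * (p / q + 1 / (l * q ^ 2)), y)))) - ∫ z, φ z| ≤
              e + τ + L / q + Λ / l + q / N := by
  have hq : (q : ℝ) ≠ 0 := by exact_mod_cast hq0.ne'
  obtain ⟨F, hFs, hFid, w', hw', hw'w, hseg, hwind⟩ := exists_winding_diffeo hτ hτ1 hw hw8 hδ
  obtain ⟨f, hf⟩ := hFs q hq
  obtain ⟨g, hFg⟩ := hFs.exists_mem_liftGroup
  have hFe := hFg.2.1
  obtain ⟨C, hC0, hC⟩ := hFe.exists_lipschitz hFg.1.1
  obtain ⟨M, hM0, hM⟩ := lipschitz_of_mem_liftGroup hf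
  have hPc := continuous_of_mem_liftGroup hP
  have hint (φ : Torus → ℝ) (hφ : LipschitzWith 1 φ) : ∫ z, φ (P.2 z) = ∫ z, φ z := by
    have := integral_map hP.2.2.2.1.measurable.aemeasurable (f := φ) (μ := volume)
      hφ.continuous.aestronglyMeasurable
    rw [hP.2.2.2.1.map_eq] at this
    exact this.symm
  -- The winding estimate is applied to `θ = circleMean (φ ∘ P.2)`, whose mean is the space average
  -- of `φ` by Fubini and invariance of area.
  have hw2 (φ : Torus → ℝ) (hφ : LipschitzWith 1 φ) (y : ℝ) (hy : |y| ≤ w') :=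
    (hwind y hy).2 (circleMean fun z => φ (P.2 z)) (∫ z, φ z) e
      ((LipschitzWith.of_dist_le_mul (K := ⟨L, hL⟩) fun s t => by
        rw [Real.dist_eq, Real.dist_eq]
        exact abs_circleMean_sub_le hL (abs_comp_sub_le hφ hH) s t).continuous)
      (circleMean_periodic _)
      ((integral_circleMean (hφ.continuous.comp hPc)).trans (hint φ hφ))
      (fun t => by
        have h1 := abs_integral_le_of_forall_le (c := 1) zero_le_one
          (f := fun u : ℝ => φ (P.2 (proj (u, t))) - ∫ z, φ z) fun u _ =>
            (abs_sub_integral_le_half hφ _).trans (by norm_num)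
        have h2 : IntervalIntegrable (fun u : ℝ => φ (P.2 (proj (u, t)))) volume 0 1 :=
          (hφ.continuous.comp (hPc.comp (continuous_proj.comp (by fun_prop)))).intervalIntegrable _ _
        rw [intervalIntegral.integral_sub h2 (by simp)] at h1
        simpa [circleMean] using h1)
      (hmean φ hφ _ (hwind y hy).1) he1
  -- The constant `M * L + L * C` depends on the diffeomorphisms but not on `l`, so `l` may be
  -- chosen afterwards.
  refine ⟨_, hf, shift_mul_scaled hFe hq p, fun z h1 h2 => ?_, w', hw', hw'w, fun y hy => ?_,
    fun φ hφ y hy => ?_, M * L + L * C, by positivity, fun φ hφ y hy l hl N hN => ?_⟩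
  · have h3 := hFid (z.1 * q, z.2) h1 h2
    have h4 := scaled_apply_proj hf z.1 z.2
    rw [h3] at h4
    simp only [mul_div_cancel_right₀ _ hq] at h4
    exact h4
  · obtain ⟨y', h1, h2⟩ := hseg y hy
    refine ⟨y', h1, ?_⟩
    change f _ = _
    rw [scaled_apply_proj hf, zero_mul, h2, zero_div]
  · have h1 := abs_circleMean_comp_sub_le hL (abs_comp_sub_le hφ hH) hFe
      hFg.1.1.continuous hq0 hf y
    have h2 := (hw2 φ hφ y hy).2
    have h3 : IntervalIntegrable
        (fun t => circleMean (fun z => φ (P.2 z)) (F (t, y)).2) volume 0 1 := by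
      have : Continuous (circleMean fun z => φ (P.2 z)) :=
        (LipschitzWith.of_dist_le_mul (K := ⟨L, hL⟩) fun s t => by
          rw [Real.dist_eq, Real.dist_eq]
          exact abs_circleMean_sub_le hL (abs_comp_sub_le hφ hH) s t).continuous
      exact (this.comp (continuous_snd.comp
        (hFg.1.1.continuous.comp (by fun_prop)))).intervalIntegrable _ _
    rw [intervalIntegral.integral_sub h3 (by simp)] at h2
    simp only [intervalIntegral.integral_const, sub_zero, smul_eq_mul, one_mul] at h2
    have := abs_sub_le (circleMean (fun z => φ (P.2 (f z))) y)
      (∫ t in (0 : ℝ)..1, circleMean (fun z => φ (P.2 z)) (F (t, y)).2) (∫ z, φ z)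
    simp only at this ⊢
    linarith
  · have h1 := abs_average_sub_le hL (abs_comp_sub_le hφ hH) hFe hq0 hf hp (L' := M * L)
      (by positivity) (fun a b => (abs_comp_sub_le hφ hH _ _).trans (by
        rw [mul_comm M L, mul_assoc]; exact mul_le_mul_of_nonneg_left (hM a b) hL)) hC hC0 hl y
      (μ := ∫ z, φ z) (κ := e + τ)
      (fun z => (abs_sub_integral_le_half hφ _).trans (by norm_num))
      (by
        have := (abs_nonneg _).trans (hmean φ hφ 0 (by rw [abs_zero]; exact hw.le))
        linarith)
      (hw2 φ hφ y hy).1 hN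
    exact h1

/-! ### Smooth convergence and limits of diffeomorphisms. -/

section

variable {E V W : Type*} [NormedAddCommGroup E] [NormedSpace ℝ E] [NormedAddCommGroup V]
  [NormedSpace ℝ V] [NormedAddCommGroup W] [NormedSpace ℝ W]

/-- The partial derivatives are the total derivative restricted along the inclusion of the second
factor, which makes joint continuity visible. -/
theorem continuous_iteratedFDeriv_snd {Φ : E × V → W} (hΦ : ContDiff ℝ ∞ Φ) (k : ℕ) :
    Continuous fun p : E × V => iteratedFDeriv ℝ k (fun z => Φ (p.1, z)) p.2 := by
  have h1 (t : E) (z : V) : iteratedFDeriv ℝ k (fun z => Φ (t, z)) z =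
      (iteratedFDeriv ℝ k Φ (t, z)).compContinuousLinearMap
        fun _ => ContinuousLinearMap.inr ℝ E V := by
    have h2 : (fun z => Φ (t, z)) =
        (fun w => Φ ((t, 0) + w)) ∘ ContinuousLinearMap.inr ℝ E V := by
      ext z; simp
    have h3 : ContDiff ℝ ∞ fun w => Φ ((t, 0) + w) := hΦ.comp (contDiff_const.add contDiff_id)
    rw [h2, ContinuousLinearMap.iteratedFDeriv_comp_right _ h3 z (i := k)
      (by exact_mod_cast le_top), iteratedFDeriv_comp_add_left]
    simp
  simp only [h1]
  have h4 : Continuous fun p : E × V => iteratedFDeriv ℝ k Φ (p.1, p.2) :=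
    hΦ.continuous_iteratedFDeriv (by exact_mod_cast le_top)
  exact (ContinuousMultilinearMap.compContinuousLinearMapL
    fun _ : Fin k => ContinuousLinearMap.inr ℝ E V).continuous.comp h4

end

/-- A smooth one-parameter family of equivariant maps depends continuously on the parameter,
uniformly with all derivatives. -/
theorem eventually_norm_iteratedFDeriv_sub_le {Φ : ℝ × (ℝ × ℝ) → ℝ × ℝ} (hΦ : ContDiff ℝ ∞ Φ)
    (he : ∀ t, IsEquivariant fun z => Φ (t, z)) (c : ℝ) (k : ℕ) {ε : ℝ} (hε : 0 < ε) :
    ∀ᶠ t in 𝓝 c, ∀ z,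
      ‖iteratedFDeriv ℝ k ((fun z => Φ (t, z)) - fun z => Φ (c, z)) z‖ ≤ ε := by
  have hs (t : ℝ) : ContDiff ℝ ∞ fun z => Φ (t, z) := hΦ.comp (contDiff_const.prodMk contDiff_id)
  have hsub (t : ℝ) (z : ℝ × ℝ) :
      iteratedFDeriv ℝ k ((fun z => Φ (t, z)) - fun z => Φ (c, z)) z =
        iteratedFDeriv ℝ k (fun z => Φ (t, z)) z - iteratedFDeriv ℝ k (fun z => Φ (c, z)) z :=
    iteratedFDeriv_sub_apply ((hs t).of_le (by exact_mod_cast le_top)).contDiffAt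
      ((hs c).of_le (by exact_mod_cast le_top)).contDiffAt
  have hcont := continuous_iteratedFDeriv_snd hΦ k
  have hK : IsCompact (Set.Icc (0 : ℝ) 1 ×ˢ Set.Icc (0 : ℝ) 1) := isCompact_Icc.prod isCompact_Icc
  have hev : ∀ᶠ t in 𝓝 c, ∀ z ∈ Set.Icc (0 : ℝ) 1 ×ˢ Set.Icc (0 : ℝ) 1,
      ‖iteratedFDeriv ℝ k (fun z => Φ (t, z)) z - iteratedFDeriv ℝ k (fun z => Φ (c, z)) z‖ < ε := by
    refine hK.eventually_forall_of_forall_eventually fun z _ => ?_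
    have h1 : Continuous fun p : ℝ × (ℝ × ℝ) =>
        ‖iteratedFDeriv ℝ k (fun z => Φ (p.1, z)) p.2 -
          iteratedFDeriv ℝ k (fun z => Φ (c, z)) p.2‖ := by
      refine Continuous.norm (Continuous.sub hcont ?_)
      exact hcont.comp (continuous_const.prodMk continuous_snd)
    have h2 := h1.tendsto (c, z)
    simp only [sub_self, norm_zero] at h2
    exact h2.eventually (gt_mem_nhds hε)
  filter_upwards [hev] with t ht z
  have hper (m n : ℤ) (z : ℝ × ℝ) :
      iteratedFDeriv ℝ k ((fun z => Φ (t, z)) - fun z => Φ (c, z)) (z + ((m : ℝ), (n : ℝ))) =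
      iteratedFDeriv ℝ k ((fun z => Φ (t, z)) - fun z => Φ (c, z)) z := by
    have h3 : (fun w => ((fun z => Φ (t, z)) - fun z => Φ (c, z)) (w + ((m : ℝ), (n : ℝ)))) =
        (fun z => Φ (t, z)) - fun z => Φ (c, z) := by
      ext1 w
      have h4 := he t w m n
      have h5 := he c w m n
      simp only [Pi.sub_apply] at h4 h5 ⊢
      rw [h4, h5, add_sub_add_right_eq_sub]
    rw [← iteratedFDeriv_comp_add_right, h3]
  have hz : ((Int.fract z.1, Int.fract z.2) : ℝ × ℝ) + ((⌊z.1⌋ : ℝ), (⌊z.2⌋ : ℝ)) = z := by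
    ext <;> simp
  rw [← hz, hper, hsub]
  exact (ht _ ⟨⟨Int.fract_nonneg _, (Int.fract_lt_one _).le⟩,
    ⟨Int.fract_nonneg _, (Int.fract_lt_one _).le⟩⟩).le

theorem eventually_shift_conj_close {P : Equiv.Perm (ℝ × ℝ) × Equiv.Perm Torus}
    (hP : P ∈ liftGroup) (c : ℝ) (k : ℕ) {ε : ℝ} (hε : 0 < ε) :
    ∀ᶠ t in 𝓝 c, ∀ z, ‖iteratedFDeriv ℝ k
      (⇑(P.1 * shift t * P.1⁻¹) - ⇑(P.1 * shift c * P.1⁻¹)) z‖ ≤ ε := by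
  refine eventually_norm_iteratedFDeriv_sub_le
    (Φ := fun p : ℝ × (ℝ × ℝ) => P.1 (P.1.symm p.2 + (p.1, 0))) ?_ ?_ c k hε |>.mono ?_
  · exact hP.1.1.comp ((hP.1.2.comp contDiff_snd).add (contDiff_fst.prodMk contDiff_const))
  · intro t z m n
    have h := (liftGroup.inv_mem hP).2.1 z m n
    change P.1.symm _ = P.1.symm z + _ at h
    simp only
    rw [h, add_right_comm, hP.2.1]
  · intro t ht z
    have hfun (t : ℝ) : ⇑(P.1 * shift t * P.1⁻¹) = fun z => P.1 (P.1.symm z + (t, 0)) := by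
      ext1 z
      change P.1 (_, _) = P.1 _
      congr 1
      ext <;> simp [Equiv.Perm.inv_def]
    rw [hfun, hfun]
    exact ht z

/-- Derivatives of order `k` are controlled only from index `k` on, so `C^k` regularity of the limit
is read off from `F k` plus the tail of the telescoping series. -/
theorem exists_smooth_limit {V W : Type*} [NormedAddCommGroup V] [NormedSpace ℝ V]
    [NormedAddCommGroup W] [NormedSpace ℝ W] [CompleteSpace W] {F : ℕ → V → W}
    (hF : ∀ n, ContDiff ℝ ∞ (F n))
    (h : ∀ n k, k ≤ n → ∀ z, ‖iteratedFDeriv ℝ k (F (n + 1) - F n) z‖ ≤ (1 / 2) ^ n) :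
    ∃ G : V → W, ContDiff ℝ ∞ G ∧
      ∀ k n, k ≤ n → ∀ z, ‖iteratedFDeriv ℝ k (F n - G) z‖ ≤ 2 * (1 / 2) ^ n := by
  have hd (n : ℕ) : ContDiff ℝ ∞ (F (n + 1) - F n) := (hF _).sub (hF _)
  have hsum (n : ℕ) : Summable fun i : ℕ => (1 / 2 : ℝ) ^ (n + i) := by
    simpa only [pow_add] using summable_geometric_two.mul_left ((1 / 2 : ℝ) ^ n)
  have htsum (n : ℕ) : ∑' i : ℕ, (1 / 2 : ℝ) ^ (n + i) = 2 * (1 / 2) ^ n := by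
    simp only [pow_add]
    rw [tsum_mul_left, tsum_geometric_two, mul_comm]
  have hz (z : V) : Summable fun i => (F (i + 1) - F i) z :=
    Summable.of_norm_bounded summable_geometric_two fun i => by
      simpa using h i 0 (Nat.zero_le _) z
  set G : V → W := fun z => F 0 z + ∑' i, (F (i + 1) - F i) z with hG
  have htail (n : ℕ) : F n - G = fun z => -∑' i, (F (n + i + 1) - F (n + i)) z := by
    ext1 z
    have h1 := (hz z).sum_add_tsum_nat_add n
    have h2 : ∑ i ∈ Finset.range n, (F (i + 1) - F i) z = F n z - F 0 z :=
      Finset.sum_range_sub (fun i => F i z) n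
    rw [h2] at h1
    simp only [add_comm _ n] at h1
    simp only [Pi.sub_apply, hG] at h1 ⊢
    rw [← h1]
    abel
  have hbound (k n : ℕ) (hkn : k ≤ n) (j i : ℕ) (hj : (j : ℕ∞) ≤ k) (z : V) :
      ‖iteratedFDeriv ℝ j (F (n + i + 1) - F (n + i)) z‖ ≤ (1 / 2) ^ (n + i) :=
    h (n + i) j (by have : j ≤ k := by exact_mod_cast hj
                    omega) z
  have hdk (k n i : ℕ) : ContDiff ℝ ((k : ℕ∞) : WithTop ℕ∞) (F (n + i + 1) - F (n + i)) :=
    (hd _).of_le (by exact_mod_cast le_top)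
  have hts (k n : ℕ) (hkn : k ≤ n) : ContDiff ℝ ((k : ℕ∞) : WithTop ℕ∞)
      fun z => ∑' i, (F (n + i + 1) - F (n + i)) z :=
    contDiff_tsum (v := fun _ i => (1 / 2 : ℝ) ^ (n + i)) (hdk k n) (fun _ _ => hsum n)
      fun j i z hj => hbound k n hkn j i hj z
  refine ⟨G, contDiff_infty.2 fun k => ?_, fun k n hkn z => ?_⟩
  · have h1 : G = fun z => F k z + ∑' i, (F (k + i + 1) - F (k + i)) z := by
      ext1 z
      have := congrFun (htail k) z
      simp only [Pi.sub_apply] at this ⊢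
      rw [← neg_neg (∑' _, _), ← this]
      abel
    rw [h1]
    exact ((hF k).of_le (by exact_mod_cast le_top)).add (hts k k le_rfl)
  · rw [htail]
    have h1 := iteratedFDeriv_tsum (v := fun _ i => (1 / 2 : ℝ) ^ (n + i)) (hdk k n)
      (fun _ _ => hsum n) (fun j i z hj => hbound k n hkn j i hj z) (k := k) le_rfl
    have h2 : iteratedFDeriv ℝ k (fun z => -∑' i, (F (n + i + 1) - F (n + i)) z) z =
        -iteratedFDeriv ℝ k (fun z => ∑' i, (F (n + i + 1) - F (n + i)) z) z :=
      iteratedFDeriv_neg_apply (f := fun z => ∑' i, (F (n + i + 1) - F (n + i)) z)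
    rw [h2, h1, norm_neg, ← htsum]
    exact tsum_of_norm_bounded (hsum n).hasSum fun i => hbound k n hkn k i le_rfl z

theorem exists_descent {F : Equiv.Perm (ℝ × ℝ)} (hF : IsEquivariant F) :
    ∃ f : Equiv.Perm Torus, ∀ z, proj (F z) = f (proj z) := by
  have hF' : IsEquivariant F.symm := fun z m n => by
    rw [Equiv.symm_apply_eq, hF, Equiv.apply_symm_apply]
  have key {G : ℝ × ℝ → ℝ × ℝ} (hG : IsEquivariant G) (z : ℝ × ℝ) :
      proj (G (Function.surjInv proj_surjective (proj z))) = proj (G z) := by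
    obtain ⟨m, n, h⟩ := proj_eq_iff.1 (Function.surjInv_eq proj_surjective (proj z))
    rw [proj_eq_iff]
    exact ⟨m, n, by rw [← hG, ← h]⟩
  refine ⟨⟨fun x => proj (F (Function.surjInv proj_surjective x)),
    fun x => proj (F.symm (Function.surjInv proj_surjective x)), fun x => ?_, fun x => ?_⟩,
    fun z => (key hF z).symm⟩
  · simp only
    rw [key hF', Equiv.symm_apply_apply]
    exact Function.surjInv_eq proj_surjective x
  · simp only
    rw [key hF, Equiv.apply_symm_apply]
    exact Function.surjInv_eq proj_surjective x

theorem measurePreserving_of_tendsto {X : Type*} [MeasurableSpace X] [TopologicalSpace X]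
    [HasOuterApproxClosed X] [BorelSpace X] {μ : Measure X} [IsFiniteMeasure μ] {f : ℕ → X → X}
    {g : X → X} (hf : ∀ n, MeasurePreserving (f n) μ μ) (hg : Measurable g)
    (h : ∀ x, Tendsto (fun n => f n x) atTop (𝓝 (g x))) : MeasurePreserving g μ μ := by
  refine ⟨hg, ?_⟩
  refine ext_of_forall_integral_eq_of_IsFiniteMeasure fun φ => ?_
  have hφ := φ.continuous.aestronglyMeasurable (μ := μ)
  rw [integral_map hg.aemeasurable φ.continuous.aestronglyMeasurable]
  have h1 (n : ℕ) : ∫ x, φ (f n x) ∂μ = ∫ x, φ x ∂μ := by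
    rw [← integral_map (hf n).measurable.aemeasurable φ.continuous.aestronglyMeasurable,
      (hf n).map_eq]
  have h2 : Tendsto (fun n => ∫ x, φ (f n x) ∂μ) atTop (𝓝 (∫ x, φ (g x) ∂μ)) :=
    tendsto_integral_of_dominated_convergence (fun _ => ‖φ‖)
      (fun n => (φ.continuous.measurable.comp (hf n).measurable).aestronglyMeasurable)
      (integrable_const _) (fun n => ae_of_all _ fun x => φ.norm_coe_le_norm _)
      (ae_of_all _ fun x => (φ.continuous.tendsto _).comp (h x))
  simp only [h1] at h2
  exact tendsto_nhds_unique h2 tendsto_const_nhds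

theorem tendsto_iterate_of_tendstoUniformly {X : Type*} [PseudoMetricSpace X] {f : ℕ → X → X}
    {g : X → X} (hg : Continuous g) (h : TendstoUniformly f g atTop) (i : ℕ) (x : X) :
    Tendsto (fun n => (f n)^[i] x) atTop (𝓝 (g^[i] x)) := by
  induction i with
  | zero => exact tendsto_const_nhds
  | succ i ih =>
    simp only [Function.iterate_succ_apply']
    exact h.tendsto_comp hg.continuousAt ih

/-- A rapidly Cauchy sequence of area-preserving diffeomorphisms converges. -/
theorem exists_limit_diffeo {P : ℕ → Equiv.Perm (ℝ × ℝ) × Equiv.Perm Torus}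
    (hP : ∀ n, P n ∈ liftGroup)
    (h : ∀ n k, k ≤ n → ∀ z,
      ‖iteratedFDeriv ℝ k (⇑(P (n + 1)).1 - ⇑(P n).1) z‖ ≤ (1 / 2) ^ n)
    (h' : ∀ n k, k ≤ n → ∀ z,
      ‖iteratedFDeriv ℝ k (⇑(P (n + 1)).1.symm - ⇑(P n).1.symm) z‖ ≤ (1 / 2) ^ n) :
    ∃ Q ∈ liftGroup, DiffeoTendsto (fun n => (P n).2) Q.2 ∧
      ∀ i x, Tendsto (fun n => (P n).2^[i] x) atTop (𝓝 (Q.2^[i] x)) := by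
  obtain ⟨G, hG, hFG⟩ := exists_smooth_limit (F := fun n => ⇑(P n).1) (fun n => (hP n).1.1) h
  obtain ⟨G', hG', hFG'⟩ :=
    exists_smooth_limit (F := fun n => ⇑(P n).1.symm) (fun n => (hP n).1.2) h'
  have hlim : Tendsto (fun n : ℕ => 2 * (1 / 2 : ℝ) ^ n) atTop (𝓝 0) := by
    simpa using (tendsto_pow_atTop_nhds_zero_of_lt_one (r := (1 / 2 : ℝ)) (by norm_num)
      (by norm_num)).const_mul 2
  have hunif {F : ℕ → ℝ × ℝ → ℝ × ℝ} {G : ℝ × ℝ → ℝ × ℝ}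
      (hFG : ∀ k n, k ≤ n → ∀ z, ‖iteratedFDeriv ℝ k (F n - G) z‖ ≤ 2 * (1 / 2) ^ n) :
      TendstoUniformly F G atTop := by
    rw [Metric.tendstoUniformly_iff]
    intro ε hε
    filter_upwards [hlim.eventually (gt_mem_nhds hε)] with n hn z
    rw [dist_comm, dist_eq_norm]
    have := hFG 0 n (Nat.zero_le _) z
    rw [norm_iteratedFDeriv_zero] at this
    exact this.trans_lt hn
  have hev {F : ℕ → ℝ × ℝ → ℝ × ℝ} {G : ℝ × ℝ → ℝ × ℝ}
      (hFG : ∀ k n, k ≤ n → ∀ z, ‖iteratedFDeriv ℝ k (F n - G) z‖ ≤ 2 * (1 / 2) ^ n)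
      (k : ℕ) (ε : ℝ) (hε : ε > 0) :
      ∀ᶠ n in atTop, ∀ z, ‖iteratedFDeriv ℝ k (F n - G) z‖ < ε := by
    filter_upwards [hlim.eventually (gt_mem_nhds hε), eventually_ge_atTop k] with n hn hk z
    exact (hFG k n hk z).trans_lt hn
  have hu := hunif hFG
  have hu' := hunif hFG'
  -- The maps and their inverses converge together, so the limits are mutually inverse and the limit
  -- is again a diffeomorphism.
  have hinv (z : ℝ × ℝ) : G (G' z) = z := by
    have := hu.tendsto_comp hG.continuous.continuousAt (hu'.tendsto_at z)
    simp only [Equiv.apply_symm_apply] at this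
    exact tendsto_nhds_unique this tendsto_const_nhds
  have hinv' (z : ℝ × ℝ) : G' (G z) = z := by
    have := hu'.tendsto_comp hG'.continuous.continuousAt (hu.tendsto_at z)
    simp only [Equiv.symm_apply_apply] at this
    exact tendsto_nhds_unique this tendsto_const_nhds
  let Ĝ : Equiv.Perm (ℝ × ℝ) := ⟨G, G', hinv', hinv⟩
  have he : IsEquivariant Ĝ := fun z m n => by
    have h1 := hu.tendsto_at (z + ((m : ℝ), (n : ℝ)))
    have h2 := (hu.tendsto_at z).add_const ((m : ℝ), (n : ℝ))
    have h3 (k : ℕ) := (hP k).2.1 z m n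
    simp only [h3] at h1
    exact tendsto_nhds_unique h1 h2
  obtain ⟨g, hg⟩ := exists_descent he
  have hg' (z : ℝ × ℝ) : proj (G' z) = g.symm (proj z) := by
    rw [Equiv.eq_symm_apply, ← hg]
    exact congrArg proj (hinv z)
  have htor {F : ℕ → ℝ × ℝ → ℝ × ℝ} {G : ℝ × ℝ → ℝ × ℝ} {f : ℕ → Torus → Torus}
      {g : Torus → Torus} (hu : TendstoUniformly F G atTop)
      (hF : ∀ n z, proj (F n z) = f n (proj z)) (hG : ∀ z, proj (G z) = g (proj z)) :
      TendstoUniformly f g atTop := by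
    rw [Metric.tendstoUniformly_iff] at hu ⊢
    intro ε hε
    filter_upwards [hu ε hε] with n hn x
    obtain ⟨z, rfl⟩ := proj_surjective x
    rw [← hF, ← hG]
    exact (dist_proj_le _ _).trans_lt (hn z)
  have hquot {G : ℝ × ℝ → ℝ × ℝ} {g : Torus → Torus} (hG : ContDiff ℝ ∞ G)
      (he : IsEquivariant G) (hGg : ∀ z, proj (G z) = g (proj z)) : Continuous g := by
    obtain ⟨C, hC0, hC⟩ := he.exists_lipschitz hG
    refine (LipschitzWith.of_dist_le_mul (K := ⟨C, hC0⟩) fun a b => ?_).continuous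
    obtain ⟨z, rfl⟩ := proj_surjective a
    obtain ⟨w, rfl, hw⟩ := exists_proj_eq_dist_eq z b
    rw [← hw, ← hGg, ← hGg]
    exact (dist_proj_le _ _).trans (hC z w)
  have he' : IsEquivariant G' := fun z m n => by
    change Ĝ.symm _ = Ĝ.symm z + _
    rw [Equiv.symm_apply_eq, he, Equiv.apply_symm_apply]
  have hgc : Continuous g := hquot hG he hg
  have hgc' : Continuous g.symm := hquot hG' he' hg'
  have hPs (n : ℕ) := (liftGroup.inv_mem (hP n)).2.2.1
  have hut : TendstoUniformly (fun n => ⇑(P n).2) g atTop := htor hu (fun n => (hP n).2.2.1) hg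
  have hut' : TendstoUniformly (fun n => ⇑(P n).2.symm) g.symm atTop := htor hu' hPs hg'
  refine ⟨(Ĝ, g), ⟨⟨hG, hG'⟩, he, hg, ?_, ?_⟩, ⟨?_, ?_⟩, fun i x => ?_⟩
  · exact measurePreserving_of_tendsto (fun n => (hP n).2.2.2.1) hgc.measurable hut.tendsto_at
  · exact measurePreserving_of_tendsto (fun n => (hP n).2.2.2.2) hgc'.measurable hut'.tendsto_at
  · exact ⟨fun n => (P n).1, G, fun n => ⟨(hP n).1.1, (hP n).2.2.1⟩, ⟨hG, hg⟩, hev hFG⟩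
  · exact ⟨fun n => (P n).1.symm, G', fun n => ⟨(hP n).1.2, hPs n⟩, ⟨hG', hg'⟩, hev hFG'⟩
  · exact tendsto_iterate_of_tendstoUniformly hgc hut i x

/-! ### Stages and the inductive step. -/

/-- The data of a stage of the approximation-by-conjugation construction: the conjugacy (with its
lift), the rotation number `p / q`, and the half-length `w` of a vertical segment. -/
structure Stage where
  conj : Equiv.Perm (ℝ × ℝ) × Equiv.Perm Torus
  q : ℕ
  p : ℤ
  w : ℝ

/-- The periodic diffeomorphism of a stage, with its lift. -/
noncomputable def Stage.approx (s : Stage) : Equiv.Perm (ℝ × ℝ) × Equiv.Perm Torus :=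
  s.conj * (shift (s.p / s.q), rotation (s.p / s.q)) * s.conj⁻¹

/-- The invariants of the `n`-th stage. -/
structure Stage.Good (s : Stage) (n : ℕ) : Prop where
  mem : s.conj ∈ liftGroup
  q_pos : 0 < s.q
  coprime : IsCoprime s.p s.q
  w_pos : 0 < s.w
  w_le : s.w ≤ 1 / 8
  lipschitz : ∃ L : ℝ, 1 ≤ L ∧ (∀ a b, dist (s.conj.2 a) (s.conj.2 b) ≤ L * dist a b) ∧
    L / s.q ≤ (1 / 2) ^ (n + 2)
  mean : ∀ φ : Torus → ℝ, LipschitzWith 1 φ → ∀ y, |y| ≤ s.w →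
    |circleMean (fun z => φ (s.conj.2 z)) y - ∫ z, φ z| ≤ (1 / 2) ^ n

/-- The neighbourhood of a union of circles that contains the support of a conjugating
diffeomorphism. -/
def cross (q : ℕ) (δ : ℝ) : Set Torus := {z | ¬(δ ≤ ‖q • z.1‖ ∧ δ ≤ ‖z.2‖)}

/-- The passage from the `n`-th stage `s` to the next stage `s'`, where `R` is the new conjugating
diffeomorphism. -/
structure Stage.Step (α : ℝ) (n : ℕ) (s : Stage) (R : Equiv.Perm (ℝ × ℝ) × Equiv.Perm Torus)
    (l : ℕ) (s' : Stage) : Prop where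
  mem : R ∈ liftGroup
  l_pos : 0 < l
  conj_eq : s'.conj = s.conj * R
  q_eq : s'.q = l * s.q ^ 2
  p_eq : s'.p = l * s.q * s.p + 1
  comm : rotation (s.p / s.q) * R.2 = R.2 * rotation (s.p / s.q)
  support : ∃ (L : ℝ) (K : ℕ), 1 ≤ L ∧ 0 < K ∧
    (∀ a b, dist (s.conj.2 a) (s.conj.2 b) ≤ L * dist a b) ∧
    1 / (K : ℝ) ≤ (1 / 2) ^ (n + 4) ∧ 2 * L / K ≤ (1 / 2) ^ n ∧
    (s.q + 1) * K * (2 * L / K) ^ α ≤ (1 / 2) ^ n ∧ ∀ z ∉ cross s.q (1 / K), R.2 z = z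
  segment : ∀ y, |y| ≤ s.w → ∃ y', |y'| ≤ s'.w ∧ R.2 (proj (0, y')) = proj (0, y)
  average : ∀ φ : Torus → ℝ, LipschitzWith 1 φ → ∀ y, |y| ≤ s'.w → ∀ N : ℕ, 2 ^ n * s.q ≤ N →
    |(1 / (N : ℝ)) * ∑ i ∈ Finset.range N, φ (s'.conj.2 (proj (i * (s'.p / s'.q), y))) -
      ∫ z, φ z| ≤ 4 * (1 / 2) ^ n
  orbit : ∀ x, ∀ i ≤ 2 ^ n * s.q, dist (s'.approx.2^[i] x) (s.approx.2^[i] x) ≤ (1 / 2) ^ n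
  deriv : ∀ k ≤ n, ∀ z,
    ‖iteratedFDeriv ℝ k (⇑s'.approx.1 - ⇑s.approx.1) z‖ ≤ (1 / 2) ^ n
  deriv_symm : ∀ k ≤ n, ∀ z,
    ‖iteratedFDeriv ℝ k (⇑s'.approx.1.symm - ⇑s.approx.1.symm) z‖ ≤ (1 / 2) ^ n

theorem shift_add (s t : ℝ) : shift (s + t) = shift s * shift t := by
  ext ⟨x, y⟩
  · simp [shift]; ring
  · rfl

theorem rotation_add (s t : ℝ) : rotation (s + t) = rotation s * rotation t := by
  ext ⟨x, y⟩
  · simp [rotation]; abel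
  · rfl

theorem rotation_pow (t : ℝ) (i : ℕ) : rotation t ^ i = rotation (i * t) := by
  induction i with
  | zero =>
    ext ⟨x, y⟩
    · simp [rotation]
    · rfl
  | succ i ih => rw [pow_succ, ih, ← rotation_add]; congr 1; push_cast; ring

theorem shift_neg (t : ℝ) : shift (-t) = (shift t)⁻¹ := by
  rw [eq_inv_iff_mul_eq_one, ← shift_add, neg_add_cancel]
  ext ⟨x, y⟩
  · simp [shift]
  · rfl

theorem conj_rotation_iterate (g : Equiv.Perm Torus) (t : ℝ) (i : ℕ) (x : Torus) :
    (g * rotation t * g⁻¹)^[i] x = g (rotation (i * t) (g⁻¹ x)) := by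
  rw [← Equiv.Perm.coe_pow, conj_pow, rotation_pow]
  rfl

theorem Stage.approx_mem {s : Stage} {n : ℕ} (h : s.Good n) : s.approx ∈ liftGroup :=
  liftGroup.mul_mem (liftGroup.mul_mem h.mem (shift_mem_liftGroup _)) (liftGroup.inv_mem h.mem)

theorem dist_rotation_le (s t : ℝ) (x : Torus) :
    dist (rotation s x) (rotation t x) ≤ |s - t| := by
  obtain ⟨z, rfl⟩ := proj_surjective x
  rw [rotation_apply_proj, rotation_apply_proj]
  exact (dist_proj_left _ _ _).trans (by rw [add_sub_add_left_eq_sub])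

/-- The old approximant can be rewritten with the new conjugacy, so two consecutive approximants
differ only in their rotation numbers. -/
theorem mul_conj_eq_of_comm {G : Type*} [Group G] {g r a : G} (h : a * r = r * a) :
    g * a * g⁻¹ = g * r * a * (g * r)⁻¹ := by
  rw [mul_inv_rev, mul_assoc g r a, ← h]
  group

theorem tendsto_const_div_natCast (c : ℝ) : Tendsto (fun l : ℕ => c / (l : ℝ)) atTop (𝓝 0) :=
  tendsto_const_div_atTop_nhds_zero_nat c

/-- The last quantity, the `α`-dimensional size of a cover of the image of the cross, is a constant
times `K ^ (1 - α)`, and tends to zero because `α > 1`. -/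
theorem exists_fine_scale {α : ℝ} (hα : 1 < α) (n q : ℕ) {L : ℝ} (hL : 1 ≤ L) :
    ∃ K : ℕ, 0 < K ∧ 1 / (K : ℝ) ≤ (1 / 2) ^ (n + 4) ∧ 2 * L / K ≤ (1 / 2) ^ n ∧
      (q + 1) * K * (2 * L / K) ^ α ≤ (1 / 2) ^ n := by
  have h1 : ∀ᶠ K : ℕ in atTop, 1 / (K : ℝ) ≤ (1 / 2) ^ (n + 4) :=
    (tendsto_const_div_natCast 1).eventually (ge_mem_nhds (by positivity))
  have h2 : ∀ᶠ K : ℕ in atTop, 2 * L / (K : ℝ) ≤ (1 / 2) ^ n :=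
    (tendsto_const_div_natCast _).eventually (ge_mem_nhds (by positivity))
  have h3 : Tendsto (fun K : ℕ => (q + 1) * (2 * L) ^ α * (K : ℝ) ^ (-(α - 1))) atTop
      (𝓝 ((q + 1) * (2 * L) ^ α * 0)) :=
    ((tendsto_rpow_neg_atTop (sub_pos.2 hα)).comp tendsto_natCast_atTop_atTop).const_mul _
  rw [mul_zero] at h3
  have h4 := h3.eventually (ge_mem_nhds (by positivity : (0 : ℝ) < (1 / 2) ^ n))
  obtain ⟨K, hK0, hK1, hK2, hK3⟩ := ((eventually_gt_atTop 0).and (h1.and (h2.and h4))).exists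
  refine ⟨K, hK0, hK1, hK2, ?_⟩
  have hK : (0 : ℝ) < K := by exact_mod_cast hK0
  refine le_of_eq_of_le ?_ hK3
  rw [Real.div_rpow (by positivity) hK.le, neg_sub, Real.rpow_sub hK, Real.rpow_one]
  ring

/-- The order of choices matters: `K` after the Lipschitz constant of the current conjugacy, then
`R` supported in the cross of width `1 / K`, and finally `l`, large in terms of everything else. -/
theorem Stage.Good.exists_step {α : ℝ} (hα : 1 < α) {n : ℕ} {s : Stage} (hs : s.Good n) :
    ∃ R l s', s.Step α n R l s' ∧ s'.Good (n + 1) := by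
  obtain ⟨L, hL1, hL, hLq⟩ := hs.lipschitz
  obtain ⟨K, hK0, hK1, hK2, hK3⟩ := exists_fine_scale hα n s.q hL1
  have hq : (0 : ℝ) < s.q := by exact_mod_cast hs.q_pos
  have hq1 : (1 : ℝ) ≤ s.q := by exact_mod_cast hs.q_pos
  obtain ⟨R, hR, hcomm, hsupp, w', hw', hww', hseg, hmean, Λ, hΛ0, hΛ⟩ :=
    exists_step_diffeo hs.mem (by linarith) hL hs.q_pos hs.coprime hs.w_pos hs.w_le
      (e := (1 / 2) ^ n) (τ := (1 / 2) ^ (n + 2)) (δ := 1 / K)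
      (pow_le_one₀ (by norm_num) (by norm_num)) (by positivity)
      (pow_le_one₀ (by norm_num) (by norm_num)) (by positivity) hs.mean
  have hP' : s.conj * R ∈ liftGroup := liftGroup.mul_mem hs.mem hR
  obtain ⟨C, hC0, hC⟩ := lipschitz_of_mem_liftGroup hP'
  set L' := max C 1 with hL'def
  have hL' : ∀ a b, dist ((s.conj * R).2 a) ((s.conj * R).2 b) ≤ L' * dist a b := fun a b =>
    (hC a b).trans (mul_le_mul_of_nonneg_right (le_max_left _ _) dist_nonneg)
  have hL'1 : 1 ≤ L' := le_max_right _ _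
  have hlim : Tendsto (fun l : ℕ => (s.p / s.q : ℝ) + 1 / (l * s.q ^ 2)) atTop
      (𝓝 ((s.p : ℝ) / s.q)) := by
    have h1 := (tendsto_const_div_natCast (1 / (s.q : ℝ) ^ 2)).const_add (s.p / s.q : ℝ)
    rw [add_zero] at h1
    refine h1.congr fun l => ?_
    rw [div_div, mul_comm (_ ^ 2)]
  have e1 : ∀ᶠ l : ℕ in atTop, ∀ k ≤ n, ∀ z, ‖iteratedFDeriv ℝ k
      (⇑((s.conj * R).1 * shift (s.p / s.q + 1 / (l * s.q ^ 2)) * (s.conj * R).1⁻¹) -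
        ⇑((s.conj * R).1 * shift (s.p / s.q) * (s.conj * R).1⁻¹)) z‖ ≤ (1 / 2) ^ n :=
    ((Set.finite_Iic n).eventually_all.2 fun k _ =>
      hlim.eventually (eventually_shift_conj_close hP' _ k (by positivity)))
  have e2 : ∀ᶠ l : ℕ in atTop, ∀ k ≤ n, ∀ z, ‖iteratedFDeriv ℝ k
      (⇑((s.conj * R).1 * shift (-(s.p / s.q + 1 / (l * s.q ^ 2))) * (s.conj * R).1⁻¹) -
        ⇑((s.conj * R).1 * shift (-(s.p / s.q)) * (s.conj * R).1⁻¹)) z‖ ≤ (1 / 2) ^ n :=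
    ((Set.finite_Iic n).eventually_all.2 fun k _ =>
      hlim.neg.eventually (eventually_shift_conj_close hP' _ k (by positivity)))
  have e3 : ∀ᶠ l : ℕ in atTop, Λ / (l : ℝ) ≤ (1 / 2) ^ n :=
    (tendsto_const_div_natCast _).eventually (ge_mem_nhds (by positivity))
  have e4 : ∀ᶠ l : ℕ in atTop, L' * 2 ^ n / (l : ℝ) ≤ (1 / 2) ^ n :=
    (tendsto_const_div_natCast _).eventually (ge_mem_nhds (by positivity))
  have e5 : ∀ᶠ l : ℕ in atTop, L' / (l : ℝ) ≤ (1 / 2) ^ (n + 1 + 2) :=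
    (tendsto_const_div_natCast _).eventually (ge_mem_nhds (by positivity))
  obtain ⟨l, hl0, h1, h2, h3, h4, h5⟩ :=
    ((eventually_gt_atTop 0).and (e1.and (e2.and (e3.and (e4.and e5))))).exists
  have hl : (0 : ℝ) < l := by exact_mod_cast hl0
  have hl1 : (1 : ℝ) ≤ l := by exact_mod_cast hl0
  set s' : Stage := ⟨s.conj * R, l * s.q ^ 2, l * s.q * s.p + 1, w'⟩ with hs'
  have hratio : (s'.p / s'.q : ℝ) = s.p / s.q + 1 / (l * s.q ^ 2) := by
    simp only [hs']
    push_cast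
    field_simp
  have hrot : rotation (s.p / s.q) * R.2 = R.2 * rotation (s.p / s.q) :=
    mul_eq_mul_of_lift (fun _ => rfl) hR.2.2.1 hR.2.2.1 (fun _ => rfl) hcomm
  have ha1 : s.approx.1 = (s.conj * R).1 * shift (s.p / s.q) * (s.conj * R).1⁻¹ :=
    mul_conj_eq_of_comm hcomm
  have ha2 : s.approx.2 = (s.conj * R).2 * rotation (s.p / s.q) * (s.conj * R).2⁻¹ :=
    mul_conj_eq_of_comm hrot
  have ha1' : s'.approx.1 = (s.conj * R).1 * shift (s.p / s.q + 1 / (l * s.q ^ 2)) *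
      (s.conj * R).1⁻¹ := by
    rw [← hratio]; rfl
  have ha2' : s'.approx.2 = (s.conj * R).2 * rotation (s.p / s.q + 1 / (l * s.q ^ 2)) *
      (s.conj * R).2⁻¹ := by
    rw [← hratio]; rfl
  refine ⟨R, l, s', ⟨hR, hl0, rfl, rfl, rfl, hrot, ⟨L, K, hL1, hK0, hL, hK1, hK2, hK3, ?_⟩, hseg,
    ?_, ?_, ?_, ?_⟩, ⟨hP', ?_, ?_, hw', hww'.trans hs.w_le, ⟨L', hL'1, hL', ?_⟩, ?_⟩⟩
  · intro z hz
    obtain ⟨z, rfl⟩ := proj_surjective z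
    rw [cross, Set.mem_ofPred_eq, not_not] at hz
    refine hsupp z ?_ hz.2
    have : ((z.1 * s.q : ℝ) : UnitAddCircle) = s.q • (proj z).1 := by
      rw [mul_comm, ← nsmul_eq_mul]; rfl
    rw [this]
    exact hz.1
  · intro φ hφ y hy N hN
    have hN0 : 0 < N := lt_of_lt_of_le (Nat.mul_pos (by positivity) hs.q_pos) hN
    have h6 := hΛ φ hφ y hy l hl0 N hN0
    simp only [hratio]
    refine h6.trans ?_
    have h7 : (s.q : ℝ) / N ≤ (1 / 2) ^ n := by
      have hN' : (0 : ℝ) < N := by exact_mod_cast hN0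
      have h8 : (2 : ℝ) ^ n * s.q ≤ N := by exact_mod_cast hN
      rw [div_le_iff₀ hN', one_div, inv_pow, inv_mul_eq_div, le_div_iff₀ (by positivity), mul_comm]
      exact h8
    have h9 : (1 / 2 : ℝ) ^ (n + 2) = (1 / 2) ^ n / 4 := by rw [pow_add]; norm_num; ring
    have h10 : (0 : ℝ) < (1 / 2) ^ n := by positivity
    rw [h9] at hLq ⊢
    linarith
  · intro x i hi
    rw [ha2, ha2', conj_rotation_iterate, conj_rotation_iterate]
    refine (hL' _ _).trans ?_
    have h6 : |(i : ℝ) * (s.p / s.q + 1 / (l * s.q ^ 2)) - i * (s.p / s.q)| ≤ (2 : ℝ) ^ n / l := by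
      have h7 : (i : ℝ) ≤ 2 ^ n * s.q := by exact_mod_cast hi
      rw [← mul_sub, add_sub_cancel_left, abs_of_nonneg (by positivity)]
      calc (i : ℝ) * (1 / ((l : ℝ) * (s.q : ℝ) ^ 2)) ≤
          (2 : ℝ) ^ n * (s.q : ℝ) * (1 / ((l : ℝ) * (s.q : ℝ) ^ 2)) := by gcongr
        _ = (2 : ℝ) ^ n / (l : ℝ) / (s.q : ℝ) := by field_simp
        _ ≤ (2 : ℝ) ^ n / (l : ℝ) := div_le_self (by positivity) hq1
    calc _ ≤ L' * ((2 : ℝ) ^ n / l) :=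
          mul_le_mul_of_nonneg_left ((dist_rotation_le _ _ _).trans h6) (by linarith)
      _ = L' * 2 ^ n / l := by ring
      _ ≤ _ := h4
  · intro k hk z
    rw [ha1, ha1']
    exact h1 k hk z
  · intro k hk z
    have hsymm (t : ℝ) : ((s.conj * R).1 * shift t * (s.conj * R).1⁻¹).symm =
        (s.conj * R).1 * shift (-t) * (s.conj * R).1⁻¹ := by
      rw [shift_neg]
      change (_ * _ * _)⁻¹ = _
      group
    rw [ha1, ha1', hsymm, hsymm]
    exact h2 k hk z
  · exact Nat.mul_pos hl0 (pow_pos hs.q_pos 2)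
  -- The new numerator is `1` modulo both `l * q` and `q`, hence coprime to their product.
  · have h6 : IsCoprime (l * s.q * s.p + 1 : ℤ) (l * s.q) := ⟨1, -s.p, by ring⟩
    have h7 : IsCoprime (l * s.q * s.p + 1 : ℤ) s.q := ⟨1, -(l * s.p), by ring⟩
    have h8 := h6.mul_right h7
    simp only [hs']
    push_cast
    rwa [sq, ← mul_assoc]
  · refine le_trans ?_ h5
    simp only [hs']
    push_cast
    gcongr
    exact le_mul_of_one_le_right hl.le (one_le_pow₀ hq1)
  · intro φ hφ y hy
    refine (hmean φ hφ y hy).trans ?_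
    have h9 : (1 / 2 : ℝ) ^ (n + 2) = (1 / 2) ^ (n + 1) / 2 := by rw [pow_succ]; ring
    rw [h9] at hLq ⊢
    linarith

/-! ### Genericity of the vertical segment. -/

/-- The approximant is the infimal convolution of `φ` with `A * dist`. The slope `A = 2 * C / δ`
makes points farther than `δ` irrelevant, and nearer ones change `φ` by less than `ε`. -/
theorem exists_lipschitz_approx {X : Type*} [MetricSpace X] [CompactSpace X] [Nonempty X]
    {φ : X → ℝ} (hφ : Continuous φ) {ε : ℝ} (hε : 0 < ε) :
    ∃ (A : NNReal) (ψ : X → ℝ), LipschitzWith A ψ ∧ ∀ x, |φ x - ψ x| ≤ ε := by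
  obtain ⟨δ, hδ, hδε⟩ := Metric.uniformContinuous_iff.1
    (CompactSpace.uniformContinuous_of_continuous hφ) ε hε
  obtain ⟨C, hC⟩ := isCompact_univ.exists_bound_of_continuousOn hφ.continuousOn
  have hC' (x : X) : |φ x| ≤ C := hC x (Set.mem_univ x)
  have hC0 : 0 ≤ C := (abs_nonneg _).trans (hC' (Classical.arbitrary X))
  set A : ℝ := 2 * C / δ with hA
  have hA0 : 0 ≤ A := by positivity
  have hbdd (x : X) : BddBelow (Set.range fun y => φ y + A * dist x y) := by
    refine ⟨-C, ?_⟩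
    rintro _ ⟨y, rfl⟩
    have := (abs_le.1 (hC' y)).1
    have : 0 ≤ A * dist x y := by positivity
    simp only
    linarith
  refine ⟨⟨A, hA0⟩, fun x => ⨅ y, φ y + A * dist x y, LipschitzWith.of_le_add_mul _ ?_, ?_⟩
  · intro x y
    rw [← sub_le_iff_le_add]
    refine le_ciInf fun z => ?_
    rw [sub_le_iff_le_add]
    refine (ciInf_le (hbdd x) z).trans ?_
    have := mul_le_mul_of_nonneg_left (dist_triangle x y z) hA0
    change _ ≤ _ + A * _
    linarith
  · intro x
    have h1 : ⨅ y, φ y + A * dist x y ≤ φ x := by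
      simpa using ciInf_le (hbdd x) x
    have h2 : φ x - ε ≤ ⨅ y, φ y + A * dist x y := by
      refine le_ciInf fun y => ?_
      rcases lt_or_ge (dist x y) δ with h | h
      · have h3 := hδε h
        rw [Real.dist_eq, abs_lt] at h3
        have : 0 ≤ A * dist x y := by positivity
        linarith [h3.2]
      · have h4 : 2 * C ≤ A * dist x y := by
          calc 2 * C = A * δ := by rw [hA]; field_simp
            _ ≤ _ := by gcongr
        have := (abs_le.1 (hC' y)).1
        have := (abs_le.1 (hC' x)).2
        linarith
    rw [abs_of_nonneg (by linarith)]
    linarith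

theorem abs_average_le {a : ℕ → ℝ} {ε : ℝ} (hε : 0 ≤ ε) (N : ℕ)
    (h : ∀ i < N, |a i| ≤ ε) : |(1 / (N : ℝ)) * ∑ i ∈ Finset.range N, a i| ≤ ε := by
  rcases N.eq_zero_or_pos with rfl | hN
  · simpa using hε
  · have hN' : (0 : ℝ) < N := by exact_mod_cast hN
    rw [abs_mul, abs_of_pos (by positivity), one_div, inv_mul_le_iff₀ hN']
    refine (Finset.abs_sum_le_sum_abs _ _).trans ((Finset.sum_le_card_nsmul _ _ ε fun i hi =>
      h i (Finset.mem_range.1 hi)).trans ?_)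
    rw [Finset.card_range, nsmul_eq_mul]

theorem abs_average_sub_average_le {a b : ℕ → ℝ} {ε : ℝ} (hε : 0 ≤ ε) (N : ℕ)
    (h : ∀ i < N, |a i - b i| ≤ ε) :
    |(1 / (N : ℝ)) * ∑ i ∈ Finset.range N, a i - (1 / (N : ℝ)) * ∑ i ∈ Finset.range N, b i| ≤ ε := by
  rw [← mul_sub, ← Finset.sum_sub_distrib]
  exact abs_average_le hε N h

theorem integrable_of_continuous {φ : Torus → ℝ} (hφ : Continuous φ) : Integrable φ volume :=
  hφ.integrable_of_hasCompactSupport (HasCompactSupport.of_compactSpace φ)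

/-- Genericity can be tested on `1`-Lipschitz functions. -/
theorem mem_genericPoints_of_lipschitz {T : Torus → Torus} {x : Torus}
    (h : ∀ φ : Torus → ℝ, LipschitzWith 1 φ →
      Tendsto (fun N : ℕ => (1 / (N : ℝ)) * ∑ i ∈ Finset.range N, φ (T^[i] x)) atTop
        (𝓝 (∫ y, φ y))) : x ∈ genericPoints T := by
  have hlip (A : NNReal) (φ : Torus → ℝ) (hφ : LipschitzWith A φ) :
      Tendsto (fun N : ℕ => (1 / (N : ℝ)) * ∑ i ∈ Finset.range N, φ (T^[i] x)) atTop
        (𝓝 (∫ y, φ y)) := by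
    have hA : (0 : ℝ) < A + 1 := by positivity
    have h1 := (h (fun y => (A + 1 : ℝ)⁻¹ * φ y) (LipschitzWith.of_dist_le_mul fun a b => by
      rw [Real.dist_eq, ← mul_sub, abs_mul, abs_of_pos (inv_pos.2 hA), inv_mul_le_iff₀ hA,
        NNReal.coe_one, one_mul, ← Real.dist_eq]
      refine (hφ.dist_le_mul a b).trans ?_
      gcongr
      linarith)).const_mul (A + 1 : ℝ)
    rw [integral_const_mul, mul_inv_cancel_left₀ hA.ne'] at h1
    refine h1.congr fun N => ?_
    rw [← Finset.mul_sum]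
    field_simp
  intro φ
  rw [Metric.tendsto_atTop]
  intro ε hε
  obtain ⟨A, ψ, hψ, hφψ⟩ := exists_lipschitz_approx φ.continuous (ε := ε / 4) (by positivity)
  obtain ⟨N₀, hN₀⟩ := Metric.tendsto_atTop.1 (hlip A ψ hψ) (ε / 4) (by positivity)
  refine ⟨N₀, fun N hN => ?_⟩
  have h1 := hN₀ N hN
  rw [Real.dist_eq] at h1 ⊢
  have h2 := abs_average_sub_average_le (by positivity) N fun i _ => hφψ (T^[i] x)
  have h3 : |(∫ y, φ y) - ∫ y, ψ y| ≤ ε / 4 := by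
    rw [← integral_sub (integrable_of_continuous φ.continuous)
      (integrable_of_continuous hψ.continuous)]
    have := norm_integral_le_of_norm_le_const (μ := (volume : Measure Torus))
      (f := fun z => φ z - ψ z) (C := ε / 4) (ae_of_all _ hφψ)
    simpa using this
  rw [abs_le] at h2 h3
  rw [abs_lt] at h1 ⊢
  constructor <;> linarith [h2.1, h2.2, h3.1, h3.2, h1.1, h1.2]

theorem good_initial : Stage.Good ⟨1, 4, 1, 1 / 8⟩ 0 where
  mem := liftGroup.one_mem
  q_pos := by norm_num
  coprime := isCoprime_one_left
  w_pos := by norm_num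
  w_le := le_rfl
  lipschitz := ⟨1, le_rfl, fun a b => by simp, by norm_num⟩
  mean φ hφ y _ := by
    have h1 := abs_integral_le_of_forall_le (c := 1) zero_le_one
      (f := fun u : ℝ => φ (proj (u, y)) - ∫ z, φ z) fun u _ =>
        (abs_sub_integral_le_half hφ _).trans (by norm_num)
    have h2 : IntervalIntegrable (fun u : ℝ => φ (proj (u, y))) volume 0 1 :=
      (hφ.continuous.comp (continuous_proj.comp (by fun_prop))).intervalIntegrable _ _
    rw [intervalIntegral.integral_sub h2 (by simp)] at h1
    simpa [circleMean] using h1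

theorem exists_stage_sequence {α : ℝ} (hα : 1 < α) :
    ∃ (s : ℕ → Stage) (R : ℕ → Equiv.Perm (ℝ × ℝ) × Equiv.Perm Torus) (l : ℕ → ℕ),
      (s 0).conj = 1 ∧ (s 0).w = 1 / 8 ∧ (∀ n, (s n).Good n) ∧
      ∀ n, (s n).Step α n (R n) (l n) (s (n + 1)) := by
  have key (n : ℕ) (s : {s : Stage // s.Good n}) :
      ∃ (s' : {s : Stage // s.Good (n + 1)}) (R : Equiv.Perm (ℝ × ℝ) × Equiv.Perm Torus) (l : ℕ),
        s.1.Step α n R l s'.1 := by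
    obtain ⟨R, l, s', h, h'⟩ := s.2.exists_step hα
    exact ⟨⟨s', h'⟩, R, l, h⟩
  choose next R l h using key
  let seq : (n : ℕ) → {s : Stage // s.Good n} :=
    fun n => Nat.rec ⟨_, good_initial⟩ (fun n s => next n s) n
  exact ⟨fun n => (seq n).1, fun n => R n (seq n), fun n => l n (seq n), rfl, rfl,
    fun n => (seq n).2, fun n => h n (seq n)⟩

section

variable {α : ℝ} {s : ℕ → Stage} {R : ℕ → Equiv.Perm (ℝ × ℝ) × Equiv.Perm Torus} {l : ℕ → ℕ}
  {T : Equiv.Perm Torus}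

theorem q_le_q_succ (hs : ∀ n, (s n).Step α n (R n) (l n) (s (n + 1)))
    (n : ℕ) : (s n).q ≤ (s (n + 1)).q := by
  rw [(hs n).q_eq]
  calc (s n).q ≤ (s n).q ^ 2 := Nat.le_self_pow two_ne_zero _
    _ ≤ l n * (s n).q ^ 2 := Nat.le_mul_of_pos_left _ (hs n).l_pos

theorem two_pow_mul_q_monotone
    (hs : ∀ n, (s n).Step α n (R n) (l n) (s (n + 1))) :
    Monotone fun n => 2 ^ n * (s n).q :=
  monotone_nat_of_le_succ fun n =>
    Nat.mul_le_mul (Nat.pow_le_pow_right two_pos n.le_succ) (q_le_q_succ hs n)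

/-- The window of times controlled at stage `n` lies in all later windows, so the distances between
successive approximants form a geometric series. -/
theorem dist_approx_iterate_le
    (hs : ∀ n, (s n).Step α n (R n) (l n) (s (n + 1)))
    (hT : ∀ i x, Tendsto (fun n => (s n).approx.2^[i] x) atTop (𝓝 (T^[i] x))) {n i : ℕ}
    (hi : i ≤ 2 ^ n * (s n).q) (x : Torus) :
    dist ((s n).approx.2^[i] x) (T^[i] x) ≤ 2 * (1 / 2) ^ n := by
  have h1 := dist_le_of_le_geometric_of_tendsto₀ (1 / 2) ((1 / 2) ^ n)
    (f := fun k => (s (n + k)).approx.2^[i] x) (by norm_num) (fun k => by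
      rw [dist_comm, ← pow_add]
      exact (hs (n + k)).orbit x i
        (hi.trans (two_pow_mul_q_monotone hs (Nat.le_add_right n k)))) (a := T^[i] x) (by
      have := (tendsto_add_atTop_iff_nat n).2 (hT i x)
      simpa only [add_comm] using this)
  refine h1.trans (le_of_eq ?_)
  norm_num
  ring

theorem exists_segment_preimage (h0 : (s 0).conj = 1)
    (hs : ∀ n, (s n).Step α n (R n) (l n) (s (n + 1))) {y : ℝ} (hy : |y| ≤ (s 0).w) (n : ℕ) :
    ∃ y', |y'| ≤ (s n).w ∧ (s n).conj.2 (proj (0, y')) = proj (0, y) := by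
  induction n with
  | zero => exact ⟨y, hy, by rw [h0]; rfl⟩
  | succ n ih =>
    obtain ⟨y₁, h1, h2⟩ := ih
    obtain ⟨y₂, h3, h4⟩ := (hs n).segment y₁ h1
    refine ⟨y₂, h3, ?_⟩
    rw [(hs n).conj_eq]
    change (s n).conj.2 ((R n).2 _) = _
    rw [h4, h2]

/-- All points of a vertical segment are generic. -/
theorem segment_mem_genericPoints (h0 : (s 0).conj = 1) (hg : ∀ n, (s n).Good n)
    (hs : ∀ n, (s n).Step α n (R n) (l n) (s (n + 1)))
    (hT : ∀ i x, Tendsto (fun n => (s n).approx.2^[i] x) atTop (𝓝 (T^[i] x))) {y : ℝ}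
    (hy : |y| ≤ (s 0).w) : proj (0, y) ∈ genericPoints T := by
  refine mem_genericPoints_of_lipschitz fun φ hφ => ?_
  have hmono := two_pow_mul_q_monotone hs
  -- In this window `N` is long enough for the averages of stage `n + 1` to be good, and short
  -- enough for `T` to follow the approximant of that stage.
  have hbound (n N : ℕ) (h1 : 2 ^ n * (s n).q ≤ N) (h2 : N ≤ 2 ^ (n + 1) * (s (n + 1)).q) :
      |(1 / (N : ℝ)) * ∑ i ∈ Finset.range N, φ (T^[i] (proj (0, y))) - ∫ z, φ z| ≤
        5 * (1 / 2) ^ n := by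
    obtain ⟨y', hy', h3⟩ := exists_segment_preimage h0 hs hy (n + 1)
    have h4 := (hs n).average φ hφ y' hy' N h1
    have h5 (i : ℕ) : (s (n + 1)).conj.2 (proj (i * ((s (n + 1)).p / (s (n + 1)).q), y')) =
        (s (n + 1)).approx.2^[i] (proj (0, y)) := by
      have h7 : (s (n + 1)).approx.2^[i] (proj (0, y)) = _ :=
        conj_rotation_iterate (s (n + 1)).conj.2 _ i _
      rw [h7, ← h3, Equiv.Perm.inv_def, Equiv.symm_apply_apply, rotation_apply_proj, zero_add]
    simp only [h5] at h4
    have h6 := abs_average_sub_average_le (a := fun i => φ (T^[i] (proj (0, y))))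
      (b := fun i => φ ((s (n + 1)).approx.2^[i] (proj (0, y)))) (ε := 2 * (1 / 2) ^ (n + 1))
      (by positivity) N fun i hi => by
        have h8 := hφ.dist_le_mul (T^[i] (proj (0, y))) ((s (n + 1)).approx.2^[i] (proj (0, y)))
        rw [NNReal.coe_one, one_mul, Real.dist_eq, dist_comm] at h8
        exact h8.trans (dist_approx_iterate_le hs hT (hi.le.trans h2) _)
    have h9 : (2 : ℝ) * (1 / 2) ^ (n + 1) = (1 / 2) ^ n := by rw [pow_succ]; ring
    rw [h9] at h6
    rw [abs_le] at h4 h6 ⊢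
    constructor <;> linarith [h4.1, h4.2, h6.1, h6.2]
  rw [Metric.tendsto_atTop]
  intro ε hε
  have hlim : Tendsto (fun n : ℕ => 5 * (1 / 2 : ℝ) ^ n) atTop (𝓝 0) := by
    simpa using (tendsto_pow_atTop_nhds_zero_of_lt_one (r := (1 / 2 : ℝ)) (by norm_num)
      (by norm_num)).const_mul 5
  obtain ⟨n₀, hn₀⟩ := eventually_atTop.1 (hlim.eventually (gt_mem_nhds hε))
  refine ⟨2 ^ n₀ * (s n₀).q, fun N hN => ?_⟩
  -- The windows of consecutive stages abut; the least such `m` is the right end of the one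
  -- containing `N`.
  have hex : ∃ m, N < 2 ^ m * (s m).q := ⟨N, by
    calc N < 2 ^ N := Nat.lt_two_pow_self
      _ ≤ 2 ^ N * (s N).q := Nat.le_mul_of_pos_right _ (hg N).q_pos⟩
  classical
  have h1 := Nat.find_spec hex
  have h2 : n₀ < Nat.find hex := by
    rw [Nat.lt_find_iff]
    intro m hm
    exact not_lt.2 ((hmono hm).trans hN)
  obtain ⟨n, hn⟩ := Nat.exists_eq_succ_of_ne_zero (by omega : Nat.find hex ≠ 0)
  rw [hn] at h1 h2
  have h3 : 2 ^ n * (s n).q ≤ N := not_lt.1 (Nat.find_min hex (m := n) (by omega))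
  rw [Real.dist_eq]
  exact (hbound n N h3 h1.le).trans_lt (hn₀ n (by omega))

end

/-! ### Points that eventually avoid the crosses are not generic. -/

theorem circleMean_eq_integral (Ψ : Torus → ℝ) (y : ℝ) :
    circleMean Ψ y = ∫ u : UnitAddCircle, Ψ (u, (y : UnitAddCircle)) := by
  have := UnitAddCircle.intervalIntegral_preimage 0
    fun u : UnitAddCircle => Ψ (u, (y : UnitAddCircle))
  rw [zero_add] at this
  exact this

theorem volume_norm_lt_le (δ : ℝ) :
    volume {u : UnitAddCircle | ‖u‖ < δ} ≤ ENNReal.ofReal (2 * δ) := by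
  have h : {u : UnitAddCircle | ‖u‖ < δ} ⊆ Metric.closedBall 0 δ := fun u hu => by
    rw [Metric.mem_closedBall, dist_zero_right]
    exact le_of_lt hu
  refine (measure_mono h).trans ?_
  rw [AddCircle.volume_closedBall]
  exact ENNReal.ofReal_le_ofReal (min_le_right _ _)

theorem measurableSet_norm_lt (δ : ℝ) : MeasurableSet {u : UnitAddCircle | ‖u‖ < δ} :=
  (isOpen_lt continuous_norm continuous_const).measurableSet

theorem volume_norm_nsmul_lt_le {q : ℕ} (hq : 0 < q) (δ : ℝ) :
    volume {u : UnitAddCircle | ‖q • u‖ < δ} ≤ ENNReal.ofReal (2 * δ) := by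
  have h := Measure.measurePreserving_zsmul (volume : Measure UnitAddCircle) (n := (q : ℤ))
    (by exact_mod_cast hq.ne')
  have h1 := h.measure_preimage (measurableSet_norm_lt δ).nullMeasurableSet
  simp only [natCast_zsmul] at h1
  exact h1.le.trans (volume_norm_lt_le δ)

theorem integral_tent_le (y : UnitAddCircle) :
    ∫ u : UnitAddCircle, max 0 (1 - 8 * ‖u - y‖) ≤ 1 / 4 := by
  have hm : MeasurableSet (Metric.closedBall y (1 / 8)) := Metric.isClosed_closedBall.measurableSet
  have h1 : ∫ u : UnitAddCircle, max 0 (1 - 8 * ‖u - y‖) ≤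
      ∫ u : UnitAddCircle, (Metric.closedBall y (1 / 8)).indicator (fun _ => (1 : ℝ)) u := by
    refine integral_mono ?_ ((integrable_const 1).indicator hm) fun u => ?_
    · have hc : Continuous fun u : UnitAddCircle => max 0 (1 - 8 * ‖u - y‖) := by fun_prop
      exact hc.integrable_of_hasCompactSupport (HasCompactSupport.of_compactSpace _)
    · by_cases hu : u ∈ Metric.closedBall y (1 / 8)
      · simp only [Set.indicator_of_mem hu]
        exact max_le zero_le_one (by linarith [norm_nonneg (u - y)])
      · simp only [Set.indicator_of_notMem hu]
        rw [Metric.mem_closedBall, not_le, dist_eq_norm] at hu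
        exact max_le le_rfl (by linarith)
  refine h1.trans ?_
  rw [integral_indicator_const _ hm, measureReal_def, AddCircle.volume_closedBall,
    ENNReal.toReal_ofReal (le_min zero_le_one (by norm_num))]
  norm_num

section

variable {α : ℝ} {s : ℕ → Stage} {R : ℕ → Equiv.Perm (ℝ × ℝ) × Equiv.Perm Torus} {l : ℕ → ℕ}
  {T : Equiv.Perm Torus} {K : ℕ → ℕ} {x : Torus} {n₀ : ℕ}

theorem two_pow_le_q {s : Stage} {n : ℕ} (h : s.Good n) : (2 : ℝ) ^ n ≤ s.q := by
  obtain ⟨L, hL, -, hLq⟩ := h.lipschitz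
  have hq : (0 : ℝ) < s.q := by exact_mod_cast h.q_pos
  have h1 : 1 / (s.q : ℝ) ≤ (1 / 2) ^ (n + 2) := le_trans (by gcongr) hLq
  have h2 : (1 / 2 : ℝ) ^ (n + 2) ≤ (1 / 2) ^ n :=
    pow_le_pow_of_le_one (by norm_num) (by norm_num) (by omega)
  have h3 := h1.trans h2
  rw [one_div_pow] at h3
  exact (one_div_le_one_div hq (by positivity)).1 h3

/-- Off the cross `R n` is the identity, so passing to the next stage does not move the pullback of
`x`. -/
theorem conj_inv_eq_of_notMem_cross (hs : ∀ n, (s n).Step α n (R n) (l n) (s (n + 1)))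
    (hR : ∀ n, ∀ z ∉ cross (s n).q (1 / K n), (R n).2 z = z)
    (hx : ∀ n ≥ n₀, (s n).conj.2⁻¹ x ∉ cross (s n).q (1 / K n)) {n : ℕ} (hn : n₀ ≤ n) :
    (s n).conj.2⁻¹ x = (s n₀).conj.2⁻¹ x := by
  induction n, hn using Nat.le_induction with
  | base => rfl
  | succ n hn ih =>
    rw [← ih, (hs n).conj_eq, Prod.snd_mul, mul_inv_rev, Equiv.Perm.mul_apply,
      Equiv.Perm.inv_def, Equiv.symm_apply_eq]
    exact (hR n _ (hx n hn)).symm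

theorem conj_apply_eq_of_notMem_cross (hs : ∀ n, (s n).Step α n (R n) (l n) (s (n + 1)))
    (hR : ∀ n, ∀ z ∉ cross (s n).q (1 / K n), (R n).2 z = z) {w : Torus} {n : ℕ} (hn : n₀ ≤ n)
    (hw : ∀ m ∈ Finset.Ico n₀ n, w ∉ cross (s m).q (1 / K m)) :
    (s n).conj.2 w = (s n₀).conj.2 w := by
  induction n, hn using Nat.le_induction with
  | base => rfl
  | succ n hn ih =>
    rw [(hs n).conj_eq, Prod.snd_mul, Equiv.Perm.mul_apply,
      hR n w (hw n (Finset.mem_Ico.2 ⟨hn, n.lt_succ_self⟩))]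
    exact ih fun m hm => hw m (Finset.Ico_subset_Ico_right n.le_succ hm)

theorem sum_Ico_half_pow_le (a b : ℕ) :
    ∑ m ∈ Finset.Ico a b, 2 * (1 / 2 : ℝ) ^ (m + 4) ≤ 1 / 4 := by
  calc ∑ m ∈ Finset.Ico a b, 2 * (1 / 2 : ℝ) ^ (m + 4)
      ≤ ∑ m ∈ Finset.range b, 2 * (1 / 2 : ℝ) ^ (m + 4) := by
        refine Finset.sum_le_sum_of_subset_of_nonneg (fun m hm => ?_) fun _ _ _ => by positivity
        exact Finset.mem_range.2 (Finset.mem_Ico.1 hm).2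
    _ = 1 / 8 * ∑ m ∈ Finset.range b, (1 / 2 : ℝ) ^ m := by
        rw [Finset.mul_sum]
        exact Finset.sum_congr rfl fun m _ => by rw [pow_add]; ring
    _ ≤ 1 / 8 * 2 := by
        gcongr
        exact sum_geometric_two_le b
    _ = 1 / 4 := by norm_num

/-- Most of a horizontal circle that avoids the supports of the later conjugating diffeomorphisms
is not moved by them. -/
theorem three_quarters_le_circleMean (hg : ∀ n, (s n).Good n)
    (hs : ∀ n, (s n).Step α n (R n) (l n) (s (n + 1)))
    (hR : ∀ n, ∀ z ∉ cross (s n).q (1 / K n), (R n).2 z = z)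
    (hK : ∀ n, 1 / (K n : ℝ) ≤ (1 / 2) ^ (n + 4)) {y : ℝ}
    (hy : ∀ n ≥ n₀, 1 / (K n : ℝ) ≤ ‖(y : UnitAddCircle)‖) {φ : Torus → ℝ} (hφ : Continuous φ)
    (hφ0 : ∀ w, 0 ≤ φ w)
    (hφ1 : ∀ u : UnitAddCircle, φ ((s n₀).conj.2 (u, (y : UnitAddCircle))) = 1) {n : ℕ}
    (hn : n₀ ≤ n) : 3 / 4 ≤ circleMean (fun w => φ ((s n).conj.2 w)) y := by
  rw [circleMean_eq_integral]
  set B : ℕ → Set UnitAddCircle := fun m => {u | ‖(s m).q • u‖ < 1 / K m} with hB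
  have hBm (m : ℕ) : MeasurableSet (B m) :=
    (isOpen_lt (continuous_norm.comp (continuous_const_smul _)) continuous_const).measurableSet
  have hBv (m : ℕ) : volume.real (B m) ≤ 2 * (1 / 2) ^ (m + 4) := by
    refine ENNReal.toReal_le_of_le_ofReal (by positivity) ?_
    refine (volume_norm_nsmul_lt_le (hg m).q_pos _).trans (ENNReal.ofReal_le_ofReal ?_)
    have := hK m
    gcongr
  have hint (m : ℕ) : Integrable ((B m).indicator fun _ => (1 : ℝ)) volume :=
    (integrable_const 1).indicator (hBm m)
  -- A point of the circle meets a later support only through a vertical strip `B m`, since the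
  -- height `y` avoids the horizontal ones. The strips have total length at most `1 / 4`.
  have hpt (u : UnitAddCircle) : 1 - ∑ m ∈ Finset.Ico n₀ n, (B m).indicator (fun _ => (1 : ℝ)) u ≤
      φ ((s n).conj.2 (u, (y : UnitAddCircle))) := by
    by_cases hu : ∃ m ∈ Finset.Ico n₀ n, u ∈ B m
    · obtain ⟨m, hm, hum⟩ := hu
      have h1 := Finset.single_le_sum
        (f := fun m => (B m).indicator (fun _ => (1 : ℝ)) u)
        (fun m _ => Set.indicator_nonneg (fun _ _ => zero_le_one) u) hm
      simp only [Set.indicator_of_mem hum] at h1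
      exact le_trans (by linarith) (hφ0 _)
    · push Not at hu
      have h1 : (s n).conj.2 (u, (y : UnitAddCircle)) = (s n₀).conj.2 (u, (y : UnitAddCircle)) := by
        refine conj_apply_eq_of_notMem_cross hs hR hn fun m hm hc => hc ⟨?_, ?_⟩
        · exact not_lt.1 (hu m hm)
        · exact hy m (Finset.mem_Ico.1 hm).1
      rw [h1, hφ1, sub_le_self_iff]
      exact Finset.sum_nonneg fun m _ => Set.indicator_nonneg (fun _ _ => zero_le_one) u
  have hc : Continuous fun u : UnitAddCircle => φ ((s n).conj.2 (u, (y : UnitAddCircle))) :=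
    hφ.comp ((continuous_of_mem_liftGroup (hg n).mem).comp (by fun_prop))
  have h2 := integral_mono ((integrable_const 1).sub (integrable_finsetSum _ fun m _ => hint m))
    (hc.integrable_of_hasCompactSupport (HasCompactSupport.of_compactSpace _)) hpt
  refine le_trans ?_ h2
  rw [integral_sub' (integrable_const _) (integrable_finsetSum _ fun m _ => hint m),
    integral_finsetSum _ fun m _ => hint m]
  simp only [integral_indicator_const _ (hBm _), smul_eq_mul, mul_one, integral_const,
    probReal_univ]
  have h3 := (Finset.sum_le_sum fun m (_ : m ∈ Finset.Ico n₀ n) => hBv m).trans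
    (sum_Ico_half_pow_le n₀ n)
  linarith

/-- A point whose pullbacks eventually avoid the supports of the conjugating diffeomorphisms is not
generic. -/
theorem notMem_genericPoints (hg : ∀ n, (s n).Good n)
    (hs : ∀ n, (s n).Step α n (R n) (l n) (s (n + 1)))
    (hT : ∀ i x, Tendsto (fun n => (s n).approx.2^[i] x) atTop (𝓝 (T^[i] x)))
    (hR : ∀ n, ∀ z ∉ cross (s n).q (1 / K n), (R n).2 z = z)
    (hK : ∀ n, 1 / (K n : ℝ) ≤ (1 / 2) ^ (n + 4))
    (hx : ∀ n ≥ n₀, (s n).conj.2⁻¹ x ∉ cross (s n).q (1 / K n)) : x ∉ genericPoints T := by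
  intro hgen
  obtain ⟨⟨a, b⟩, hz⟩ := proj_surjective ((s n₀).conj.2⁻¹ x)
  have hzn {n : ℕ} (hn : n₀ ≤ n) : (s n).conj.2⁻¹ x = proj (a, b) := by
    rw [conj_inv_eq_of_notMem_cross hs hR hx hn, hz]
  have hb (n : ℕ) (hn : n ≥ n₀) : 1 / (K n : ℝ) ≤ ‖(b : UnitAddCircle)‖ := by
    have h1 := hx n hn
    rw [hzn hn, cross, Set.mem_ofPred_eq, not_not] at h1
    exact h1.2
  obtain ⟨C, hC0, hC⟩ := lipschitz_of_mem_liftGroup (liftGroup.inv_mem (hg n₀).mem)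
  -- A tent over the circle at height `b`, equal to `1` on it and supported in a band of area `1 /
  -- 4`. Transported by the conjugacy of stage `n₀`, it separates the averages at times `qₙ`, close
  -- to at least `3 / 4`, from the space average, at most `1 / 4`.
  set ψ : Torus → ℝ := fun w => max 0 (1 - 8 * ‖w.2 - (b : UnitAddCircle)‖) with hψ
  have hψl (v w : Torus) : |ψ v - ψ w| ≤ 8 * dist v w := by
    refine (abs_max_sub_max_le_max _ _ _ _).trans (max_le (by simp [dist_nonneg]) ?_)
    rw [sub_sub_sub_cancel_left, ← mul_sub, abs_mul, abs_of_pos (by norm_num : (0 : ℝ) < 8)]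
    gcongr
    refine (abs_norm_sub_norm_le _ _).trans ?_
    rw [sub_sub_sub_cancel_right, ← dist_eq_norm, dist_comm]
    exact le_max_right _ _
  set φ : Torus → ℝ := fun w => ψ ((s n₀).conj⁻¹.2 w) with hφ
  have hφl (v w : Torus) : |φ v - φ w| ≤ 8 * C * dist v w :=
    (hψl _ _).trans (by rw [mul_assoc]; gcongr; exact hC v w)
  have hφc : Continuous φ := continuous_of_abs_sub_le hφl
  have hφ0 (w : Torus) : 0 ≤ φ w := le_max_left _ _
  have hφ1 (u : UnitAddCircle) : φ ((s n₀).conj.2 (u, (b : UnitAddCircle))) = 1 := by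
    simp [hφ, hψ]
  have hint : ∫ w, φ w ≤ 1 / 4 := by
    have hmp := (hg n₀).mem.2.2.2.2
    have h1 : ∫ w, φ w = ∫ w, ψ w := by
      have h2 := integral_map hmp.measurable.aemeasurable (f := ψ) (μ := volume)
        (continuous_of_abs_sub_le hψl).aestronglyMeasurable
      rw [hmp.map_eq] at h2
      exact h2.symm
    have hsnd : MeasurePreserving (Prod.snd : Torus → UnitAddCircle) volume volume :=
      measurePreserving_snd
    have h3 : ∫ w, ψ w = ∫ u : UnitAddCircle, max 0 (1 - 8 * ‖u - b‖) := by
      have hc : Continuous fun u : UnitAddCircle => max 0 (1 - 8 * ‖u - b‖) := by fun_prop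
      have h2 := integral_map hsnd.measurable.aemeasurable (μ := volume)
        (f := fun u : UnitAddCircle => max 0 (1 - 8 * ‖u - b‖)) hc.aestronglyMeasurable
      rw [hsnd.map_eq] at h2
      exact h2.symm
    rw [h1, h3]
    exact integral_tent_le _
  have hq : Tendsto (fun n => (s n).q) atTop atTop := by
    rw [← tendsto_natCast_atTop_iff (R := ℝ)]
    exact tendsto_atTop_mono (fun n => two_pow_le_q (hg n))
      (tendsto_pow_atTop_atTop_of_one_lt one_lt_two)
  have hlim := (hgen ⟨φ, hφc⟩).comp hq
  simp only [ContinuousMap.coe_mk, Function.comp_def] at hlim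
  -- Of the `24 * C`, a third comes from replacing the periodic orbit by the circle it samples, and
  -- the rest from replacing `T` by the approximant.
  have hlow : ∀ n ≥ n₀, 3 / 4 - 24 * C * (1 / 2) ^ n ≤
      (1 / ((s n).q : ℝ)) * ∑ i ∈ Finset.range (s n).q, φ (T^[i] x) := by
    intro n hn
    obtain ⟨L, hL1, hL, hLq⟩ := (hg n).lipschitz
    have hqpos : (0 : ℝ) < (s n).q := by exact_mod_cast (hg n).q_pos
    have hΨ (v w : Torus) : |φ ((s n).conj.2 v) - φ ((s n).conj.2 w)| ≤ 8 * C * L * dist v w :=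
      (hφl _ _).trans (by rw [mul_assoc (8 * C)]; gcongr; exact hL v w)
    have h1 := abs_sum_sub_circleMean_le (by positivity) hΨ (hg n).q_pos a b
    have h2 := three_quarters_le_circleMean hg hs hR hK hb hφc hφ0 hφ1 hn
    have h3 : ∑ i ∈ Finset.range (s n).q, φ ((s n).approx.2^[i] x) =
        ∑ j ∈ Finset.range (s n).q, φ ((s n).conj.2 (proj (a + j / (s n).q, b))) := by
      have h4 := sum_mul_div_eq_sum_div
        (fun t => φ ((s n).conj.2 ((a : UnitAddCircle) + t, (b : UnitAddCircle)))) (hg n).q_pos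
        (hg n).coprime
      have h5 (i : ℕ) : (s n).approx.2^[i] x =
          (s n).conj.2 (proj (a + i * (s n).p / (s n).q, b)) := by
        have h7 : (s n).approx.2^[i] x = _ := conj_rotation_iterate (s n).conj.2 _ i _
        rw [h7, hzn hn, rotation_apply_proj, mul_div_assoc]
      simp only [h5]
      exact h4
    rw [← h3] at h1
    have h6 := abs_average_sub_average_le (a := fun i => φ (T^[i] x))
      (b := fun i => φ ((s n).approx.2^[i] x)) (ε := 8 * C * (2 * (1 / 2) ^ n))
      (by positivity) (s n).q fun i hi => (hφl _ _).trans (by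
        gcongr
        rw [dist_comm]
        exact dist_approx_iterate_le hs hT
          (hi.le.trans (Nat.le_mul_of_pos_left _ (by positivity))) x)
    have h8 : 8 * C * L ≤ 8 * C * (1 / 2) ^ n * (s n).q := by
      rw [mul_assoc (8 * C)]
      gcongr
      rw [div_le_iff₀ hqpos] at hLq
      refine hLq.trans ?_
      gcongr ?_ * _
      exact pow_le_pow_of_le_one (by norm_num) (by norm_num) (by omega)
    have h9 : 3 / 4 - 8 * C * (1 / 2) ^ n ≤
        (1 / ((s n).q : ℝ)) * ∑ i ∈ Finset.range (s n).q, φ ((s n).approx.2^[i] x) := by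
      rw [one_div ((s n).q : ℝ), le_inv_mul_iff₀ hqpos]
      have := (abs_le.1 h1).1
      nlinarith
    have := (abs_le.1 h6).1
    linarith
  have hlim2 : Tendsto (fun n : ℕ => 3 / 4 - 24 * C * (1 / 2 : ℝ) ^ n) atTop (𝓝 (3 / 4)) := by
    simpa using ((tendsto_pow_atTop_nhds_zero_of_lt_one (r := (1 / 2 : ℝ)) (by norm_num)
      (by norm_num)).const_mul (24 * C)).const_sub (3 / 4)
  have := le_of_tendsto_of_tendsto hlim2 hlim (eventually_atTop.2 ⟨n₀, hlow⟩)
  linarith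

end

-- Covers of the crosses, measure and Hausdorff dimension.

end Torus

/-- Borel–Cantelli for Hausdorff measure: for each `N` the families of index at least `N` cover the
limsup set, and their `d`-sums are tails of a convergent series. -/
theorem MeasureTheory.Measure.hausdorffMeasure_setOf_frequently_eq_zero {X : Type*} [MetricSpace X]
    [MeasurableSpace X] [BorelSpace X] {ι : ℕ → Type*} [∀ n, Fintype (ι n)] {d : ℝ} (hd : 0 ≤ d)
    {t : ∀ n, ι n → Set X} {r : ℕ → ℝ} (hr0 : ∀ n, 0 ≤ r n)
    (hr : Tendsto r atTop (𝓝 0)) (ht : ∀ n i, Metric.ediam (t n i) ≤ ENNReal.ofReal (r n))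
    (hs : Summable fun n => Fintype.card (ι n) * r n ^ d) :
    μH[d] {x | ∃ᶠ n in atTop, ∃ i, x ∈ t n i} = 0 := by
  -- `r` need not be monotone, so the mesh of the `N`-th cover is a supremum over the tail.
  set ρ : ℕ → ℝ := fun N => ⨆ k, r (k + N) with hρ
  have hbdd (N : ℕ) : BddAbove (Set.range fun k => r (k + N)) :=
    ((tendsto_add_atTop_iff_nat N).2 hr).bddAbove_range
  have hρ0 : Tendsto ρ atTop (𝓝 0) := by
    rw [Metric.tendsto_atTop] at hr ⊢
    intro ε hε
    obtain ⟨N, hN⟩ := hr (ε / 2) (half_pos hε)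
    refine ⟨N, fun n hn => ?_⟩
    rw [Real.dist_0_eq_abs, abs_of_nonneg (Real.iSup_nonneg fun k => hr0 _)]
    refine lt_of_le_of_lt (ciSup_le fun k => ?_) (half_lt_self hε)
    have := hN (k + n) (by omega)
    rw [Real.dist_0_eq_abs] at this
    exact (le_abs_self _).trans this.le
  set f : ℕ → ℝ≥0∞ := fun n => ∑ i, Metric.ediam (t n i) ^ d with hf
  have hf' (n : ℕ) : f n ≤ ENNReal.ofReal (Fintype.card (ι n) * r n ^ d) := by
    calc f n ≤ ∑ _i : ι n, ENNReal.ofReal (r n ^ d) := by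
          refine Finset.sum_le_sum fun i _ => ?_
          rw [← ENNReal.ofReal_rpow_of_nonneg (hr0 n) hd]
          exact ENNReal.rpow_le_rpow (ht n i) hd
      _ = _ := by
          rw [Finset.sum_const, nsmul_eq_mul, ENNReal.ofReal_mul (by positivity),
            ENNReal.ofReal_natCast, Finset.card_univ]
  have hfs : ∑' n, f n ≠ ⊤ :=
    ne_top_of_le_ne_top hs.tsum_ofReal_ne_top (ENNReal.tsum_le_tsum hf')
  have h := Measure.hausdorffMeasure_le_liminf_tsum d {x | ∃ᶠ n in atTop, ∃ i, x ∈ t n i}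
    (ι := fun N => Σ k, ι (k + N)) (l := atTop) (fun N => ENNReal.ofReal (ρ N))
    (by simpa using ENNReal.tendsto_ofReal hρ0) (fun N i => t (i.1 + N) i.2)
    (Eventually.of_forall fun N i => (ht _ _).trans
      (ENNReal.ofReal_le_ofReal (le_ciSup (hbdd N) i.1)))
    (Eventually.of_forall fun N x hx => by
      obtain ⟨n, hn, i, hi⟩ := frequently_atTop.1 hx N
      obtain ⟨k, rfl⟩ := Nat.exists_eq_add_of_le' hn
      exact Set.mem_iUnion.2 ⟨⟨k, i⟩, hi⟩)
  simp only [ENNReal.tsum_sigma', tsum_fintype] at h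
  rw [(ENNReal.tendsto_sum_nat_add f hfs).liminf_eq] at h
  exact le_antisymm h bot_le

namespace Torus

theorem exists_fin_coe_int_div_eq {q : ℕ} (hq : 0 < q) (r : ℤ) :
    ∃ j : Fin q, (((r : ℝ) / q : ℝ) : UnitAddCircle) = ((j : ℕ) / q : ℝ) := by
  have hq' : (0 : ℤ) < q := by exact_mod_cast hq
  have h0 := Int.emod_nonneg r hq'.ne'
  have h1 := Int.emod_lt_of_pos r hq'
  refine ⟨⟨(r % q).toNat, by omega⟩, ?_⟩
  have h2 : (((r % q).toNat : ℕ) : ℝ) = ((r % q : ℤ) : ℝ) := by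
    exact_mod_cast Int.toNat_of_nonneg h0
  have h3 : (r : ℝ) = ((r % q : ℤ) : ℝ) + q * ((r / q : ℤ) : ℝ) := by
    exact_mod_cast (Int.emod_add_mul_ediv r q).symm
  have hq0 : (q : ℝ) ≠ 0 := by exact_mod_cast hq.ne'
  have h4 : (r : ℝ) / q = ((r % q : ℤ) : ℝ) / q + ((r / q : ℤ) : ℝ) := by
    rw [h3]
    field_simp
  simp only [h2]
  rw [h4, AddCircle.coe_add]
  simp

/-- Multiplication by `q` expands the distance to the nearest multiple of `1 / q` by the factor `q`.
-/
theorem exists_fin_dist_div_le {q : ℕ} (hq : 0 < q) (u : UnitAddCircle) :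
    ∃ j : Fin q, q * dist u (((j : ℕ) / q : ℝ) : UnitAddCircle) ≤ ‖q • u‖ := by
  obtain ⟨a, rfl⟩ := QuotientAddGroup.mk_surjective u
  obtain ⟨j, hj⟩ := exists_fin_coe_int_div_eq hq (round (q * a))
  have hq0 : (0 : ℝ) < q := by exact_mod_cast hq
  refine ⟨j, ?_⟩
  rw [← hj]
  have h1 : ‖q • (a : UnitAddCircle)‖ = |q * a - round (q * a)| := by
    rw [← AddCircle.coe_nsmul, nsmul_eq_mul, UnitAddCircle.norm_eq]
  refine le_of_le_of_eq ?_ h1.symm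
  refine (mul_le_mul_of_nonneg_left (UnitAddCircle.dist_coe_le a _) hq0.le).trans (le_of_eq ?_)
  rw [Real.dist_eq, ← abs_of_pos hq0, ← abs_mul, abs_of_pos hq0, mul_sub, mul_div_cancel₀ _ hq0.ne']

theorem exists_fin_dist_div_le_inv {K : ℕ} (hK : 0 < K) (u : UnitAddCircle) :
    ∃ m : Fin K, dist u (((m : ℕ) / K : ℝ) : UnitAddCircle) ≤ 1 / K := by
  obtain ⟨m, hm⟩ := exists_fin_dist_div_le hK u
  refine ⟨m, ?_⟩
  rw [le_div_iff₀' (by exact_mod_cast hK)]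
  refine hm.trans ((AddCircle.norm_le_half_period 1 one_ne_zero).trans ?_)
  norm_num

/-- The centres of balls of radius `1 / K` that cover `cross q (1 / K)`. -/
noncomputable def crossCenter (q K : ℕ) : Option (Fin q) × Fin K → Torus
  | (none, m) => proj ((m : ℕ) / K, 0)
  | (some j, m) => proj ((j : ℕ) / q, (m : ℕ) / K)

theorem exists_mem_closedBall_crossCenter {q K : ℕ} (hq : 0 < q) (hK : 0 < K) {z : Torus}
    (hz : z ∈ cross q (1 / K)) : ∃ i, z ∈ Metric.closedBall (crossCenter q K i) (1 / K) := by
  rw [cross, Set.mem_ofPred_eq, not_and_or, not_le, not_le] at hz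
  rcases hz with hz | hz
  · obtain ⟨j, hj⟩ := exists_fin_dist_div_le hq z.1
    obtain ⟨m, hm⟩ := exists_fin_dist_div_le_inv hK z.2
    refine ⟨(some j, m), max_le (le_trans ?_ (hj.trans hz.le)) hm⟩
    exact le_mul_of_one_le_left dist_nonneg (by exact_mod_cast hq)
  · obtain ⟨m, hm⟩ := exists_fin_dist_div_le_inv hK z.1
    refine ⟨(none, m), max_le hm ?_⟩
    change dist z.2 ((0 : ℝ) : UnitAddCircle) ≤ _
    rw [AddCircle.coe_zero, dist_zero_right]
    exact hz.le

theorem volume_cross_le {q : ℕ} (hq : 0 < q) {δ : ℝ} (hδ : 0 ≤ δ) :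
    volume (cross q δ) ≤ ENNReal.ofReal (4 * δ) := by
  have h : cross q δ ⊆ {u : UnitAddCircle | ‖q • u‖ < δ} ×ˢ Set.univ ∪
      Set.univ ×ˢ {u : UnitAddCircle | ‖u‖ < δ} := fun z hz => by
    rw [cross, Set.mem_ofPred_eq, not_and_or, not_le, not_le] at hz
    simpa using! hz
  refine (measure_mono h).trans ((measure_union_le _ _).trans ?_)
  rw [Measure.volume_eq_prod, Measure.prod_prod, Measure.prod_prod, measure_univ, one_mul, mul_one]
  refine (add_le_add (volume_norm_nsmul_lt_le hq δ) (volume_norm_lt_le δ)).trans (le_of_eq ?_)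
  rw [← ENNReal.ofReal_add (by positivity) (by positivity)]
  ring_nf

section

variable {α : ℝ} {s : ℕ → Stage} {R : ℕ → Equiv.Perm (ℝ × ℝ) × Equiv.Perm Torus} {l : ℕ → ℕ}
  {T : Equiv.Perm Torus}

theorem frequently_mem_cross_of_mem_genericPoints {K : ℕ → ℕ} (hg : ∀ n, (s n).Good n)
    (hs : ∀ n, (s n).Step α n (R n) (l n) (s (n + 1)))
    (hT : ∀ i x, Tendsto (fun n => (s n).approx.2^[i] x) atTop (𝓝 (T^[i] x)))
    (hR : ∀ n, ∀ z ∉ cross (s n).q (1 / K n), (R n).2 z = z)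
    (hK : ∀ n, 1 / (K n : ℝ) ≤ (1 / 2) ^ (n + 4)) {x : Torus} (hx : x ∈ genericPoints T) :
    ∃ᶠ n in atTop, (s n).conj.2⁻¹ x ∈ cross (s n).q (1 / K n) := by
  by_contra h
  obtain ⟨n₀, hn₀⟩ := eventually_atTop.1 (not_frequently.1 h)
  exact notMem_genericPoints hg hs hT hR hK hn₀ hx

theorem volume_genericPoints_eq_zero (hg : ∀ n, (s n).Good n)
    (hs : ∀ n, (s n).Step α n (R n) (l n) (s (n + 1)))
    (hT : ∀ i x, Tendsto (fun n => (s n).approx.2^[i] x) atTop (𝓝 (T^[i] x))) :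
    volume (genericPoints T) = 0 := by
  choose L K hL1 hK0 hL hK1 hK2 hK3 hR using fun n => (hs n).support
  refine measure_mono_null
    (fun x hx => frequently_mem_cross_of_mem_genericPoints hg hs hT hR hK1 hx)
    (measure_setOfPred_frequently_eq_zero ?_)
  have h1 (n : ℕ) : volume {x | (s n).conj.2⁻¹ x ∈ cross (s n).q (1 / K n)} ≤
      ENNReal.ofReal ((1 / 2) ^ n) := by
    have hmp : MeasurePreserving ⇑(s n).conj.2⁻¹ volume volume := (hg n).mem.2.2.2.2
    have hme : MeasurableEmbedding ⇑(s n).conj.2⁻¹ :=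
      (MeasurableEquiv.mk (s n).conj.2⁻¹ hmp.measurable
        (hg n).mem.2.2.2.1.measurable).measurableEmbedding
    refine le_of_eq_of_le (hmp.measure_preimage_emb hme _)
      ((volume_cross_le (hg n).q_pos (by positivity)).trans (ENNReal.ofReal_le_ofReal ?_))
    have := hK1 n
    rw [pow_add] at this
    have h2 : (0 : ℝ) ≤ (1 / 2) ^ n := by positivity
    linarith
  exact ne_top_of_le_ne_top
    (summable_geometric_of_lt_one (by norm_num) (by norm_num)).tsum_ofReal_ne_top
    (ENNReal.tsum_le_tsum h1)

/-- The limsup set is covered by images of balls of radius `1 / K n` under maps with Lipschitz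
constant `L n`, so its `α`-dimensional Hausdorff measure is zero. -/
theorem dimH_genericPoints_le (hα : 0 ≤ α) (hg : ∀ n, (s n).Good n)
    (hs : ∀ n, (s n).Step α n (R n) (l n) (s (n + 1)))
    (hT : ∀ i x, Tendsto (fun n => (s n).approx.2^[i] x) atTop (𝓝 (T^[i] x))) :
    dimH (genericPoints T) ≤ ENNReal.ofReal α := by
  choose L K hL1 hK0 hL hK1 hK2 hK3 hR using fun n => (hs n).support
  have hr0 (n : ℕ) : 0 ≤ 2 * L n / K n := by
    have := hL1 n
    positivity
  have hgeom := summable_geometric_of_lt_one (r := (1 / 2 : ℝ)) (by norm_num) (by norm_num)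
  have h0 := Measure.hausdorffMeasure_setOf_frequently_eq_zero hα
    (t := fun n i => (s n).conj.2 '' Metric.closedBall (crossCenter (s n).q (K n) i) (1 / K n))
    hr0 (squeeze_zero hr0 hK2 hgeom.tendsto_atTop_zero)
    (fun n i => by
      refine Metric.ediam_le ?_
      rintro _ ⟨a, ha, rfl⟩ _ ⟨b, hb, rfl⟩
      rw [edist_dist]
      refine ENNReal.ofReal_le_ofReal ((hL n a b).trans ?_)
      have h1 := (dist_triangle_right a b _).trans (add_le_add ha hb)
      refine (mul_le_mul_of_nonneg_left h1 (zero_le_one.trans (hL1 n))).trans (le_of_eq ?_)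
      ring)
    (hgeom.of_nonneg_of_le
      (fun n => mul_nonneg (by positivity) (Real.rpow_nonneg (hr0 n) _)) fun n => by
        have := hK3 n
        simpa using this)
  refine dimH_le_of_hausdorffMeasure_ne_top (d := α.toNNReal) ?_
  rw [Real.coe_toNNReal _ hα]
  refine ne_top_of_le_ne_top ENNReal.zero_ne_top
    (le_of_le_of_eq (measure_mono fun x hx => ?_) h0)
  refine (frequently_mem_cross_of_mem_genericPoints hg hs hT hR hK1 hx).mono fun n hn => ?_
  obtain ⟨i, hi⟩ := exists_mem_closedBall_crossCenter (hg n).q_pos (hK0 n) hn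
  exact ⟨i, _, hi, Equiv.apply_symm_apply _ _⟩

theorem one_le_dimH_of_segment_subset {A : Set Torus} {w : ℝ} (hw : 0 < w) (hw' : w ≤ 1 / 8)
    (h : ∀ y, |y| ≤ w → proj (0, y) ∈ A) : 1 ≤ dimH A := by
  have hf : Isometry fun y : Set.Icc (-w) w => proj (0, (y : ℝ)) := by
    refine Isometry.of_dist_eq fun y z => ?_
    have h1 : ‖(((y : ℝ) - z : ℝ) : UnitAddCircle)‖ = |(y : ℝ) - z| := by
      refine (AddCircle.norm_coe_eq_abs_iff 1 one_ne_zero).2 ?_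
      have := y.2.1
      have := y.2.2
      have := z.2.1
      have := z.2.2
      rw [abs_one, abs_le]
      constructor <;> linarith
    rw [Prod.dist_eq, proj, proj, dist_self, dist_eq_norm, ← AddCircle.coe_sub, h1,
      max_eq_right (abs_nonneg _), Subtype.dist_eq, Real.dist_eq]
  have h1 : dimH (Set.Icc (-w) w) = 1 := by
    rw [Real.dimH_of_nonempty_interior, Module.finrank_self, Nat.cast_one]
    rw [interior_Icc]
    exact ⟨0, by constructor <;> linarith⟩
  have h2 : dimH (Set.univ : Set (Set.Icc (-w) w)) = 1 := by
    rw [← isometry_subtype_coe.dimH_image, Set.image_univ, Subtype.range_coe, h1]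
  rw [← h2, ← hf.dimH_image]
  refine dimH_mono ?_
  rintro _ ⟨y, -, rfl⟩
  exact h _ (abs_le.2 y.2)

/-! ### Assembling the theorem. -/

theorem conjugacy_eq_conj (h0 : (s 0).conj = 1)
    (hs : ∀ n, (s n).Step α n (R n) (l n) (s (n + 1))) (n : ℕ) :
    conjugacy (fun n => (R n).2) n = (s n).conj.2 := by
  induction n with
  | zero => rw [h0]; rfl
  | succ n ih => rw [conjugacy, ih, (hs n).conj_eq]; rfl

theorem isAbC_of_step (h0 : (s 0).conj = 1) (hg : ∀ n, (s n).Good n)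
    (hs : ∀ n, (s n).Step α n (R n) (l n) (s (n + 1)))
    (hT : DiffeoTendsto (fun n => (s (n + 1)).approx.2) T) : IsAbC T := by
  refine ⟨fun n => (R n).2, fun n => (s n).p, fun n => (s n).q, fun _ => 1, l,
    fun n => isSmoothAreaPreservingDiffeo_of_mem_liftGroup (hs n).mem, fun n => (hg n).q_pos,
    fun _ => one_pos, fun n => (hs n).l_pos, fun n => ?_, fun n => ?_, fun n => (hs n).comm, ?_⟩
  · simp [(hs n).p_eq]
  · simp [(hs n).q_eq]
  · simp only [conjugacy_eq_conj h0 hs]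
    exact hT

end

end Torus

theorem theoremD (α : ℝ) (hα₁ : 1 < α) (hα₂ : α < 2) :
    ∃ T : Equiv.Perm Torus,
      Torus.IsSmoothAreaPreservingDiffeo T ∧
      Torus.IsAbC T ∧
      volume (Torus.genericPoints T) = 0 ∧
      ENNReal.ofReal (α - 1) ≤ dimH (Torus.genericPoints T) ∧
      dimH (Torus.genericPoints T) ≤ ENNReal.ofReal α := by
  obtain ⟨s, R, l, h0, hw, hg, hs⟩ := Torus.exists_stage_sequence hα₁
  have hle (n : ℕ) : (1 / 2 : ℝ) ^ (n + 1) ≤ (1 / 2) ^ n :=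
    pow_le_pow_of_le_one (by norm_num) (by norm_num) n.le_succ
  -- The sequence starts at stage `1` because `IsAbC` uses the approximants of index `n + 1`.
  obtain ⟨Q, hQ, hlim, hiter⟩ := Torus.exists_limit_diffeo (P := fun n => (s (n + 1)).approx)
    (fun n => Torus.Stage.approx_mem (hg (n + 1)))
    (fun n k hk z => ((hs (n + 1)).deriv k (hk.trans n.le_succ) z).trans (hle n))
    (fun n k hk z => ((hs (n + 1)).deriv_symm k (hk.trans n.le_succ) z).trans (hle n))
  have hT (i : ℕ) (x : Torus) :
      Tendsto (fun n => (s n).approx.2^[i] x) atTop (𝓝 (Q.2^[i] x)) :=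
    (tendsto_add_atTop_iff_nat 1).1 (hiter i x)
  refine ⟨Q.2, Torus.isSmoothAreaPreservingDiffeo_of_mem_liftGroup hQ,
    Torus.isAbC_of_step h0 hg hs hlim, Torus.volume_genericPoints_eq_zero hg hs hT, ?_,
    Torus.dimH_genericPoints_le (zero_le_one.trans hα₁.le) hg hs hT⟩
  -- The segment already gives dimension at least `1`, and `α - 1 ≤ 1`.
  refine le_trans (ENNReal.ofReal_le_one.2 (by linarith)) ?_
  exact Torus.one_le_dimH_of_segment_subset (w := 1 / 8) (by norm_num) le_rfl fun y hy =>
    Torus.segment_mem_genericPoints h0 hg hs hT (by rwa [hw])
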